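/- For $f\in L_2(-\pi,\pi)$ real-valued put $\gamma_f(k)=\int_{-\pi}^{\pi}e^{\mathrm{i}k\omega}f(\omega)\,d\omega$, $k\in\mathbb{Z}$. For $\alpha>0$ and $M>0$ let $\Sigma_{\alpha,M}$ be the set of all $f\in L_2(-\pi,\pi)$ that satisfy $$|\gamma_f(0)|^2+\sum_{k=-\infty}^{\infty}|k|^{2\alpha}|\gamma_f(k)|^2\le M,\qquad f(\omega)\ge M^{-1},\quad f(\omega)=f(-\omega)\quad\text{for all }\omega\in[-\pi,\pi].$$ For experiments $\mathcal{E}=(P_f,\ f\in\Sigma)$ and $\mathcal{F}=(Q_f,\ f\in\Sigma)$ with the same parameter set let $\delta(\mathcal{E},\mathcal{F})=\inf_K\sup_{f\in\Sigma}\|Q_f-KP_f\|_{TV}$, where $K$ runs over all Markov kernels from the sample space of $\mathcal{E}$ to that of $\mathcal{F}$, and let $\Delta(\mathcal{E},\mathcal{F})=\max(\delta(\mathcal{E},\mathcal{F}),\delta(\mathcal{F},\mathcal{E}))$ be Le Cam's distance. **Theorem.** Let $\alpha>1/2$, $M>0$ and $\Sigma\subseteq\Sigma_{\alpha,M}$.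 For $n\ge1$ let $\mathcal{E}_n=(N_n(0,\Gamma_n(f)),\ f\in\Sigma)$ with $\Gamma_n(f)=(\gamma_f(k-j))_{j,k=1,\dots,n}$, that is, one observes $y(1),\dots,y(n)$ from a stationary centered Gaussian sequence with spectral density $f$. Let $\mathring{\mathcal{E}}_n$ be the experiment, indexed by $f\in\Sigma$, in which one observes independent $z_j\sim N(0,J_{j,n}(f))$, $j=1,\dots,n$, where $$J_{j,n}(f)=n\int_{(j-1)/n}^{j/n}f(2\pi x-\pi)\,dx .$$ Then the two sequences of experiments are asymptotically equivalent: $\Delta(\mathcal{E}_n,\mathring{\mathcal{E}}_n)\to0$ as $n\to\infty$. -/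

import Mathlib

open MeasureTheory ProbabilityTheory Filter
open scoped ENNReal Topology

noncomputable section

namespace SpectralEquivalence

/-! ### Le Cam's distance between statistical experiments -/

/-- Total variation distance `sup_A |P(A) - Q(A)|` over measurable sets `A`. -/
def tvDist {X : Type*} [MeasurableSpace X] (P Q : Measure X) : ℝ≥0∞ :=
  ⨆ (A : Set X) (_ : MeasurableSet A), ENNReal.ofReal |P.real A - Q.real A|

/-- Deficiency `δ(P, Q) = inf_K sup_θ ‖Q_θ - K P_θ‖_TV` of the experiment `(P_θ)` with respect to
the experiment `(Q_θ)`; the infimum runs over all Markov kernels between the sample spaces. -/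
def deficiency {Θ X Y : Type*} [MeasurableSpace X] [MeasurableSpace Y]
    (P : Θ → Measure X) (Q : Θ → Measure Y) : ℝ≥0∞ :=
  ⨅ (K : Kernel X Y) (_ : IsMarkovKernel K), ⨆ θ : Θ, tvDist (Q θ) ((P θ).bind K)

/-- Le Cam's pseudodistance `Δ` between two experiments with the same parameter space. -/
def leCamDist {Θ X Y : Type*} [MeasurableSpace X] [MeasurableSpace Y]
    (P : Θ → Measure X) (Q : Θ → Measure Y) : ℝ≥0∞ :=
  max (deficiency P Q) (deficiency Q P)

/-- Two sequences of experiments with the same parameter space (the sample spaces may vary with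
`n`) are asymptotically equivalent if their Le Cam distance tends to `0`. -/
def AsympEquiv {Θ : Type*} {X Y : ℕ → Type*} [∀ n, MeasurableSpace (X n)]
    [∀ n, MeasurableSpace (Y n)]
    (P : ∀ n, Θ → Measure (X n)) (Q : ∀ n, Θ → Measure (Y n)) : Prop :=
  Tendsto (fun n => leCamDist (P n) (Q n)) atTop (𝓝 0)

/-! ### Spectral densities -/

/-- Fourier coefficient `γ_f(h) = ∫_{-π}^{π} exp(i h ω) f(ω) dω`. -/
def fourierCoef (f : ℝ → ℝ) (h : ℤ) : ℂ :=
  ∫ ω in (-Real.pi)..Real.pi, Complex.exp (Complex.I * h * ω) * (f ω : ℂ)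

/-- The Sobolev ball `W^α(M)`: square integrable functions on `[-π, π]` with
`γ_f(0)² + ∑_k |k|^{2α} γ_f(k)² ≤ M`. -/
def sobolevBall (α M : ℝ) : Set (ℝ → ℝ) :=
  {f | MemLp f 2 (volume.restrict (Set.Icc (-Real.pi) Real.pi)) ∧
    Summable (fun k : ℤ => |(k : ℝ)| ^ (2 * α) * ‖fourierCoef f k‖ ^ 2) ∧
    ‖fourierCoef f 0‖ ^ 2 + ∑' k : ℤ, |(k : ℝ)| ^ (2 * α) * ‖fourierCoef f k‖ ^ 2 ≤ M}

/-- The even functions on `[-π, π]` bounded below by `1 / M`. -/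
def evenBoundedBelow (M : ℝ) : Set (ℝ → ℝ) :=
  {f | ∀ ω ∈ Set.Icc (-Real.pi) Real.pi, M⁻¹ ≤ f ω ∧ f ω = f (-ω)}

/-- The class `Σ_{α,M}` of spectral densities. A spectral density is represented by a function
`ℝ → ℝ`, of which only the values on `[-π, π]` matter. -/
def spectralClass (α M : ℝ) : Set (ℝ → ℝ) :=
  sobolevBall α M ∩ evenBoundedBelow M

/-! ### The two experiments -/

/-- Autocovariance function of a stationary sequence with (even) spectral density `f`; the Fourier
coefficients are then real, see `fourierCoef_eq_autocov`. -/
def autocov (f : ℝ → ℝ) (h : ℤ) : ℝ := (fourierCoef f h).re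

/-- The `n × n` Toeplitz covariance matrix `Γ_n(f)`, with entries `γ_f(k - j)`. -/
def toeplitz (n : ℕ) (f : ℝ → ℝ) : Matrix (Fin n) (Fin n) ℝ :=
  Matrix.of fun j k => autocov f ((k : ℤ) - (j : ℤ))

/-- The law `N_n(0, Γ_n(f))` of `n` successive values of a centered stationary Gaussian sequence
with spectral density `f`. -/
def timeSeriesLaw (n : ℕ) (f : ℝ → ℝ) : Measure (EuclideanSpace ℝ (Fin n)) :=
  multivariateGaussian 0 (toeplitz n f)

/-- The local average `J_{j,n}(f) = n ∫_{(j-1)/n}^{j/n} f(2πx - π) dx`, for `j = 1, …, n`. -/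
def localAverage (n j : ℕ) (f : ℝ → ℝ) : ℝ :=
  n * ∫ x in (((j : ℝ) - 1) / n)..((j : ℝ) / n), f (2 * Real.pi * x - Real.pi)

/-- The joint law of independent variables `z_j ~ N(0, J_{j,n}(f))`, `j = 1, …, n`
(`j : Fin n` stands for the index `j + 1`). -/
def scaleLaw (n : ℕ) (f : ℝ → ℝ) : Measure (Fin n → ℝ) :=
  Measure.pi fun j : Fin n => gaussianReal 0 (localAverage n ((j : ℕ) + 1) f).toNNReal

/-! ### The covariance matrix is real and positive semidefinite on the class -/

theorem intervalIntegrable_of_mem {α M : ℝ} {f : ℝ → ℝ} (hf : f ∈ spectralClass α M) :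
    IntervalIntegrable f volume (-Real.pi) Real.pi := by
  rw [intervalIntegrable_iff_integrableOn_Icc_of_le (by linarith [Real.pi_pos])]
  exact hf.1.1.integrable (by norm_num)

theorem autocov_eq_integral {α M : ℝ} {f : ℝ → ℝ} (hf : f ∈ spectralClass α M) (h : ℤ) :
    autocov f h = ∫ ω in (-Real.pi)..Real.pi, Real.cos (h * ω) * f ω := by
  have hi := intervalIntegrable_of_mem hf
  have hc : IntervalIntegrable
      (fun ω : ℝ => Complex.exp (Complex.I * h * ω) * (f ω : ℂ)) volume
      (-Real.pi) Real.pi := by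
    refine IntervalIntegrable.continuousOn_mul (g := fun ω : ℝ => Complex.exp (Complex.I * h * ω))
      (f := fun ω => (f ω : ℂ)) ?_ (by fun_prop)
    exact ⟨hi.1.ofReal, hi.2.ofReal⟩
  have := intervalIntegral.intervalIntegral_re (𝕜 := ℂ) hc
  simp only [RCLike.re_eq_complex_re] at this
  unfold autocov fourierCoef
  rw [← this]
  refine intervalIntegral.integral_congr fun ω _ => ?_
  have e : Complex.I * (h : ℂ) * (ω : ℂ) = ((h * ω : ℝ) : ℂ) * Complex.I := by
    push_cast; ring
  simp only [e, Complex.re_mul_ofReal, Complex.exp_ofReal_mul_I_re]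

theorem fourierCoef_eq_autocov {α M : ℝ} {f : ℝ → ℝ} (hf : f ∈ spectralClass α M) (h : ℤ) :
    fourierCoef f h = (autocov f h : ℂ) := by
  have hpi := Real.pi_pos
  have hconj : (starRingEnd ℂ) (fourierCoef f h) = fourierCoef f h := by
    unfold fourierCoef
    have h1 : -Real.pi ≤ Real.pi := by linarith
    rw [intervalIntegral.integral_of_le h1, ← integral_conj,
      ← intervalIntegral.integral_of_le h1, ← intervalIntegral.integral_of_le h1]
    have h2 := intervalIntegral.integral_comp_neg (a := -Real.pi) (b := Real.pi)
      (fun ω : ℝ => Complex.exp (Complex.I * h * ω) * (f ω : ℂ))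
    rw [neg_neg] at h2
    rw [← h2]
    refine intervalIntegral.integral_congr fun ω hω => ?_
    rw [Set.uIcc_of_le (by linarith)] at hω
    have h3 := (hf.2 ω hω).2
    simp only [map_mul, ← Complex.exp_conj, Complex.conj_I, Complex.conj_ofReal, map_intCast,
      h3, Complex.ofReal_neg]
    congr 2
    ring
  exact (Complex.conj_eq_iff_re.mp hconj).symm

theorem toeplitz_posSemidef {α M : ℝ} (hM : 0 < M) {f : ℝ → ℝ} (hf : f ∈ spectralClass α M)
    (n : ℕ) : (toeplitz n f).PosSemidef := by
  have hpi := Real.pi_pos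
  have hi := intervalIntegrable_of_mem hf
  refine Matrix.PosSemidef.of_dotProduct_mulVec_nonneg ?_ fun x => ?_
  · ext j k
    simp only [toeplitz, Matrix.conjTranspose_apply, Matrix.of_apply, star_trivial,
      autocov_eq_integral hf]
    refine intervalIntegral.integral_congr fun ω _ => ?_
    have e : (((j : ℤ) - (k : ℤ) : ℤ) : ℝ) * ω = -((((k : ℤ) - (j : ℤ) : ℤ) : ℝ) * ω) := by
      push_cast; ring
    simp only [e, Real.cos_neg]
  · have hsum : star x ⬝ᵥ (toeplitz n f).mulVec x =
        ∫ ω in (-Real.pi)..Real.pi,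
          ((∑ j : Fin n, x j * Real.cos ((j : ℕ) * ω)) ^ 2 +
            (∑ j : Fin n, x j * Real.sin ((j : ℕ) * ω)) ^ 2) * f ω := by
      have hint : ∀ j k : Fin n, IntervalIntegrable
          (fun ω => x j * x k * (Real.cos ((((k : ℤ) - (j : ℤ) : ℤ) : ℝ) * ω) * f ω))
          volume (-Real.pi) Real.pi := fun j k =>
        (hi.continuousOn_mul (by fun_prop)).const_mul _
      have e1 : star x ⬝ᵥ (toeplitz n f).mulVec x = ∑ j : Fin n, ∑ k : Fin n,
          ∫ ω in (-Real.pi)..Real.pi,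
            x j * x k * (Real.cos ((((k : ℤ) - (j : ℤ) : ℤ) : ℝ) * ω) * f ω) := by
        simp only [dotProduct, Matrix.mulVec, toeplitz, Matrix.of_apply, star_trivial,
          autocov_eq_integral hf, Finset.mul_sum, intervalIntegral.integral_const_mul]
        refine Finset.sum_congr rfl fun j _ => Finset.sum_congr rfl fun k _ => ?_
        ring
      rw [e1]
      simp_rw [← intervalIntegral.integral_finsetSum fun k _ => hint _ k]
      rw [← intervalIntegral.integral_finsetSum fun j _ => by
        simpa only [Finset.sum_fn] using IntervalIntegrable.sum Finset.univ fun k _ => hint j k]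
      refine intervalIntegral.integral_congr fun ω _ => ?_
      simp only [sq, Finset.sum_mul_sum]
      simp only [← Finset.sum_add_distrib, Finset.sum_mul]
      refine Finset.sum_congr rfl fun j _ => Finset.sum_congr rfl fun k _ => ?_
      push_cast
      rw [sub_mul, Real.cos_sub]
      ring
    rw [hsum]
    refine intervalIntegral.integral_nonneg (by linarith) fun ω hω => ?_
    have := (hf.2 ω hω).1
    have h0 : 0 ≤ f ω := (inv_pos.mpr hM).le.trans this
    positivity

end SpectralEquivalence

end

noncomputable section

namespace SpectralEquivalence

/-! ### Total variation distance and deficiency -/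

section TotalVariation

variable {X Y Z Θ : Type*} [MeasurableSpace X] [MeasurableSpace Y] [MeasurableSpace Z]

theorem tvDist_le {P Q : Measure X} {c : ℝ}
    (h : ∀ A, MeasurableSet A → |P.real A - Q.real A| ≤ c) : tvDist P Q ≤ ENNReal.ofReal c :=
  iSup₂_le fun A hA => ENNReal.ofReal_le_ofReal (h A hA)

theorem ofReal_abs_sub_le_tvDist (P Q : Measure X) {A : Set X} (hA : MeasurableSet A) :
    ENNReal.ofReal |P.real A - Q.real A| ≤ tvDist P Q :=
  le_iSup₂_of_le A hA le_rfl

theorem tvDist_le_one (P Q : Measure X) [IsProbabilityMeasure P] [IsProbabilityMeasure Q] :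
    tvDist P Q ≤ 1 := by
  rw [← ENNReal.ofReal_one]
  refine tvDist_le fun A _ => ?_
  have h1 : P.real A ≤ 1 := measureReal_le_one
  have h2 : Q.real A ≤ 1 := measureReal_le_one
  have h3 : 0 ≤ P.real A := measureReal_nonneg
  have h4 : 0 ≤ Q.real A := measureReal_nonneg
  rw [abs_le]; constructor <;> linarith

theorem abs_sub_le_toReal_tvDist (P Q : Measure X) [IsProbabilityMeasure P]
    [IsProbabilityMeasure Q] {A : Set X} (hA : MeasurableSet A) :
    |P.real A - Q.real A| ≤ (tvDist P Q).toReal := by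
  have h := ofReal_abs_sub_le_tvDist P Q hA
  rwa [ENNReal.ofReal_le_iff_le_toReal
    ((tvDist_le_one P Q).trans_lt ENNReal.one_lt_top).ne] at h

theorem tvDist_comm (P Q : Measure X) : tvDist P Q = tvDist Q P := by
  simp only [tvDist, abs_sub_comm]

theorem tvDist_triangle (P Q R : Measure X) : tvDist P R ≤ tvDist P Q + tvDist Q R := by
  refine iSup₂_le fun A hA => ?_
  calc ENNReal.ofReal |P.real A - R.real A|
      ≤ ENNReal.ofReal (|P.real A - Q.real A| + |Q.real A - R.real A|) :=
        ENNReal.ofReal_le_ofReal (abs_sub_le _ _ _)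
    _ ≤ ENNReal.ofReal |P.real A - Q.real A| + ENNReal.ofReal |Q.real A - R.real A| :=
        ENNReal.ofReal_add_le
    _ ≤ _ := add_le_add (ofReal_abs_sub_le_tvDist _ _ hA) (ofReal_abs_sub_le_tvDist _ _ hA)

theorem tvDist_map_le (P Q : Measure X) {g : X → Y} (hg : Measurable g) :
    tvDist (P.map g) (Q.map g) ≤ tvDist P Q := by
  refine iSup₂_le fun A hA => ?_
  rw [map_measureReal_apply hg hA, map_measureReal_apply hg hA]
  exact ofReal_abs_sub_le_tvDist _ _ (hg hA)

theorem measureReal_bind_apply (P : Measure X) [IsProbabilityMeasure P] (K : Kernel X Y)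
    [IsMarkovKernel K] {A : Set Y} (hA : MeasurableSet A) :
    (P.bind K).real A = ∫ x, (K x).real A ∂P := by
  rw [measureReal_def, Measure.bind_apply hA K.measurable.aemeasurable,
    integral_eq_lintegral_of_nonneg_ae (Eventually.of_forall fun _ => measureReal_nonneg)
      ((K.measurable_coe hA).ennreal_toReal.aestronglyMeasurable)]
  congr 1
  refine lintegral_congr fun x => ?_
  rw [measureReal_def, ENNReal.ofReal_toReal (measure_ne_top _ _)]

theorem abs_integral_sub_integral_le (P Q : Measure X) [IsProbabilityMeasure P]
    [IsProbabilityMeasure Q] {h : X → ℝ} (hm : Measurable h) (h0 : ∀ x, 0 ≤ h x)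
    (h1 : ∀ x, h x ≤ 1) : |∫ x, h x ∂P - ∫ x, h x ∂Q| ≤ (tvDist P Q).toReal := by
  have key : ∀ ρ : Measure X, IsProbabilityMeasure ρ →
      ∫ x, h x ∂ρ = ∫ t in (0 : ℝ)..1, ρ.real {a | t ≤ h a} := by
    intro ρ _
    have hi : Integrable h ρ := Integrable.of_bound hm.aestronglyMeasurable 1
      (Eventually.of_forall fun x => by rw [Real.norm_of_nonneg (h0 x)]; exact h1 x)
    rw [hi.integral_eq_integral_Ioc_meas_le (Eventually.of_forall h0) (Eventually.of_forall h1),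
      intervalIntegral.integral_of_le zero_le_one]
  have hint : ∀ ρ : Measure X, IsProbabilityMeasure ρ →
      IntervalIntegrable (fun t => ρ.real {a | t ≤ h a}) volume 0 1 := by
    intro ρ _
    refine AntitoneOn.intervalIntegrable fun s _ t _ hst => ?_
    exact measureReal_mono (fun a (ha : t ≤ h a) => hst.trans ha)
  rw [key P inferInstance, key Q inferInstance,
    ← intervalIntegral.integral_sub (hint P inferInstance) (hint Q inferInstance)]
  have := intervalIntegral.norm_integral_le_of_norm_le_const (a := (0 : ℝ)) (b := 1)
    (C := (tvDist P Q).toReal) (f := fun t => P.real {a | t ≤ h a} - Q.real {a | t ≤ h a})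
    (fun t _ => abs_sub_le_toReal_tvDist P Q (measurableSet_le measurable_const hm))
  simpa using this

theorem tvDist_bind_le (P Q : Measure X) [IsProbabilityMeasure P] [IsProbabilityMeasure Q]
    (K : Kernel X Y) [IsMarkovKernel K] : tvDist (P.bind K) (Q.bind K) ≤ tvDist P Q := by
  rw [← ENNReal.ofReal_toReal ((tvDist_le_one P Q).trans_lt ENNReal.one_lt_top).ne]
  refine tvDist_le fun A hA => ?_
  rw [measureReal_bind_apply P K hA, measureReal_bind_apply Q K hA]
  exact abs_integral_sub_integral_le P Q (K.measurable_coe hA).ennreal_toReal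
    (fun _ => measureReal_nonneg) (fun _ => measureReal_le_one)

theorem tvDist_prod_left_le (P Q : Measure X) (R : Measure Y) [IsProbabilityMeasure P]
    [IsProbabilityMeasure Q] [IsProbabilityMeasure R] :
    tvDist (P.prod R) (Q.prod R) ≤ tvDist P Q := by
  rw [← ENNReal.ofReal_toReal ((tvDist_le_one P Q).trans_lt ENNReal.one_lt_top).ne]
  refine tvDist_le fun A hA => ?_
  have key : ∀ S : Measure X, IsProbabilityMeasure S →
      (S.prod R).real A = ∫ x, R.real (Prod.mk x ⁻¹' A) ∂S := by
    intro S _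
    rw [measureReal_def, Measure.prod_apply hA,
      integral_eq_lintegral_of_nonneg_ae (Eventually.of_forall fun _ => measureReal_nonneg)
        ((measurable_measure_prodMk_left hA).ennreal_toReal.aestronglyMeasurable)]
    congr 1
    refine lintegral_congr fun x => ?_
    rw [measureReal_def, ENNReal.ofReal_toReal (measure_ne_top _ _)]
  rw [key P inferInstance, key Q inferInstance]
  exact abs_integral_sub_integral_le P Q (measurable_measure_prodMk_left hA).ennreal_toReal
    (fun _ => measureReal_nonneg) (fun _ => measureReal_le_one)

theorem deficiency_le_of_map {P : Θ → Measure X} {Q : Θ → Measure Y} {g : X → Y}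
    (hg : Measurable g) {c : ℝ≥0∞} (h : ∀ θ, tvDist (Q θ) ((P θ).map g) ≤ c) :
    deficiency P Q ≤ c := by
  refine iInf₂_le_of_le (Kernel.deterministic g hg) inferInstance (iSup_le fun θ => ?_)
  rw [Measure.deterministic_comp_eq_map hg]
  exact h θ

/-- Randomisation by an independent variable of law `ν`. -/
theorem deficiency_le_of_prod_map {P : Θ → Measure X} {Q : Θ → Measure Y} (ν : Measure Z)
    [IsProbabilityMeasure ν] [∀ θ, IsProbabilityMeasure (P θ)] {g : X × Z → Y}
    (hg : Measurable g) {c : ℝ≥0∞} (h : ∀ θ, tvDist (Q θ) (((P θ).prod ν).map g) ≤ c) :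
    deficiency P Q ≤ c := by
  refine iInf₂_le_of_le ((Kernel.id ×ₖ Kernel.const X ν).map g)
    (Kernel.IsMarkovKernel.map _ hg) (iSup_le fun θ => ?_)
  have e : (P θ).bind ((Kernel.id ×ₖ Kernel.const X ν).map g) = ((P θ).prod ν).map g := by
    ext A hA
    rw [Measure.bind_apply hA (Kernel.measurable _).aemeasurable, Measure.map_apply hg hA,
      Measure.prod_apply (hg hA)]
    refine lintegral_congr fun x => ?_
    rw [Kernel.map_apply' _ hg _ hA, Kernel.prod_apply, Kernel.id_apply, Kernel.const_apply,
      Measure.prod_apply (hg hA), lintegral_dirac' _ (measurable_measure_prodMk_left (hg hA))]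
  rw [e]
  exact h θ

theorem deficiency_triangle (P : Θ → Measure X) (Q : Θ → Measure Y) (R : Θ → Measure Z)
    [∀ θ, IsProbabilityMeasure (P θ)] [∀ θ, IsProbabilityMeasure (Q θ)] :
    deficiency P R ≤ deficiency P Q + deficiency Q R := by
  simp only [deficiency, ENNReal.iInf_add, ENNReal.add_iInf]
  refine le_iInf₂ fun L hL => le_iInf₂ fun K hK => ?_
  refine iInf₂_le_of_le (L ∘ₖ K) inferInstance (iSup_le fun θ => ?_)
  have e : (P θ).bind (L ∘ₖ K) = ((P θ).bind K).bind L := by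
    rw [Measure.comp_assoc]
  have : IsProbabilityMeasure ((P θ).bind K) := inferInstance
  rw [e]
  calc tvDist (R θ) (((P θ).bind K).bind L)
      ≤ tvDist (R θ) ((Q θ).bind L) + tvDist ((Q θ).bind L) (((P θ).bind K).bind L) :=
        tvDist_triangle _ _ _
    _ ≤ tvDist (R θ) ((Q θ).bind L) + tvDist (Q θ) ((P θ).bind K) := by
        gcongr; exact tvDist_bind_le _ _ _
    _ ≤ _ := by
        rw [add_comm]
        exact add_le_add (le_iSup (fun θ => tvDist (Q θ) ((P θ).bind K)) θ)
          (le_iSup (fun θ => tvDist (R θ) ((Q θ).bind L)) θ)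

end TotalVariation

/-! ### Total variation distance between products of centered Gaussian laws -/

section GaussianProduct

variable {ι : Type*} [Fintype ι]

/-- The density of `N(0, v)` with respect to `N(0, 1)`. -/
def gaussianRatio (v : ℝ) (x : ℝ) : ℝ := (√v)⁻¹ * Real.exp (-((v⁻¹ - 1) / 2) * x ^ 2)

theorem gaussianRatio_nonneg (v x : ℝ) : 0 ≤ gaussianRatio v x := by
  unfold gaussianRatio; positivity

theorem gaussianPDFReal_mul_gaussianRatio {v : ℝ} (hv : 0 < v) (x : ℝ) :
    gaussianPDFReal 0 1 x * gaussianRatio v x = gaussianPDFReal 0 v.toNNReal x := by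
  have h2 : √(2 * Real.pi * v) = √(2 * Real.pi) * √v := Real.sqrt_mul (by positivity) _
  simp only [gaussianPDFReal, gaussianRatio, NNReal.coe_one, mul_one, sub_zero,
    Real.coe_toNNReal _ hv.le, h2, mul_inv]
  rw [show (√(2 * Real.pi))⁻¹ * Real.exp (-x ^ 2 / 2) *
      ((√v)⁻¹ * Real.exp (-((v⁻¹ - 1) / 2) * x ^ 2)) = (√(2 * Real.pi))⁻¹ * (√v)⁻¹ *
      (Real.exp (-x ^ 2 / 2) * Real.exp (-((v⁻¹ - 1) / 2) * x ^ 2)) by ring, ← Real.exp_add]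
  congr 2
  field_simp
  ring

theorem gaussianReal_eq_ofReal_setIntegral {v : ℝ} (hv : 0 < v) {s : Set ℝ}
    (hs : MeasurableSet s) :
    gaussianReal 0 v.toNNReal s =
      ENNReal.ofReal (∫ x, s.indicator (gaussianRatio v) x ∂(gaussianReal 0 1)) := by
  rw [gaussianReal_apply_eq_integral 0 (by simpa using hv),
    integral_gaussianReal_eq_integral_smul one_ne_zero, ← integral_indicator hs]
  congr 2
  ext x
  by_cases hx : x ∈ s
  · simp [hx, gaussianPDFReal_mul_gaussianRatio hv]
  · simp [hx]

theorem integrable_gaussianReal_iff {g : ℝ → ℝ} {v : NNReal} (hv : v ≠ 0) :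
    Integrable g (gaussianReal 0 v) ↔ Integrable (fun x => gaussianPDFReal 0 v x * g x) := by
  rw [gaussianReal_of_var_ne_zero _ hv, integrable_withDensity_iff_integrable_smul'
    (measurable_gaussianPDF _ _) (ae_of_all _ fun _ => gaussianPDF_lt_top)]
  simp [toReal_gaussianPDF]

theorem integrable_gaussianRatio {v : ℝ} (hv : 0 < v) :
    Integrable (gaussianRatio v) (gaussianReal 0 1) := by
  rw [integrable_gaussianReal_iff one_ne_zero]
  simp only [gaussianPDFReal_mul_gaussianRatio hv]
  exact integrable_gaussianPDFReal _ _

theorem integral_gaussianRatio {v : ℝ} (hv : 0 < v) :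
    ∫ x, gaussianRatio v x ∂(gaussianReal 0 1) = 1 := by
  rw [integral_gaussianReal_eq_integral_smul one_ne_zero]
  simp only [smul_eq_mul, gaussianPDFReal_mul_gaussianRatio hv]
  exact integral_gaussianPDFReal_eq_one _ (by simpa using hv)

theorem gaussianPDFReal_mul_gaussianRatio_sq {v : ℝ} (x : ℝ) :
    gaussianPDFReal 0 1 x * gaussianRatio v x ^ 2 =
      (√(2 * Real.pi))⁻¹ * (√v)⁻¹ ^ 2 * Real.exp (-(v⁻¹ - 1 / 2) * x ^ 2) := by
  simp only [gaussianPDFReal, gaussianRatio, NNReal.coe_one, mul_one, sub_zero, mul_pow,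
    ← Real.exp_nat_mul]
  rw [show (√(2 * Real.pi))⁻¹ * Real.exp (-x ^ 2 / 2) *
      ((√v)⁻¹ ^ 2 * Real.exp ((2 : ℕ) * (-((v⁻¹ - 1) / 2) * x ^ 2))) =
      (√(2 * Real.pi))⁻¹ * (√v)⁻¹ ^ 2 * (Real.exp (-x ^ 2 / 2) *
        Real.exp ((2 : ℕ) * (-((v⁻¹ - 1) / 2) * x ^ 2))) by ring, ← Real.exp_add]
  congr 2
  push_cast
  ring

theorem integrable_gaussianRatio_sq {v : ℝ} (hv : 0 < v) (hv2 : v < 2) :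
    Integrable (fun x => gaussianRatio v x ^ 2) (gaussianReal 0 1) := by
  rw [integrable_gaussianReal_iff one_ne_zero]
  simp only [gaussianPDFReal_mul_gaussianRatio_sq]
  refine (integrable_exp_neg_mul_sq ?_).const_mul _
  rw [sub_pos, ← one_div]
  exact one_div_lt_one_div_of_lt hv hv2

theorem integral_gaussianRatio_sq {v : ℝ} (hv : 0 < v) (hv2 : v < 2) :
    ∫ x, gaussianRatio v x ^ 2 ∂(gaussianReal 0 1) = (√(1 - (v - 1) ^ 2))⁻¹ := by
  rw [integral_gaussianReal_eq_integral_smul one_ne_zero]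
  simp only [smul_eq_mul, gaussianPDFReal_mul_gaussianRatio_sq]
  have hb : 0 < v⁻¹ - 1 / 2 := by
    rw [sub_pos, ← one_div]
    exact one_div_lt_one_div_of_lt hv hv2
  rw [integral_const_mul, integral_gaussian]
  have h1 : 0 < 1 - (v - 1) ^ 2 := by nlinarith
  rw [← Real.sqrt_inv, ← Real.sqrt_inv, ← Real.sqrt_inv, Real.sq_sqrt (by positivity)]
  have e : v⁻¹ = √(v⁻¹ ^ 2) := (Real.sqrt_sq (by positivity)).symm
  rw [e, ← Real.sqrt_mul (by positivity), ← Real.sqrt_mul (by positivity), ← e]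
  congr 1
  have : 2 - v ≠ 0 := by linarith
  have h3 : v⁻¹ - 1 / 2 = (2 - v) / (2 * v) := by field_simp
  have h4 : 1 - (v - 1) ^ 2 = v * (2 - v) := by ring
  rw [h3, h4]
  have hpi := Real.pi_pos
  field_simp

theorem pi_gaussianReal_eq_withDensity {v : ι → ℝ} (hv : ∀ i, 0 < v i) :
    Measure.pi (fun i => gaussianReal 0 (v i).toNNReal) =
      (Measure.pi fun _ : ι => gaussianReal 0 1).withDensity
        (fun x => ENNReal.ofReal (∏ i, gaussianRatio (v i) (x i))) := by
  refine Measure.pi_eq fun s hs => ?_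
  have hS : MeasurableSet (Set.univ.pi s) := MeasurableSet.univ_pi hs
  have hint : Integrable (fun x : ι → ℝ => ∏ i, gaussianRatio (v i) (x i))
      (Measure.pi fun _ : ι => gaussianReal 0 1) :=
    Integrable.fintype_prod fun i => integrable_gaussianRatio (hv i)
  rw [withDensity_apply _ hS, ← ofReal_integral_eq_lintegral_ofReal hint.integrableOn
    (ae_of_all _ fun x => Finset.prod_nonneg fun i _ => gaussianRatio_nonneg _ _),
    ← integral_indicator hS]
  have e : (Set.univ.pi s).indicator (fun x : ι → ℝ => ∏ i, gaussianRatio (v i) (x i)) =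
      fun x => ∏ i, (s i).indicator (gaussianRatio (v i)) (x i) := by
    ext x
    by_cases hx : x ∈ Set.univ.pi s
    · rw [Set.indicator_of_mem hx]
      exact Finset.prod_congr rfl fun i _ => by
        rw [Set.indicator_of_mem (hx i (Set.mem_univ i))]
    · rw [Set.indicator_of_notMem hx]
      simp only [Set.mem_univ_pi, not_forall] at hx
      obtain ⟨i, hi⟩ := hx
      exact (Finset.prod_eq_zero (Finset.mem_univ i) (Set.indicator_of_notMem hi _)).symm
  rw [e, integral_fintype_prod_eq_prod, ENNReal.ofReal_prod_of_nonneg]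
  · exact Finset.prod_congr rfl fun i _ => (gaussianReal_eq_ofReal_setIntegral (hv i) (hs i)).symm
  · exact fun i _ => integral_nonneg fun x =>
      Set.indicator_nonneg (fun y _ => gaussianRatio_nonneg _ y) x

theorem integral_abs_le_sqrt_integral_sq {Ω : Type*} [MeasurableSpace Ω] {P : Measure Ω}
    [IsProbabilityMeasure P] {u : Ω → ℝ} (hu : MemLp u 2 P) :
    ∫ x, |u x| ∂P ≤ √(∫ x, u x ^ 2 ∂P) := by
  refine Real.le_sqrt_of_sq_le ?_
  have h := variance_nonneg |u| P
  rw [variance_eq_sub hu.abs] at h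
  simpa using h

theorem inv_sqrt_one_sub_le_exp {x : ℝ} (h0 : 0 ≤ x) (h1 : x ≤ 1 / 2) :
    (√(1 - x))⁻¹ ≤ Real.exp x := by
  rw [inv_le_comm₀ (Real.sqrt_pos.2 (by linarith)) (Real.exp_pos _), ← Real.exp_neg]
  refine Real.le_sqrt_of_sq_le ?_
  rw [← Real.exp_nat_mul]
  have h2 := Real.add_one_le_exp (2 * x)
  have h3 : Real.exp ((2 : ℕ) * -x) * Real.exp (2 * x) = 1 := by
    rw [← Real.exp_add]; simp
  have h4 := Real.exp_pos ((2 : ℕ) * -x)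
  have h5 : 1 ≤ (1 - x) * Real.exp (2 * x) := by nlinarith
  calc Real.exp ((2 : ℕ) * -x) ≤ Real.exp ((2 : ℕ) * -x) * ((1 - x) * Real.exp (2 * x)) :=
        le_mul_of_one_le_right h4.le h5
    _ = 1 - x := by linear_combination (1 - x) * h3

theorem tvDist_pi_gaussianReal_one_le (v : ι → ℝ) :
    tvDist (Measure.pi fun _ : ι => gaussianReal 0 1)
      (Measure.pi fun i => gaussianReal 0 (v i).toNNReal) ≤
      ENNReal.ofReal √(2 * ∑ i, (v i - 1) ^ 2) := by
  by_cases hs : 1 / 2 < ∑ i, (v i - 1) ^ 2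
  · refine (tvDist_le_one _ _).trans ?_
    rw [← ENNReal.ofReal_one]
    exact ENNReal.ofReal_le_ofReal (Real.one_le_sqrt.2 (by linarith))
  rw [not_lt] at hs
  have hvi : ∀ i, (v i - 1) ^ 2 ≤ 1 / 2 := fun i =>
    (Finset.single_le_sum (f := fun i => (v i - 1) ^ 2) (fun i _ => sq_nonneg _)
      (Finset.mem_univ i)).trans hs
  have hv : ∀ i, 0 < v i := fun i => by nlinarith [hvi i]
  have hv2 : ∀ i, v i < 2 := fun i => by nlinarith [hvi i]
  set P := Measure.pi fun _ : ι => gaussianReal 0 1 with hP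
  set g : (ι → ℝ) → ℝ := fun x => ∏ i, gaussianRatio (v i) (x i) with hg
  have hg0 : ∀ x, 0 ≤ g x := fun x => Finset.prod_nonneg fun i _ => gaussianRatio_nonneg _ _
  have hgi : Integrable g P := Integrable.fintype_prod fun i => integrable_gaussianRatio (hv i)
  have hg2i : Integrable (fun x => g x ^ 2) P := by
    simp only [hg, ← Finset.prod_pow]
    exact Integrable.fintype_prod (f := fun i x => gaussianRatio (v i) x ^ 2)
      fun i => integrable_gaussianRatio_sq (hv i) (hv2 i)
  have hg1 : ∫ x, g x ∂P = 1 := by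
    rw [hg, hP, integral_fintype_prod_eq_prod]
    exact Finset.prod_eq_one fun i _ => integral_gaussianRatio (hv i)
  have hg2 : ∫ x, g x ^ 2 ∂P ≤ 1 + 2 * ∑ i, (v i - 1) ^ 2 := by
    simp only [hg, ← Finset.prod_pow]
    rw [hP, integral_fintype_prod_eq_prod (f := fun i x => gaussianRatio (v i) x ^ 2)]
    calc ∏ i, ∫ x, gaussianRatio (v i) x ^ 2 ∂(gaussianReal 0 1)
        ≤ ∏ i, Real.exp ((v i - 1) ^ 2) := by
          refine Finset.prod_le_prod (fun i _ => integral_nonneg fun x => sq_nonneg _)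
            fun i _ => ?_
          rw [integral_gaussianRatio_sq (hv i) (hv2 i)]
          exact inv_sqrt_one_sub_le_exp (sq_nonneg _) (hvi i)
      _ = Real.exp (∑ i, (v i - 1) ^ 2) := (Real.exp_sum _ _).symm
      _ ≤ 1 + 2 * ∑ i, (v i - 1) ^ 2 := by
          set s := ∑ i, (v i - 1) ^ 2
          have hs0 : 0 ≤ s := Finset.sum_nonneg fun i _ => sq_nonneg _
          have h1 := Real.add_one_le_exp (-s)
          have h2 : Real.exp s * Real.exp (-s) = 1 := by rw [← Real.exp_add]; simp
          have h3 := Real.exp_pos s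
          nlinarith
  have hL : MemLp (fun x => 1 - g x) 2 P := by
    refine (memLp_const 1).sub ((memLp_two_iff_integrable_sq hgi.aestronglyMeasurable).2 hg2i)
  rw [pi_gaussianReal_eq_withDensity hv]
  refine tvDist_le fun A hA => ?_
  have eA : (P.withDensity fun x => ENNReal.ofReal (g x)).real A = ∫ x in A, g x ∂P := by
    rw [measureReal_def, withDensity_apply _ hA,
      ← ofReal_integral_eq_lintegral_ofReal hgi.integrableOn (ae_of_all _ hg0),
      ENNReal.toReal_ofReal (integral_nonneg hg0)]
  have e1 : P.real A = ∫ x in A, (1 : ℝ) ∂P := by simp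
  rw [eA, e1, ← integral_sub (integrable_const _) hgi.integrableOn]
  calc |∫ x in A, (1 - g x) ∂P| ≤ ∫ x in A, |1 - g x| ∂P := abs_integral_le_integral_abs
    _ ≤ ∫ x, |1 - g x| ∂P := setIntegral_le_integral
        ((integrable_const _).sub hgi).abs (ae_of_all _ fun x => abs_nonneg _)
    _ ≤ √(∫ x, (1 - g x) ^ 2 ∂P) := integral_abs_le_sqrt_integral_sq hL
    _ ≤ _ := by
        refine Real.sqrt_le_sqrt ?_
        have e : ∀ x, (1 - g x) ^ 2 = 1 - 2 * g x + g x ^ 2 := fun x => by ring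
        simp only [e]
        have h1 : Integrable (fun x => 1 - 2 * g x) P := (integrable_const _).sub (hgi.const_mul _)
        rw [integral_add h1 hg2i,
          integral_sub (integrable_const _) (hgi.const_mul _), integral_const_mul, hg1]
        simp only [integral_const, probReal_univ, smul_eq_mul]
        linarith

theorem tvDist_pi_gaussianReal_le {a : ι → ℝ} (ha : ∀ i, 0 < a i) (b : ι → ℝ) :
    tvDist (Measure.pi fun i => gaussianReal 0 (a i).toNNReal)
      (Measure.pi fun i => gaussianReal 0 (b i).toNNReal) ≤
      ENNReal.ofReal √(2 * ∑ i, (b i / a i - 1) ^ 2) := by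
  have key : ∀ b : ι → ℝ, Measure.pi (fun i => gaussianReal 0 (b i).toNNReal) =
      (Measure.pi fun i => gaussianReal 0 (b i / a i).toNNReal).map
        (fun x i => √(a i) * x i) := by
    intro b
    rw [Measure.pi_map_pi fun i => by fun_prop]
    congr 1
    ext1 i
    rw [gaussianReal_map_const_mul, mul_zero]
    congr 1
    ext
    simp only [NNReal.coe_mul, NNReal.coe_mk, Real.sq_sqrt (ha i).le, Real.coe_toNNReal']
    rw [mul_max_of_nonneg _ _ (ha i).le, mul_zero, mul_div_cancel₀ _ (ha i).ne']
  rw [key a, key b]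
  refine (tvDist_map_le _ _ (by fun_prop)).trans ?_
  simp only [div_self (ha _).ne', Real.toNNReal_one]
  exact tvDist_pi_gaussianReal_one_le _

end GaussianProduct

/-! ### Linear images of Gaussian laws and their total variation distance -/

section GaussianVector

open Matrix

variable {ι κ : Type*} [Fintype ι]

/-- The linear map of Euclidean spaces with matrix `L`. -/
def mulVecLp (L : Matrix κ ι ℝ) (x : EuclideanSpace ℝ ι) : EuclideanSpace ℝ κ :=
  WithLp.toLp 2 (L *ᵥ WithLp.ofLp x)

theorem measurable_mulVecLp (L : Matrix κ ι ℝ) : Measurable (mulVecLp L) := by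
  have : Measurable fun v : ι → ℝ => L *ᵥ v := by
    unfold Matrix.mulVec dotProduct; fun_prop
  unfold mulVecLp
  fun_prop

theorem inner_mulVecLp [Fintype κ] (L : Matrix κ ι ℝ) (x : EuclideanSpace ℝ ι)
    (t : EuclideanSpace ℝ κ) :
    inner ℝ (mulVecLp L x) t = inner ℝ x (mulVecLp Lᵀ t) := by
  simp only [mulVecLp, EuclideanSpace.inner_eq_star_dotProduct, star_trivial]
  rw [mulVec_transpose, ← dotProduct_mulVec]

theorem map_multivariateGaussian [DecidableEq ι] [Fintype κ] [DecidableEq κ]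
    {S : Matrix ι ι ℝ} (hS : S.PosSemidef)
    (L : Matrix κ ι ℝ) :
    (multivariateGaussian 0 S).map (mulVecLp L) = multivariateGaussian 0 (L * S * Lᵀ) := by
  have hS' : (L * S * Lᵀ).PosSemidef := by
    simpa [conjTranspose_eq_transpose_of_trivial] using hS.mul_mul_conjTranspose_same L
  have : IsProbabilityMeasure ((multivariateGaussian 0 S).map (mulVecLp L)) :=
    Measure.isProbabilityMeasure_map (measurable_mulVecLp L).aemeasurable
  apply Measure.ext_of_charFun
  ext t
  have e : charFun ((multivariateGaussian 0 S).map (mulVecLp L)) t =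
      charFun (multivariateGaussian 0 S) (mulVecLp Lᵀ t) := by
    rw [charFun_apply, charFun_apply, integral_map (measurable_mulVecLp L).aemeasurable
      (by fun_prop)]
    simp only [inner_mulVecLp]
  rw [e, charFun_multivariateGaussian hS, charFun_multivariateGaussian hS']
  simp only [inner_zero_right, mulVecLp]
  congr 4
  rw [mulVec_transpose, ← dotProduct_mulVec, ← mulVec_transpose, mulVec_mulVec, mulVec_mulVec,
    Matrix.mul_assoc]

theorem map_toLp_pi_gaussianReal [DecidableEq ι] {D : ι → ℝ} (hD : ∀ i, 0 ≤ D i) :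
    (Measure.pi fun i => gaussianReal 0 (D i).toNNReal).map (WithLp.toLp 2) =
      multivariateGaussian 0 (diagonal D) := by
  have hS : (diagonal D).PosSemidef := PosSemidef.diagonal hD
  have : IsProbabilityMeasure ((Measure.pi fun i => gaussianReal 0 (D i).toNNReal).map
    (WithLp.toLp 2 : (ι → ℝ) → EuclideanSpace ℝ ι)) :=
    Measure.isProbabilityMeasure_map (by fun_prop)
  apply Measure.ext_of_charFun
  ext t
  rw [charFun_multivariateGaussian hS, charFun_pi]
  simp_rw [charFun_gaussianReal, ← Complex.exp_sum]
  congr 1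
  simp only [inner_zero_right, dotProduct, mulVec_diagonal, Real.coe_toNNReal _ (hD _)]
  push_cast
  rw [zero_mul, zero_sub, Finset.sum_div, ← Finset.sum_neg_distrib]
  refine Finset.sum_congr rfl fun i _ => ?_
  simp
  ring

theorem map_pi_gaussianReal [DecidableEq ι] [Fintype κ] [DecidableEq κ] {D : ι → ℝ}
    (hD : ∀ i, 0 ≤ D i) (L : Matrix κ ι ℝ) :
    (Measure.pi fun i => gaussianReal 0 (D i).toNNReal).map
      (fun x => mulVecLp L (WithLp.toLp 2 x)) =
      multivariateGaussian 0 (L * diagonal D * Lᵀ) := by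
  rw [← map_multivariateGaussian (PosSemidef.diagonal hD), ← map_toLp_pi_gaussianReal hD,
    Measure.map_map (measurable_mulVecLp L) (by fun_prop)]
  rfl

theorem trace_transpose_mul_self (E : Matrix ι ι ℝ) :
    (Eᵀ * E).trace = ∑ i, ∑ j, E i j ^ 2 := by
  simp only [Matrix.trace, Matrix.diag, Matrix.mul_apply, transpose_apply]
  rw [Finset.sum_comm]
  exact Finset.sum_congr rfl fun i _ => Finset.sum_congr rfl fun j _ => by ring

theorem trace_conj_le [DecidableEq ι] {P : Matrix ι ι ℝ} {c : ℝ}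
    (hP : (c • (1 : Matrix ι ι ℝ) - P).PosSemidef) (X : Matrix ι ι ℝ) : (Xᵀ * P * X).trace ≤ c * (Xᵀ * X).trace := by
  have h := (hP.conjTranspose_mul_mul_same X).trace_nonneg
  rw [conjTranspose_eq_transpose_of_trivial, Matrix.mul_sub, Matrix.sub_mul, trace_sub,
    Matrix.mul_smul, Matrix.smul_mul, Matrix.mul_one, trace_smul, smul_eq_mul] at h
  linarith

open scoped MatrixOrder in
/-- A symmetric square root of a matrix `A ≥ c > 0`, with its inverse. -/
theorem exists_sqrt_of_sub_smul_posSemidef [DecidableEq ι] {A : Matrix ι ι ℝ} {c : ℝ}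
    (hc : 0 < c)
    (hA : (A - c • (1 : Matrix ι ι ℝ)).PosSemidef) :
    ∃ R T : Matrix ι ι ℝ, Rᵀ = R ∧ Tᵀ = T ∧ R * T = 1 ∧ T * R = 1 ∧ R * R = A ∧
      (c⁻¹ • (1 : Matrix ι ι ℝ) - T * T).PosSemidef := by
  have hApd : A.PosDef := by
    have : A = (A - c • (1 : Matrix ι ι ℝ)) + c • (1 : Matrix ι ι ℝ) := by simp
    rw [this]
    exact PosDef.posSemidef_add hA (PosDef.one.smul hc)
  set R := CFC.sqrt A with hR
  have hRR : R * R = A := CFC.sqrt_mul_sqrt_self _ hApd.posSemidef.nonneg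
  have hRt : Rᵀ = R := by
    have := (CFC.sqrt_nonneg A).isSelfAdjoint
    rw [← conjTranspose_eq_transpose_of_trivial]
    exact this
  have hdet : IsUnit R.det := by
    have h1 : R.det * R.det = A.det := by rw [← det_mul, hRR]
    have h2 := hApd.det_pos
    refine isUnit_iff_ne_zero.2 fun h => ?_
    rw [h] at h1; linarith
  have hTt : (R⁻¹)ᵀ = R⁻¹ := by rw [transpose_nonsing_inv, hRt]
  have h1 : R * R⁻¹ = 1 := mul_nonsing_inv _ hdet
  have h2 : R⁻¹ * R = 1 := nonsing_inv_mul _ hdet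
  refine ⟨R, R⁻¹, hRt, hTt, h1, h2, hRR, ?_⟩
  have h3 := (hA.conjTranspose_mul_mul_same R⁻¹).smul (inv_pos.2 hc).le
  convert h3 using 1
  rw [conjTranspose_eq_transpose_of_trivial, hTt, ← hRR, Matrix.mul_sub, Matrix.sub_mul,
    ← Matrix.mul_assoc, h2, Matrix.one_mul, h1, smul_sub]
  simp only [Matrix.mul_smul, Matrix.smul_mul, Matrix.mul_one, smul_smul, inv_mul_cancel₀ hc.ne',
    one_smul]

/-- The total variation distance between centered Gaussian laws is controlled by the Frobenius
distance of the covariance matrices. -/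
theorem tvDist_multivariateGaussian_le [DecidableEq ι] {A B : Matrix ι ι ℝ} {c : ℝ}
    (hc : 0 < c)
    (hA : (A - c • (1 : Matrix ι ι ℝ)).PosSemidef) (hB : Bᵀ = B) :
    tvDist (multivariateGaussian 0 A) (multivariateGaussian 0 B) ≤
      ENNReal.ofReal (c⁻¹ * √(2 * ∑ i, ∑ j, (B i j - A i j) ^ 2)) := by
  obtain ⟨R, T, hRt, hTt, hRT, hTR, hRR, hTc⟩ := exists_sqrt_of_sub_smul_posSemidef hc hA
  have hW : (T * B * T).IsHermitian := by
    rw [IsHermitian, conjTranspose_eq_transpose_of_trivial, transpose_mul, transpose_mul, hTt, hB,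
      Matrix.mul_assoc]
  set lam := hW.eigenvalues with hlam
  set U : Matrix ι ι ℝ := (hW.eigenvectorUnitary : Matrix ι ι ℝ) with hU
  have hUU : U * Uᵀ = 1 := by
    have := Unitary.coe_mul_star_self hW.eigenvectorUnitary
    rwa [Unitary.coe_star, star_eq_conjTranspose, conjTranspose_eq_transpose_of_trivial] at this
  have hUU' : Uᵀ * U = 1 := by
    have := Unitary.coe_star_mul_self hW.eigenvectorUnitary
    rwa [star_eq_conjTranspose, conjTranspose_eq_transpose_of_trivial] at this
  have hspec : T * B * T = U * diagonal lam * Uᵀ := by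
    have := hW.spectral_theorem
    rw [Unitary.conjStarAlgAut_apply, star_eq_conjTranspose,
      conjTranspose_eq_transpose_of_trivial] at this
    exact this
  have hsum : ∑ i, (lam i - 1) ^ 2 ≤ c⁻¹ ^ 2 * ∑ i, ∑ j, (B i j - A i j) ^ 2 := by
    set E := B - A with hE
    have hEt : Eᵀ = E := by
      rw [hE, transpose_sub, hB, ← hRR, transpose_mul, hRt]
    have h1 : T * E * T = U * diagonal (fun i => lam i - 1) * Uᵀ := by
      have : diagonal (fun i => lam i - 1) = diagonal lam - 1 := by
        rw [← diagonal_one, diagonal_sub]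
      rw [this, Matrix.mul_sub U, Matrix.sub_mul, ← hspec, Matrix.mul_one, hUU, hE,
        Matrix.mul_sub, Matrix.sub_mul, ← hRR]
      congr 1
      rw [← Matrix.mul_assoc, hTR, Matrix.one_mul, hRT]
    have h2 : ∑ i, (lam i - 1) ^ 2 = ((T * E * T)ᵀ * (T * E * T)).trace := by
      rw [h1]
      simp only [transpose_mul, diagonal_transpose, transpose_transpose]
      rw [show U * (diagonal (fun i => lam i - 1) * Uᵀ) *
          (U * diagonal (fun i => lam i - 1) * Uᵀ) = U * (diagonal (fun i => lam i - 1) *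
          (Uᵀ * U) * diagonal (fun i => lam i - 1)) * Uᵀ by simp only [Matrix.mul_assoc],
        hUU', Matrix.mul_one, trace_mul_comm, ← Matrix.mul_assoc, hUU', Matrix.one_mul,
        diagonal_mul_diagonal, trace_diagonal]
      exact Finset.sum_congr rfl fun i _ => by ring
    have h3 : ((T * E * T)ᵀ * (T * E * T)).trace = ((E * T)ᵀ * (T * T) * (E * T)).trace := by
      simp only [transpose_mul, hTt, hEt, Matrix.mul_assoc]
    have h4 : ((E * T)ᵀ * (E * T)).trace = (Eᵀ * (T * T) * E).trace := by
      rw [trace_mul_comm]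
      simp only [transpose_mul, hTt, hEt, Matrix.mul_assoc]
    have h5 : ∑ i, ∑ j, (B i j - A i j) ^ 2 = (Eᵀ * E).trace := by
      rw [trace_transpose_mul_self]; rfl
    rw [h2, h3, h5]
    have hc' : 0 ≤ c⁻¹ := (inv_pos.2 hc).le
    calc _ ≤ c⁻¹ * ((E * T)ᵀ * (E * T)).trace := trace_conj_le hTc _
      _ ≤ c⁻¹ * (c⁻¹ * (Eᵀ * E).trace) := by
          rw [h4]; exact mul_le_mul_of_nonneg_left (trace_conj_le hTc _) hc'
      _ = _ := by ring
  have hbound : √(2 * ∑ i, (lam i - 1) ^ 2) ≤ c⁻¹ * √(2 * ∑ i, ∑ j, (B i j - A i j) ^ 2) := by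
    have hc' : 0 ≤ c⁻¹ := (inv_pos.2 hc).le
    calc √(2 * ∑ i, (lam i - 1) ^ 2) ≤ √(c⁻¹ ^ 2 * (2 * ∑ i, ∑ j, (B i j - A i j) ^ 2)) :=
          Real.sqrt_le_sqrt (by linarith)
      _ = _ := by rw [Real.sqrt_mul (sq_nonneg _), Real.sqrt_sq hc']
  by_cases hs : 1 < 2 * ∑ i, (lam i - 1) ^ 2
  · refine (tvDist_le_one _ _).trans ?_
    rw [← ENNReal.ofReal_one]
    exact ENNReal.ofReal_le_ofReal ((Real.one_le_sqrt.2 hs.le).trans hbound)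
  rw [not_lt] at hs
  have hlam0 : ∀ i, 0 ≤ lam i := fun i => by
    have := Finset.single_le_sum (f := fun i => (lam i - 1) ^ 2) (fun i _ => sq_nonneg _)
      (Finset.mem_univ i)
    nlinarith
  have eB : B = (R * U) * diagonal lam * (R * U)ᵀ := by
    rw [transpose_mul, hRt]
    calc B = (R * T) * B * (T * R) := by rw [hRT, hTR, Matrix.one_mul, Matrix.mul_one]
      _ = R * (T * B * T) * R := by simp only [Matrix.mul_assoc]
      _ = _ := by rw [hspec]; simp only [Matrix.mul_assoc]
  have eA : A = (R * U) * diagonal (fun _ => (1 : ℝ)) * (R * U)ᵀ := by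
    rw [transpose_mul, hRt, diagonal_one, Matrix.mul_one]
    calc A = R * (U * Uᵀ) * R := by rw [hUU, Matrix.mul_one, hRR]
      _ = _ := by simp only [Matrix.mul_assoc]
  rw [eB, eA, ← map_pi_gaussianReal hlam0, ← map_pi_gaussianReal fun _ => zero_le_one]
  refine (tvDist_map_le _ _ ((measurable_mulVecLp _).comp (by fun_prop))).trans ?_
  simp only [Real.toNNReal_one]
  refine (tvDist_pi_gaussianReal_one_le lam).trans (ENNReal.ofReal_le_ofReal ?_)
  rw [← eA, ← eB]
  exact hbound

end GaussianVector

/-! ### Fourier analysis on the circle -/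

section Increments

instance factTwoPiPos : Fact (0 < 2 * Real.pi) := ⟨Real.two_pi_pos⟩

/-- The function on the circle of length `2π` that agrees with `f` on `(-π, π]`. -/
def circleLift (f : ℝ → ℝ) : AddCircle (2 * Real.pi) → ℂ :=
  AddCircle.liftIoc (2 * Real.pi) (-Real.pi) fun x => (f x : ℂ)

theorem neg_pi_add_two_pi : -Real.pi + 2 * Real.pi = Real.pi := by ring

theorem circleLift_coe {f : ℝ → ℝ} {x : ℝ} (hx : x ∈ Set.Ioc (-Real.pi) Real.pi) :
    circleLift f x = f x := by
  exact AddCircle.liftIoc_coe_apply (by rwa [neg_pi_add_two_pi])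

theorem measurable_circleLift {f : ℝ → ℝ} (hf : Measurable f) : Measurable (circleLift f) := by
  have h := (AddCircle.measurableEquivIoc (2 * Real.pi) (-Real.pi)).measurable
  exact (Complex.measurable_ofReal.comp (hf.comp measurable_subtype_coe)).comp h

theorem memLp_circleLift {f : ℝ → ℝ}
    (hf : MemLp f 2 (volume.restrict (Set.Ioc (-Real.pi) Real.pi))) :
    MemLp (circleLift f) 2 := by
  have : MemLp (fun x => (f x : ℂ)) 2
      (volume.restrict (Set.Ioc (-Real.pi) (-Real.pi + 2 * Real.pi))) := by
    rw [neg_pi_add_two_pi]; exact hf.ofReal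
  exact this.memLp_liftIoc

theorem fourierCoeff_circleLift (f : ℝ → ℝ) (n : ℤ) :
    fourierCoeff (circleLift f) n = ((2 * Real.pi : ℝ) : ℂ)⁻¹ * fourierCoef f (-n) := by
  rw [fourierCoeff_eq_intervalIntegral _ _ (-Real.pi), neg_pi_add_two_pi, fourierCoef]
  rw [← Complex.ofReal_inv, ← Complex.real_smul, one_div]
  congr 1
  have hpi := Real.pi_pos
  refine intervalIntegral.integral_congr_ae (ae_of_all _ fun x hx => ?_)
  rw [Set.uIoc_of_le (by linarith)] at hx
  rw [circleLift_coe hx, fourier_coe_apply, smul_eq_mul]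
  congr 2
  have : (Real.pi : ℂ) ≠ 0 := by exact_mod_cast hpi.ne'
  push_cast
  field_simp

theorem hasSum_sq_fourierCoeff_of_memLp {T : ℝ} [Fact (0 < T)] {F : AddCircle T → ℂ}
    (hF : MemLp F 2) :
    HasSum (fun k : ℤ => ‖fourierCoeff F k‖ ^ 2) (T⁻¹ * ∫ t, ‖F t‖ ^ 2) := by
  have h := hF.haarAddCircle
  have h2 := hasSum_sq_fourierCoeff h.toLp
  have e : ∫ t : AddCircle T, ‖h.toLp F t‖ ^ 2 ∂AddCircle.haarAddCircle = T⁻¹ * ∫ t, ‖F t‖ ^ 2 := by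
    rw [← smul_eq_mul, ← AddCircle.integral_haarAddCircle]
    refine integral_congr_ae ?_
    filter_upwards [h.coeFn_toLp] with x hx
    rw [hx]
  rw [e] at h2
  simpa only [fourierCoeff_congr_ae h.coeFn_toLp] using h2

/-- Parseval's identity for the Fourier coefficients `γ_f`. -/
theorem hasSum_sq_fourierCoef {f : ℝ → ℝ}
    (hf : MemLp f 2 (volume.restrict (Set.Ioc (-Real.pi) Real.pi))) :
    HasSum (fun k : ℤ => ‖fourierCoef f k‖ ^ 2)
      (2 * Real.pi * ∫ x in Set.Ioc (-Real.pi) Real.pi, f x ^ 2) := by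
  have hpi := Real.pi_pos
  have h := hasSum_sq_fourierCoeff_of_memLp (memLp_circleLift hf)
  have e : ∫ t, ‖circleLift f t‖ ^ 2 = ∫ x in Set.Ioc (-Real.pi) Real.pi, f x ^ 2 := by
    rw [← AddCircle.integral_preimage (2 * Real.pi) (-Real.pi), neg_pi_add_two_pi]
    refine setIntegral_congr_fun measurableSet_Ioc fun x hx => ?_
    simp only [circleLift_coe hx, Complex.norm_real, Real.norm_eq_abs, sq_abs]
  rw [e] at h
  have h2 := (((Equiv.neg ℤ).hasSum_iff).2 h).mul_left ((2 * Real.pi) ^ 2)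
  have e1 : (fun k : ℤ => ‖fourierCoef f k‖ ^ 2) = fun k => (2 * Real.pi) ^ 2 *
      ((fun k : ℤ => ‖fourierCoeff (circleLift f) k‖ ^ 2) ∘ Equiv.neg ℤ) k := by
    ext k
    simp only [Function.comp_apply, Equiv.neg_apply, fourierCoeff_circleLift, neg_neg, norm_mul,
      norm_inv, Complex.norm_real]
    rw [Real.norm_of_nonneg zero_le_two, Real.norm_of_nonneg hpi.le]
    field_simp
  have e2 : 2 * Real.pi * ∫ x in Set.Ioc (-Real.pi) Real.pi, f x ^ 2 = (2 * Real.pi) ^ 2 *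
      ((2 * Real.pi)⁻¹ * ∫ x in Set.Ioc (-Real.pi) Real.pi, f x ^ 2) := by
    rw [← mul_assoc]
    congr 1
    field_simp
  rw [e1, e2]
  exact h2

theorem fourierCoeff_translate {T : ℝ} [Fact (0 < T)] (F : AddCircle T → ℂ) (h : AddCircle T)
    (n : ℤ) : fourierCoeff (fun t => F (t + h)) n = fourier n h * fourierCoeff F n := by
  unfold fourierCoeff
  rw [← integral_const_mul,
    ← integral_add_right_eq_self (fun t => fourier n h * (fourier (-n) t • F t)) h]
  congr 1
  ext t
  have h1 : fourier n h * fourier (-n) h = (1 : ℂ) := by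
    rw [← fourier_add, add_neg_cancel, fourier_zero]
  have h2 : (fourier (-n) (t + h) : ℂ) = fourier (-n) t * fourier (-n) h := by
    simp only [fourier_apply, smul_add, AddCircle.toCircle_add, Circle.coe_mul]
  rw [h2, smul_eq_mul, smul_eq_mul]
  linear_combination (-(fourier (-n) t * F (t + h)) : ℂ) * h1

theorem norm_exp_I_sub_one_sq_le {a : ℝ} (ha0 : 0 ≤ a) (ha : a ≤ 1) (x : ℝ) :
    ‖Complex.exp (Complex.I * x) - 1‖ ^ 2 ≤ 4 * |x| ^ (2 * a) := by
  rcases le_total |x| 1 with hx | hx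
  · have h1 : ‖Complex.exp (Complex.I * x) - 1‖ ≤ |x| := by
      simpa using Real.norm_exp_I_mul_ofReal_sub_one_le (x := x)
    calc ‖Complex.exp (Complex.I * x) - 1‖ ^ 2 ≤ |x| ^ 2 := by gcongr
      _ = |x| ^ (2 : ℝ) := by norm_cast
      _ ≤ |x| ^ (2 * a) := by
          refine Real.rpow_le_rpow_of_exponent_ge_of_imp (abs_nonneg _) hx (by linarith) ?_
          intro h1 h2
          simp_all
      _ ≤ 4 * |x| ^ (2 * a) := by
          have : 0 ≤ |x| ^ (2 * a) := by positivity
          linarith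
  · have h1 : ‖Complex.exp (Complex.I * x) - 1‖ ≤ 2 := by
      refine (norm_sub_le _ _).trans ?_
      rw [mul_comm, Complex.norm_exp_ofReal_mul_I]
      norm_num
    have h2 : 1 ≤ |x| ^ (2 * a) := Real.one_le_rpow hx (by linarith)
    have h3 := norm_nonneg (Complex.exp (Complex.I * x) - 1)
    nlinarith

theorem memLp_Ioc_of_mem_sobolevBall {α M : ℝ} {f : ℝ → ℝ} (hf : f ∈ sobolevBall α M) :
    MemLp f 2 (volume.restrict (Set.Ioc (-Real.pi) Real.pi)) :=
  hf.1.mono_measure (Measure.restrict_mono Set.Ioc_subset_Icc_self le_rfl)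

theorem tsum_le_of_mem_sobolevBall {α M : ℝ} {f : ℝ → ℝ} (hf : f ∈ sobolevBall α M) :
    ∑' k : ℤ, |(k : ℝ)| ^ (2 * α) * ‖fourierCoef f k‖ ^ 2 ≤ M := by
  have := hf.2.2
  have h0 : 0 ≤ ‖fourierCoef f 0‖ ^ 2 := by positivity
  linarith

theorem nonneg_of_mem_sobolevBall {α M : ℝ} {f : ℝ → ℝ} (hf : f ∈ sobolevBall α M) : 0 ≤ M :=
  (tsum_nonneg fun _ => by positivity).trans (tsum_le_of_mem_sobolevBall hf)

theorem integral_sq_increment_le {α M : ℝ} (h0 : 0 ≤ α) (h1 : α ≤ 1) {f : ℝ → ℝ}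
    (hf : f ∈ sobolevBall α M) (h : ℝ) :
    ∫ t, ‖circleLift f (t + h) - circleLift f t‖ ^ 2 ≤ M * |h| ^ (2 * α) := by
  have hpi := Real.pi_pos
  set F := circleLift f with hF
  have hM := nonneg_of_mem_sobolevBall hf
  have hFL : MemLp F 2 := memLp_circleLift (memLp_Ioc_of_mem_sobolevBall hf)
  have hFT : MemLp (fun t => F (t + (h : AddCircle (2 * Real.pi)))) 2 :=
    hFL.comp_measurePreserving (measurePreserving_add_right _ _)
  have hcoef : ∀ n : ℤ, fourierCoeff (fun t => F (t + (h : AddCircle (2 * Real.pi))) - F t) n =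
      (Complex.exp (Complex.I * (n * h : ℝ)) - 1) * fourierCoeff F n := by
    intro n
    have e : fourierCoeff (fun t => F (t + (h : AddCircle (2 * Real.pi))) - F t) n =
        fourierCoeff (fun t => F (t + (h : AddCircle (2 * Real.pi)))) n - fourierCoeff F n := by
      unfold fourierCoeff
      rw [← integral_sub]
      · simp only [smul_sub]
      · exact (hFT.haarAddCircle.integrable (by norm_num)).fourier_smul _
      · exact (hFL.haarAddCircle.integrable (by norm_num)).fourier_smul _
    rw [e, fourierCoeff_translate, sub_mul, one_mul, fourier_coe_apply]
    congr 3
    have : (Real.pi : ℂ) ≠ 0 := by exact_mod_cast hpi.ne'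
    push_cast
    field_simp
  have hs := hasSum_sq_fourierCoeff_of_memLp (hFT.sub hFL)
  have hS : HasSum (fun k : ℤ => |(k : ℝ)| ^ (2 * α) * ‖fourierCoef f (-k)‖ ^ 2)
      (∑' k : ℤ, |(k : ℝ)| ^ (2 * α) * ‖fourierCoef f k‖ ^ 2) := by
    have := (Equiv.neg ℤ).hasSum_iff.2 hf.2.1.hasSum
    simpa [Function.comp_def] using this
  have hle := hasSum_le (fun n : ℤ => ?_) hs
    (hS.mul_left (4 * |h| ^ (2 * α) * (2 * Real.pi)⁻¹ ^ 2))
  · have h3 : (2 * Real.pi)⁻¹ * ∫ t, ‖F (t + (h : AddCircle (2 * Real.pi))) - F t‖ ^ 2 ≤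
        4 * |h| ^ (2 * α) * (2 * Real.pi)⁻¹ ^ 2 * M := by
      refine hle.trans (mul_le_mul_of_nonneg_left (tsum_le_of_mem_sobolevBall hf) (by positivity))
    rw [inv_mul_le_iff₀ Real.two_pi_pos] at h3
    refine h3.trans ?_
    have h4 : 0 ≤ M * |h| ^ (2 * α) := by positivity
    have h5 : 2 * Real.pi * (4 * |h| ^ (2 * α) * (2 * Real.pi)⁻¹ ^ 2 * M) =
        (2 / Real.pi) * (M * |h| ^ (2 * α)) := by
      field_simp
      ring
    rw [h5]
    refine mul_le_of_le_one_left h4 ?_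
    rw [div_le_one hpi]
    exact Real.two_le_pi
  · have h6 : fourierCoeff ((fun t => F (t + (h : AddCircle (2 * Real.pi)))) - F) n =
        (Complex.exp (Complex.I * (n * h : ℝ)) - 1) * fourierCoeff F n := hcoef n
    rw [h6, hF, fourierCoeff_circleLift, norm_mul, norm_mul, norm_inv, Complex.norm_real,
      Real.norm_eq_abs, abs_of_pos Real.two_pi_pos, mul_pow, mul_pow]
    have h7 := norm_exp_I_sub_one_sq_le h0 h1 (n * h)
    rw [abs_mul, Real.mul_rpow (abs_nonneg _) (abs_nonneg _)] at h7
    calc _ ≤ 4 * (|(n : ℝ)| ^ (2 * α) * |h| ^ (2 * α)) *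
          ((2 * Real.pi)⁻¹ ^ 2 * ‖fourierCoef f (-n)‖ ^ 2) := by gcongr
      _ = _ := by ring

/-- The pairs of points of `(-π, π]` at distance at most `δ`. -/
def nearDiagonal (δ : ℝ) : Set (ℝ × ℝ) :=
  {p | p.1 ∈ Set.Ioc (-Real.pi) Real.pi ∧ p.2 ∈ Set.Ioc (-Real.pi) Real.pi ∧ |p.2 - p.1| ≤ δ}

theorem measurableSet_nearDiagonal (δ : ℝ) : MeasurableSet (nearDiagonal δ) := by
  refine (measurable_fst measurableSet_Ioc).inter ((measurable_snd measurableSet_Ioc).inter ?_)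
  have h : Measurable fun p : ℝ × ℝ => |p.2 - p.1| := by fun_prop
  exact measurableSet_le h measurable_const

theorem lintegral_nearDiagonal_le {α M : ℝ} (h0 : 0 ≤ α) (h1 : α ≤ 1) {f : ℝ → ℝ}
    (hf : f ∈ sobolevBall α M) (hfm : Measurable f) {δ : ℝ} (hδ : 0 ≤ δ) :
    ∫⁻ p in nearDiagonal δ, ENNReal.ofReal ((f p.1 - f p.2) ^ 2) ≤
      ENNReal.ofReal (M * δ ^ (2 * α) * (2 * δ)) := by
  have hM := nonneg_of_mem_sobolevBall hf
  set F := circleLift f with hF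
  have hFm : Measurable F := measurable_circleLift hfm
  have hB : MeasurableSet (Set.Ioc (-Real.pi) Real.pi) := measurableSet_Ioc
  have hψ : Measurable fun p : ℝ × ℝ =>
      ENNReal.ofReal (‖F ((p.1 : AddCircle (2 * Real.pi)) + (p.2 : ℝ)) - F (p.1 : ℝ)‖ ^ 2) := by
    have hc : Measurable fun x : ℝ => (x : AddCircle (2 * Real.pi)) := AddCircle.measurable_mk'
    have h2 : Measurable fun p : ℝ × ℝ =>
        F ((p.1 : AddCircle (2 * Real.pi)) + ((p.2 : ℝ) : AddCircle (2 * Real.pi))) :=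
      hFm.comp ((hc.comp measurable_fst).add (hc.comp measurable_snd))
    have h3 : Measurable fun p : ℝ × ℝ => F ((p.1 : ℝ) : AddCircle (2 * Real.pi)) :=
      hFm.comp (hc.comp measurable_fst)
    exact ((h2.sub h3).norm.pow_const 2).ennreal_ofReal
  have hφ : Measurable fun p : ℝ × ℝ => (nearDiagonal δ).indicator
      (fun p => ENNReal.ofReal ((f p.1 - f p.2) ^ 2)) p :=
    Measurable.indicator (by fun_prop) (measurableSet_nearDiagonal δ)
  rw [← lintegral_indicator (measurableSet_nearDiagonal δ), Measure.volume_eq_prod,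
    lintegral_prod _ hφ.aemeasurable]
  calc ∫⁻ x, ∫⁻ y, (nearDiagonal δ).indicator
        (fun p => ENNReal.ofReal ((f p.1 - f p.2) ^ 2)) (x, y)
      = ∫⁻ x, ∫⁻ h, (nearDiagonal δ).indicator
        (fun p => ENNReal.ofReal ((f p.1 - f p.2) ^ 2)) (x, x + h) := by
        refine lintegral_congr fun x => ?_
        exact (lintegral_add_left_eq_self (fun y => (nearDiagonal δ).indicator
          (fun p => ENNReal.ofReal ((f p.1 - f p.2) ^ 2)) (x, y)) x).symm
    _ ≤ ∫⁻ x in Set.Ioc (-Real.pi) Real.pi, ∫⁻ h in Set.Icc (-δ) δ,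
          ENNReal.ofReal (‖F ((x : AddCircle (2 * Real.pi)) + (h : ℝ)) - F (x : ℝ)‖ ^ 2) := by
        rw [← lintegral_indicator hB]
        refine lintegral_mono fun x => ?_
        by_cases hx : x ∈ Set.Ioc (-Real.pi) Real.pi
        · rw [Set.indicator_of_mem hx, ← lintegral_indicator measurableSet_Icc]
          refine lintegral_mono fun h => ?_
          by_cases hp : (x, x + h) ∈ nearDiagonal δ
          · have hh : h ∈ Set.Icc (-δ) δ := by
              have := hp.2.2
              simp only [add_sub_cancel_left] at this
              exact abs_le.1 this
            rw [Set.indicator_of_mem hp, Set.indicator_of_mem hh, ← AddCircle.coe_add,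
              hF, circleLift_coe hx, circleLift_coe hp.2.1, ← Complex.ofReal_sub,
              Complex.norm_real, Real.norm_eq_abs, sq_abs]
            refine ENNReal.ofReal_le_ofReal (le_of_eq ?_)
            ring
          · rw [Set.indicator_of_notMem hp]; exact zero_le
        · rw [Set.indicator_of_notMem hx]
          refine le_of_eq (lintegral_eq_zero_of_ae_eq_zero (ae_of_all _ fun h => ?_))
          exact Set.indicator_of_notMem (fun hp => hx hp.1) _
    _ = ∫⁻ h in Set.Icc (-δ) δ, ∫⁻ x in Set.Ioc (-Real.pi) Real.pi,
          ENNReal.ofReal (‖F ((x : AddCircle (2 * Real.pi)) + (h : ℝ)) - F (x : ℝ)‖ ^ 2) :=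
        lintegral_lintegral_swap hψ.aemeasurable
    _ ≤ ∫⁻ _ in Set.Icc (-δ) δ, ENNReal.ofReal (M * δ ^ (2 * α)) := by
        refine setLIntegral_mono measurable_const fun h hh => ?_
        have e := AddCircle.lintegral_preimage (2 * Real.pi) (-Real.pi) fun t =>
          ENNReal.ofReal (‖F (t + (h : ℝ)) - F t‖ ^ 2)
        rw [neg_pi_add_two_pi] at e
        have hFL : MemLp F 2 := memLp_circleLift (memLp_Ioc_of_mem_sobolevBall hf)
        have hFT : MemLp (fun t => F (t + (h : AddCircle (2 * Real.pi)))) 2 :=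
          hFL.comp_measurePreserving (measurePreserving_add_right _ _)
        have hi : Integrable fun t : AddCircle (2 * Real.pi) => ‖F (t + (h : ℝ)) - F t‖ ^ 2 :=
          (hFT.sub hFL).integrable_norm_pow (by norm_num)
        rw [e, ← ofReal_integral_eq_lintegral_ofReal hi (ae_of_all _ fun t => by positivity)]
        refine ENNReal.ofReal_le_ofReal ((integral_sq_increment_le h0 h1 hf h).trans ?_)
        gcongr
        exact abs_le.2 hh
    _ = _ := by
        rw [setLIntegral_const, Real.volume_Icc, ← ENNReal.ofReal_mul (by positivity)]
        congr 2
        ring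

end Increments

/-! ### Local averages -/

section LocalAverages

theorem integrable_sq_sub {μ ν : Measure ℝ} [IsFiniteMeasure μ] [IsFiniteMeasure ν] {f : ℝ → ℝ}
    (hμ : MemLp f 2 μ) (hν : MemLp f 2 ν) :
    Integrable (fun p : ℝ × ℝ => (f p.1 - f p.2) ^ 2) (μ.prod ν) :=
  ((hμ.comp_fst ν).sub (hν.comp_snd μ)).integrable_sq

theorem integral_sq_sub {μ ν : Measure ℝ} [IsFiniteMeasure μ] [IsFiniteMeasure ν] {f : ℝ → ℝ}
    (hμ : MemLp f 2 μ) (hν : MemLp f 2 ν) :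
    ∫ p : ℝ × ℝ, (f p.1 - f p.2) ^ 2 ∂(μ.prod ν) =
      ν.real Set.univ * ∫ x, f x ^ 2 ∂μ - 2 * ((∫ x, f x ∂μ) * ∫ x, f x ∂ν) +
        μ.real Set.univ * ∫ x, f x ^ 2 ∂ν := by
  have h1 : Integrable (fun p : ℝ × ℝ => f p.1 ^ 2 * 1) (μ.prod ν) :=
    hμ.integrable_sq.mul_prod (integrable_const (1 : ℝ))
  have h2 : Integrable (fun p : ℝ × ℝ => f p.1 * f p.2) (μ.prod ν) :=
    (hμ.integrable (by norm_num)).mul_prod (hν.integrable (by norm_num))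
  have h3 : Integrable (fun p : ℝ × ℝ => 1 * f p.2 ^ 2) (μ.prod ν) :=
    (integrable_const (1 : ℝ)).mul_prod hν.integrable_sq
  have e : ∀ p : ℝ × ℝ, (f p.1 - f p.2) ^ 2 =
      f p.1 ^ 2 * 1 - 2 * (f p.1 * f p.2) + 1 * f p.2 ^ 2 := fun p => by ring
  have h12 : Integrable (fun p : ℝ × ℝ => f p.1 ^ 2 * 1 - 2 * (f p.1 * f p.2)) (μ.prod ν) :=
    h1.sub (h2.const_mul 2)
  simp only [e]
  rw [integral_add h12 h3, integral_sub h1 (h2.const_mul 2), integral_const_mul,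
    integral_prod_mul (fun x => f x ^ 2) (fun _ => (1 : ℝ)), integral_prod_mul f f,
    integral_prod_mul (fun _ => (1 : ℝ)) (fun x => f x ^ 2)]
  simp only [integral_const, smul_eq_mul, mul_one]
  ring

theorem sq_integral_le {μ : Measure ℝ} [IsFiniteMeasure μ] {f : ℝ → ℝ} (hμ : MemLp f 2 μ) :
    (∫ x, f x ∂μ) ^ 2 ≤ μ.real Set.univ * ∫ x, f x ^ 2 ∂μ := by
  have h := integral_sq_sub hμ hμ
  have h0 : 0 ≤ ∫ p : ℝ × ℝ, (f p.1 - f p.2) ^ 2 ∂(μ.prod μ) :=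
    integral_nonneg fun _ => sq_nonneg _
  nlinarith

theorem sq_average_sub_average_le {μ ν : Measure ℝ} [IsFiniteMeasure μ] [IsFiniteMeasure ν]
    {f : ℝ → ℝ} (hμ : MemLp f 2 μ) (hν : MemLp f 2 ν) (hμ0 : 0 < μ.real Set.univ)
    (hν0 : 0 < ν.real Set.univ) :
    ((μ.real Set.univ)⁻¹ * ∫ x, f x ∂μ - (ν.real Set.univ)⁻¹ * ∫ x, f x ∂ν) ^ 2 ≤
      (μ.real Set.univ)⁻¹ * (ν.real Set.univ)⁻¹ *
        ∫ p : ℝ × ℝ, (f p.1 - f p.2) ^ 2 ∂(μ.prod ν) := by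
  have h := integral_sq_sub hμ hν
  have h1 := sq_integral_le hμ
  have h2 := sq_integral_le hν
  rw [h]
  set a := μ.real Set.univ
  set b := ν.real Set.univ
  set A := ∫ x, f x ∂μ
  set B := ∫ x, f x ∂ν
  have e : (a⁻¹ * A - b⁻¹ * B) ^ 2 =
      a⁻¹ * b⁻¹ * (b * (a⁻¹ * A ^ 2) - 2 * (A * B) + a * (b⁻¹ * B ^ 2)) := by
    field_simp
    ring
  rw [e]
  gcongr
  · rw [inv_mul_le_iff₀ hμ0]; exact h1
  · rw [inv_mul_le_iff₀ hν0]; exact h2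

theorem integral_sq_sub_average {μ : Measure ℝ} [IsFiniteMeasure μ] {f : ℝ → ℝ}
    (hμ : MemLp f 2 μ) (hμ0 : 0 < μ.real Set.univ) :
    ∫ x, (f x - (μ.real Set.univ)⁻¹ * ∫ y, f y ∂μ) ^ 2 ∂μ =
      (2 * μ.real Set.univ)⁻¹ * ∫ p : ℝ × ℝ, (f p.1 - f p.2) ^ 2 ∂(μ.prod μ) := by
  rw [integral_sq_sub hμ hμ]
  set m := (μ.real Set.univ)⁻¹ * ∫ y, f y ∂μ with hm
  have hi := hμ.integrable (by norm_num : (1 : ℝ≥0∞) ≤ 2)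
  have e : ∀ x, (f x - m) ^ 2 = f x ^ 2 - 2 * m * f x + m ^ 2 := fun x => by ring
  have h1 : Integrable (fun x => f x ^ 2 - 2 * m * f x) μ :=
    hμ.integrable_sq.sub (hi.const_mul _)
  simp only [e]
  rw [integral_add h1 (integrable_const _), integral_sub hμ.integrable_sq (hi.const_mul _),
    integral_const_mul, integral_const, smul_eq_mul, hm]
  field_simp
  ring

theorem sum_integral_sq_sub_le {α M : ℝ} (h0 : 0 ≤ α) (h1 : α ≤ 1) {f : ℝ → ℝ}
    (hf : f ∈ sobolevBall α M) (hfm : Measurable f) {δ : ℝ} (hδ : 0 ≤ δ) {ι : Type*}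
    (S : Finset ι) {s t : ι → Set ℝ} (hs : ∀ i, MeasurableSet (s i))
    (ht : ∀ i, MeasurableSet (t i)) (hd : Pairwise fun i j => Disjoint (s i) (s j))
    (hst : ∀ i ∈ S, s i ×ˢ t i ⊆ nearDiagonal δ)
    (hsB : ∀ i ∈ S, s i ⊆ Set.Ioc (-Real.pi) Real.pi)
    (htB : ∀ i ∈ S, t i ⊆ Set.Ioc (-Real.pi) Real.pi) :
    ∑ i ∈ S, ∫ p : ℝ × ℝ, (f p.1 - f p.2) ^ 2
      ∂((volume.restrict (s i)).prod (volume.restrict (t i))) ≤ M * δ ^ (2 * α) * (2 * δ) := by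
  have hM := nonneg_of_mem_sobolevBall hf
  have hL := memLp_Ioc_of_mem_sobolevBall hf
  set B := Set.Ioc (-Real.pi) Real.pi with hB
  have hint : IntegrableOn (fun p : ℝ × ℝ => (f p.1 - f p.2) ^ 2) (B ×ˢ B)
      (volume.prod volume) := by
    rw [IntegrableOn, ← Measure.prod_restrict]
    exact integrable_sq_sub hL hL
  simp only [Measure.prod_restrict]
  rw [← integral_biUnion_finset S (fun i _ => (hs i).prod (ht i))
    (fun i _ j _ hij => Set.disjoint_prod.2 (Or.inl (hd hij)))
    fun i hi => hint.mono_set (Set.prod_mono (hsB i hi) (htB i hi))]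
  rw [integral_eq_lintegral_of_nonneg_ae (ae_of_all _ fun _ => sq_nonneg _) (by fun_prop)]
  refine ENNReal.toReal_le_of_le_ofReal (by positivity) ?_
  refine le_trans ?_ (lintegral_nearDiagonal_le h0 h1 hf hfm hδ)
  exact lintegral_mono_set (Set.iUnion₂_subset hst)

/-- The endpoints of the partition of `[-π, π]` into `n` intervals of equal length. -/
def gridPt (n j : ℕ) : ℝ := 2 * Real.pi * (j / n) - Real.pi

/-- The cells of the partition of `(-π, π]` into `n` intervals of equal length. -/
def cell (n j : ℕ) : Set ℝ := Set.Ioc (gridPt n j) (gridPt n (j + 1))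

theorem measurableSet_cell (n j : ℕ) : MeasurableSet (cell n j) := measurableSet_Ioc

theorem gridPt_mono (n : ℕ) : Monotone (gridPt n) := by
  intro i j hij
  unfold gridPt
  have hpi := Real.pi_pos
  gcongr

theorem gridPt_zero (n : ℕ) : gridPt n 0 = -Real.pi := by simp [gridPt]

theorem gridPt_self {n : ℕ} (hn : n ≠ 0) : gridPt n n = Real.pi := by
  have : (n : ℝ) ≠ 0 := by exact_mod_cast hn
  unfold gridPt
  field_simp
  ring

theorem gridPt_succ_sub (n j : ℕ) : gridPt n (j + 1) - gridPt n j = 2 * Real.pi / n := by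
  unfold gridPt
  push_cast
  ring

theorem cell_subset {n j : ℕ} (hj : j < n) : cell n j ⊆ Set.Ioc (-Real.pi) Real.pi := by
  rw [← gridPt_zero n, ← gridPt_self (n := n) (by omega)]
  exact Set.Ioc_subset_Ioc (gridPt_mono n (Nat.zero_le _)) (gridPt_mono n hj)

theorem pairwise_disjoint_cell (n : ℕ) : Pairwise fun i j => Disjoint (cell n i) (cell n j) :=
  (gridPt_mono n).pairwise_disjoint_on_Ioc_succ

theorem iUnion_cell {n : ℕ} (hn : n ≠ 0) :
    ⋃ j ∈ Finset.range n, cell n j = Set.Ioc (-Real.pi) Real.pi := by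
  rw [← gridPt_zero n, ← gridPt_self hn]
  have : ∀ m, ⋃ j ∈ Finset.range m, cell n j = Set.Ioc (gridPt n 0) (gridPt n m) := by
    intro m
    induction m with
    | zero => simp
    | succ k ih =>
      rw [Finset.range_add_one, Finset.set_biUnion_insert, ih, Set.union_comm]
      exact Set.Ioc_union_Ioc_eq_Ioc (gridPt_mono n (Nat.zero_le _)) (gridPt_mono n (Nat.le_succ _))
  exact this n

theorem volume_cell (n j : ℕ) : (volume.restrict (cell n j)).real Set.univ = 2 * Real.pi / n := by
  rw [measureReal_restrict_apply_univ, cell, Real.volume_real_Ioc_of_le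
    (gridPt_mono n (Nat.le_succ _)), gridPt_succ_sub]

theorem localAverage_eq {n : ℕ} (hn : n ≠ 0) (j : ℕ) (f : ℝ → ℝ) :
    localAverage n (j + 1) f = (2 * Real.pi / n)⁻¹ * ∫ x in cell n j, f x := by
  have hpi := Real.pi_pos
  have hn' : (n : ℝ) ≠ 0 := by exact_mod_cast hn
  unfold localAverage cell
  rw [intervalIntegral.integral_comp_mul_sub f (by positivity),
    ← intervalIntegral.integral_of_le (gridPt_mono n (Nat.le_succ _)), smul_eq_mul, ← mul_assoc]
  congr 1
  · field_simp
  · unfold gridPt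
    push_cast
    congr 1
    ring

theorem memLp_cell {α M : ℝ} {f : ℝ → ℝ} (hf : f ∈ sobolevBall α M) {n j : ℕ} (hj : j < n) :
    MemLp f 2 (volume.restrict (cell n j)) :=
  (memLp_Ioc_of_mem_sobolevBall hf).mono_measure (Measure.restrict_mono (cell_subset hj) le_rfl)

theorem sq_localAverage_sub_le {α M : ℝ} {f : ℝ → ℝ} (hf : f ∈ sobolevBall α M) {n j m i : ℕ}
    (hj : j < n) (hi : i < m) :
    (localAverage n (j + 1) f - localAverage m (i + 1) f) ^ 2 ≤
      (2 * Real.pi / n)⁻¹ * (2 * Real.pi / m)⁻¹ * ∫ p : ℝ × ℝ, (f p.1 - f p.2) ^ 2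
      ∂((volume.restrict (cell n j)).prod (volume.restrict (cell m i))) := by
  have hpi := Real.pi_pos
  have hn : (0 : ℝ) < n := by exact_mod_cast (by omega : 0 < n)
  have hm : (0 : ℝ) < m := by exact_mod_cast (by omega : 0 < m)
  have : IsFiniteMeasure (volume.restrict (cell n j)) := ⟨by simp [cell]⟩
  have : IsFiniteMeasure (volume.restrict (cell m i)) := ⟨by simp [cell]⟩
  have h := sq_average_sub_average_le (memLp_cell hf hj) (memLp_cell hf hi)
    (by rw [volume_cell]; positivity) (by rw [volume_cell]; positivity)
  rw [volume_cell, volume_cell] at h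
  rwa [localAverage_eq (by omega), localAverage_eq (by omega)]

theorem cell_prod_subset {n j m i : ℕ} (hj : j < n) (hi : i < m) {δ : ℝ}
    (h1 : gridPt m (i + 1) - gridPt n j ≤ δ) (h2 : gridPt n (j + 1) - gridPt m i ≤ δ) :
    cell n j ×ˢ cell m i ⊆ nearDiagonal δ := by
  rintro ⟨x, y⟩ ⟨hx, hy⟩
  refine ⟨cell_subset hj hx, cell_subset hi hy, ?_⟩
  have a := hx.1; have b := hx.2; have c := hy.1; have d := hy.2
  simp only at a b c d ⊢
  rw [abs_le]
  constructor <;> linarith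

end LocalAverages

section Rates

theorem tendsto_natCast_rpow_rate {α : ℝ} (hα : 1 / 2 < α) (C : ℝ) :
    Tendsto (fun n : ℕ => C * (n : ℝ) ^ (1 - 2 * α)) atTop (𝓝 0) := by
  have h := (tendsto_rpow_neg_atTop (y := 2 * α - 1) (by linarith)).comp
    tendsto_natCast_atTop_atTop
  simpa [Function.comp_def] using h.const_mul C

theorem sq_mul_div_rpow {n c a : ℝ} (hn : 0 < n) (hc : 0 ≤ c) :
    n ^ 2 * ((c / n) ^ a * (c / n)) = c ^ a * c * n ^ (1 - a) := by
  rw [Real.div_rpow hc hn.le, Real.rpow_sub hn, Real.rpow_one]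
  have : 0 < n ^ a := by positivity
  field_simp

theorem exists_measurable_rep {α M : ℝ} {f : ℝ → ℝ} (hf : f ∈ sobolevBall α M) :
    ∃ g, Measurable g ∧ g ∈ sobolevBall α M ∧
      f =ᵐ[volume.restrict (Set.Icc (-Real.pi) Real.pi)] g ∧
      ∀ n j, j < n → localAverage n (j + 1) g = localAverage n (j + 1) f := by
  have hpi := Real.pi_pos
  have hae := hf.1.aestronglyMeasurable
  obtain ⟨g, hgm, hg⟩ := hae
  have hF : ∀ h, fourierCoef g h = fourierCoef f h := by
    intro h
    unfold fourierCoef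
    refine intervalIntegral.integral_congr_ae ?_
    rw [Set.uIoc_of_le (by linarith)]
    filter_upwards [(ae_restrict_iff' measurableSet_Icc).1 hg] with x hx hx'
    rw [hx (Set.Ioc_subset_Icc_self hx')]
  refine ⟨g, hgm.measurable, ⟨hf.1.ae_eq hg, ?_⟩, hg, ?_⟩
  · simp only [hF]
    exact hf.2
  · intro n j hj
    rw [localAverage_eq (by omega), localAverage_eq (by omega)]
    congr 1
    refine setIntegral_congr_ae (measurableSet_cell n j) ?_
    filter_upwards [(ae_restrict_iff' measurableSet_Icc).1 hg] with x hx hx'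
    exact (hx (Set.Ioc_subset_Icc_self (cell_subset hj hx'))).symm

theorem inv_mul_inv_le_sq {n : ℕ} (hn : n ≠ 0) :
    (2 * Real.pi / n)⁻¹ * (2 * Real.pi / (n + 1 : ℕ))⁻¹ ≤ (n : ℝ) ^ 2 := by
  have hpi := Real.two_le_pi
  have h1 : (1 : ℝ) ≤ n := by exact_mod_cast Nat.one_le_iff_ne_zero.2 hn
  rw [inv_div, inv_div, div_mul_div_comm, div_le_iff₀ (by positivity)]
  push_cast
  have h2 : (n : ℝ) * (n + 1) ≤ n ^ 2 * 2 := by nlinarith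
  refine h2.trans (mul_le_mul_of_nonneg_left ?_ (by positivity))
  nlinarith

theorem inv_two_pi_div_le {n : ℕ} (hn : n ≠ 0) : (2 * Real.pi / n)⁻¹ ≤ (n : ℝ) := by
  have hpi := Real.two_le_pi
  have h1 : (0 : ℝ) ≤ n := by positivity
  rw [inv_div]
  exact div_le_self h1 (by linarith)

/-- The local averages over the cells of two consecutive partitions are close in mean square. -/
theorem sum_sq_localAverage_succ_le {α M : ℝ} (h0 : 0 ≤ α) (h1 : α ≤ 1) {f : ℝ → ℝ}
    (hf : f ∈ sobolevBall α M) {n : ℕ} (hn : n ≠ 0) :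
    ∑ j ∈ Finset.range n, (localAverage n (j + 1) f - localAverage (n + 1) (j + 1) f) ^ 2 ≤
      2 * M * ((4 * Real.pi) ^ (2 * α) * (4 * Real.pi)) * (n : ℝ) ^ (1 - 2 * α) := by
  obtain ⟨g, hgm, hg, -, hJ⟩ := exists_measurable_rep hf
  have hpi := Real.pi_pos
  have hM := nonneg_of_mem_sobolevBall hf
  have hn' : (0 : ℝ) < n := by exact_mod_cast Nat.pos_of_ne_zero hn
  have hn1 : (1 : ℝ) ≤ n := by exact_mod_cast Nat.one_le_iff_ne_zero.2 hn
  have hsub : ∀ j ∈ Finset.range n, cell n j ×ˢ cell (n + 1) j ⊆ nearDiagonal (4 * Real.pi / n) := by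
    intro j hj
    have hj := Finset.mem_range.1 hj
    have hj' : (j : ℝ) + 1 ≤ n := by exact_mod_cast hj
    have hj0 : (0 : ℝ) ≤ j := by positivity
    refine cell_prod_subset hj (by omega) ?_ ?_
    · have : ((j : ℝ) + 1) / (n + 1) - j / n ≤ 2 / n := by
        rw [div_sub_div _ _ (by positivity) hn'.ne', div_le_div_iff₀ (by positivity) hn']
        nlinarith
      unfold gridPt
      push_cast
      calc _ = 2 * Real.pi * (((j : ℝ) + 1) / (n + 1) - j / n) := by ring
        _ ≤ 2 * Real.pi * (2 / n) := by gcongr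
        _ = _ := by ring
    · have : ((j : ℝ) + 1) / n - j / (n + 1) ≤ 2 / n := by
        rw [div_sub_div _ _ hn'.ne' (by positivity), div_le_div_iff₀ (by positivity) hn']
        nlinarith
      unfold gridPt
      push_cast
      calc _ = 2 * Real.pi * (((j : ℝ) + 1) / n - j / (n + 1)) := by ring
        _ ≤ 2 * Real.pi * (2 / n) := by gcongr
        _ = _ := by ring
  calc ∑ j ∈ Finset.range n, (localAverage n (j + 1) f - localAverage (n + 1) (j + 1) f) ^ 2
      ≤ ∑ j ∈ Finset.range n, (n : ℝ) ^ 2 * ∫ p : ℝ × ℝ, (g p.1 - g p.2) ^ 2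
        ∂((volume.restrict (cell n j)).prod (volume.restrict (cell (n + 1) j))) := by
        refine Finset.sum_le_sum fun j hj => ?_
        have hj := Finset.mem_range.1 hj
        rw [← hJ n j hj, ← hJ (n + 1) j (by omega)]
        refine (sq_localAverage_sub_le hg hj (by omega)).trans ?_
        refine mul_le_mul_of_nonneg_right (inv_mul_inv_le_sq hn)
          (integral_nonneg fun _ => sq_nonneg _)
    _ ≤ (n : ℝ) ^ 2 * (M * (4 * Real.pi / n) ^ (2 * α) * (2 * (4 * Real.pi / n))) := by
        rw [← Finset.mul_sum]
        refine mul_le_mul_of_nonneg_left (sum_integral_sq_sub_le h0 h1 hg hgm (by positivity) _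
          (measurableSet_cell n) (measurableSet_cell (n + 1)) (pairwise_disjoint_cell n) hsub
          (fun j hj => cell_subset (Finset.mem_range.1 hj))
          (fun j hj => cell_subset (by have := Finset.mem_range.1 hj; omega))) (by positivity)
    _ = 2 * M * ((n : ℝ) ^ 2 * ((4 * Real.pi / n) ^ (2 * α) * (4 * Real.pi / n))) := by ring
    _ = _ := by rw [sq_mul_div_rpow hn' (by positivity)]; ring

theorem sq_localAverage_sub_localAverage_le {α M : ℝ} (h0 : 0 ≤ α) (h1 : α ≤ 1) {f : ℝ → ℝ}
    (hf : f ∈ sobolevBall α M) {n i j l : ℕ} (hj : j < n) (hij : i ≤ j) (hl : j ≤ i + l) :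
    (localAverage n (i + 1) f - localAverage n (j + 1) f) ^ 2 ≤
      2 * M * ((2 * Real.pi * (l + 1)) ^ (2 * α) * (2 * Real.pi * (l + 1))) *
        (n : ℝ) ^ (1 - 2 * α) := by
  obtain ⟨g, hgm, hg, -, hJ⟩ := exists_measurable_rep hf
  have hpi := Real.pi_pos
  have hM := nonneg_of_mem_sobolevBall hf
  have hn : n ≠ 0 := by omega
  have hn' : (0 : ℝ) < n := by exact_mod_cast Nat.pos_of_ne_zero hn
  have hij' : (i : ℝ) ≤ j := by exact_mod_cast hij
  have hl' : (j : ℝ) ≤ i + l := by exact_mod_cast hl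
  have hl0 : (0 : ℝ) ≤ l := by positivity
  have hsub : cell n i ×ˢ cell n j ⊆ nearDiagonal (2 * Real.pi * (l + 1) / n) := by
    refine cell_prod_subset (by omega) hj ?_ ?_
    · unfold gridPt
      push_cast
      calc _ = 2 * Real.pi * ((j : ℝ) + 1 - i) / n := by ring
        _ ≤ _ := by gcongr; linarith
    · unfold gridPt
      push_cast
      calc _ = 2 * Real.pi * ((i : ℝ) + 1 - j) / n := by ring
        _ ≤ _ := by gcongr; linarith
  have hs := sum_integral_sq_sub_le h0 h1 hg hgm
    (δ := 2 * Real.pi * (l + 1) / n) (by positivity) (Finset.univ : Finset Unit)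
    (s := fun _ => cell n i) (t := fun _ => cell n j) (fun _ => measurableSet_cell _ _)
    (fun _ => measurableSet_cell _ _) (fun a b hab => (hab rfl).elim) (fun _ _ => hsub)
    (fun _ _ => cell_subset (by omega)) (fun _ _ => cell_subset hj)
  simp only [Finset.univ_unique, Finset.sum_const, Finset.card_singleton, one_smul] at hs
  rw [← hJ n i (by omega), ← hJ n j hj]
  have h4 : (2 * Real.pi / n)⁻¹ * (2 * Real.pi / n)⁻¹ ≤ (n : ℝ) ^ 2 := by
    rw [sq]
    have h5 : 0 ≤ (2 * Real.pi / (n : ℝ))⁻¹ := by positivity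
    exact mul_le_mul (inv_two_pi_div_le hn) (inv_two_pi_div_le hn) h5 hn'.le
  calc _ ≤ _ := sq_localAverage_sub_le hg (by omega) hj
    _ ≤ (n : ℝ) ^ 2 * (M * (2 * Real.pi * (l + 1) / n) ^ (2 * α) *
        (2 * (2 * Real.pi * (l + 1) / n))) := by
        refine mul_le_mul h4 hs (integral_nonneg fun _ => sq_nonneg _) (by positivity)
    _ = 2 * M * ((n : ℝ) ^ 2 * ((2 * Real.pi * (l + 1) / n) ^ (2 * α) *
        (2 * Real.pi * (l + 1) / n))) := by ring
    _ = _ := by rw [sq_mul_div_rpow hn' (by positivity)]; ring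

/-- The step function on the cells with values the local averages of `f`. -/
def stepFun (n : ℕ) (f : ℝ → ℝ) (x : ℝ) : ℝ :=
  ∑ j ∈ Finset.range n, (cell n j).indicator (fun _ => localAverage n (j + 1) f) x

theorem stepFun_of_mem {n j : ℕ} (hj : j < n) (f : ℝ → ℝ) {x : ℝ} (hx : x ∈ cell n j) :
    stepFun n f x = localAverage n (j + 1) f := by
  unfold stepFun
  rw [Finset.sum_eq_single_of_mem j (Finset.mem_range.2 hj)]
  · exact Set.indicator_of_mem hx _
  · intro i _ hij
    exact Set.indicator_of_notMem (fun h => Set.disjoint_left.1 (pairwise_disjoint_cell n hij) h hx) _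

theorem memLp_stepFun (n : ℕ) (f : ℝ → ℝ) {s : Set ℝ} (hs : volume s ≠ ∞) :
    MemLp (stepFun n f) 2 (volume.restrict s) := by
  have : IsFiniteMeasure (volume.restrict s) := ⟨by simpa using hs.lt_top⟩
  unfold stepFun
  exact memLp_finsetSum _ fun j _ => (memLp_const _).indicator (measurableSet_cell n j)

theorem integral_sq_sub_stepFun_le {α M : ℝ} (h0 : 0 ≤ α) (h1 : α ≤ 1) {f : ℝ → ℝ}
    (hf : f ∈ sobolevBall α M) {n : ℕ} (hn : n ≠ 0) :
    n * ∫ x in Set.Ioc (-Real.pi) Real.pi, (f x - stepFun n f x) ^ 2 ≤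
      2 * M * ((2 * Real.pi) ^ (2 * α) * (2 * Real.pi)) * (n : ℝ) ^ (1 - 2 * α) := by
  obtain ⟨g, hgm, hg, hfg, hJ⟩ := exists_measurable_rep hf
  have hpi := Real.pi_pos
  have hM := nonneg_of_mem_sobolevBall hf
  have hn' : (0 : ℝ) < n := by exact_mod_cast Nat.pos_of_ne_zero hn
  have e1 : ∫ x in Set.Ioc (-Real.pi) Real.pi, (f x - stepFun n f x) ^ 2 =
      ∫ x in Set.Ioc (-Real.pi) Real.pi, (g x - stepFun n g x) ^ 2 := by
    have e2 : stepFun n f = stepFun n g := by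
      ext x
      exact Finset.sum_congr rfl fun j hj => by rw [hJ n j (Finset.mem_range.1 hj)]
    rw [e2]
    refine setIntegral_congr_ae measurableSet_Ioc ?_
    filter_upwards [(ae_restrict_iff' measurableSet_Icc).1 hfg] with x hx hx'
    rw [hx (Set.Ioc_subset_Icc_self hx')]
  have hint : IntegrableOn (fun x => (g x - stepFun n g x) ^ 2)
      (Set.Ioc (-Real.pi) Real.pi) :=
    ((memLp_Ioc_of_mem_sobolevBall hg).sub (memLp_stepFun n g (by simp))).integrable_sq
  have e3 : ∀ j ∈ Finset.range n, ∫ x in cell n j, (g x - stepFun n g x) ^ 2 =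
      (2 * (2 * Real.pi / n))⁻¹ * ∫ p : ℝ × ℝ, (g p.1 - g p.2) ^ 2
        ∂((volume.restrict (cell n j)).prod (volume.restrict (cell n j))) := by
    intro j hj
    have hj := Finset.mem_range.1 hj
    have : IsFiniteMeasure (volume.restrict (cell n j)) := ⟨by simp [cell]⟩
    have h := integral_sq_sub_average (memLp_cell hg hj) (by rw [volume_cell]; positivity)
    rw [volume_cell, ← localAverage_eq hn] at h
    rw [← h]
    refine setIntegral_congr_fun (measurableSet_cell n j) fun x hx => ?_
    simp only [stepFun_of_mem hj g hx]
  have hsub : ∀ j ∈ Finset.range n, cell n j ×ˢ cell n j ⊆ nearDiagonal (2 * Real.pi / n) :=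
    fun j hj => cell_prod_subset (Finset.mem_range.1 hj) (Finset.mem_range.1 hj)
      (gridPt_succ_sub n j).le (gridPt_succ_sub n j).le
  have hsum := sum_integral_sq_sub_le h0 h1 hg hgm (δ := 2 * Real.pi / n) (by positivity)
    (Finset.range n) (measurableSet_cell n) (measurableSet_cell n) (pairwise_disjoint_cell n) hsub
    (fun j hj => cell_subset (Finset.mem_range.1 hj))
    (fun j hj => cell_subset (Finset.mem_range.1 hj))
  rw [e1, ← iUnion_cell hn, integral_biUnion_finset _ (fun j _ => measurableSet_cell n j)
    (fun i _ j _ hij => pairwise_disjoint_cell n hij)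
    (fun j hj => hint.mono_set (cell_subset (Finset.mem_range.1 hj))), Finset.sum_congr rfl e3,
    ← Finset.mul_sum]
  have h4 : (2 * (2 * Real.pi / n))⁻¹ ≤ (n : ℝ) := by
    refine le_trans ?_ (inv_two_pi_div_le hn)
    have : 0 < 2 * Real.pi / n := by positivity
    gcongr
    linarith
  calc _ ≤ (n : ℝ) * (n * (M * (2 * Real.pi / n) ^ (2 * α) * (2 * (2 * Real.pi / n)))) := by
        gcongr
    _ = 2 * M * ((n : ℝ) ^ 2 * ((2 * Real.pi / n) ^ (2 * α) * (2 * Real.pi / n))) := by ring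
    _ = _ := by rw [sq_mul_div_rpow hn' (by positivity)]; ring

end Rates

/-! ### The circulant covariance matrix built from the local averages -/

section Circulant

/-- The midpoints of the cells. -/
def midPt (m j : ℕ) : ℝ := 2 * Real.pi * ((j + 1 / 2) / m) - Real.pi

/-- Covariances of the stationary sequence with period `m` (up to sign) and spectrum given by the
local averages of `f`. -/
def circCov (m : ℕ) (f : ℝ → ℝ) (d : ℤ) : ℝ :=
  2 * Real.pi / m * ∑ j ∈ Finset.range m, localAverage m (j + 1) f * Real.cos (d * midPt m j)

theorem circCov_neg (m : ℕ) (f : ℝ → ℝ) (d : ℤ) : circCov m f (-d) = circCov m f d := by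
  unfold circCov
  simp

theorem natCast_mul_midPt {m : ℕ} (hm : m ≠ 0) (j : ℕ) :
    m * midPt m j = ((2 * j + 1 - m : ℤ) : ℝ) * Real.pi := by
  have : (m : ℝ) ≠ 0 := by exact_mod_cast hm
  unfold midPt
  push_cast
  field_simp

theorem circCov_sub (m : ℕ) (f : ℝ → ℝ) (d : ℤ) :
    circCov m f (d - m) = (-1) ^ (m + 1) * circCov m f d := by
  rcases eq_or_ne m 0 with rfl | hm
  · simp [circCov]
  unfold circCov
  rw [mul_left_comm, Finset.mul_sum (Finset.range m) _ ((-1 : ℝ) ^ (m + 1))]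
  refine congrArg _ (Finset.sum_congr rfl fun j _ => ?_)
  have h : ((d - m : ℤ) : ℝ) * midPt m j =
      d * midPt m j - ((2 * j + 1 - m : ℤ) : ℝ) * Real.pi := by
    rw [← natCast_mul_midPt hm]
    push_cast
    ring
  have hz : (-1 : ℝ) ^ (2 * (j : ℤ) + 1 - m) = (-1) ^ (m + 1) := by
    rw [show 2 * (j : ℤ) + 1 - m = 2 * (j - m) + ((m + 1 : ℕ) : ℤ) by push_cast; ring,
      zpow_add₀ (by norm_num), zpow_mul, zpow_natCast]
    simp
  rw [h, Real.cos_sub_int_mul_pi, hz]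
  ring

theorem integral_cos_Ioc (d : ℤ) (a h : ℝ) (hh : 0 ≤ h) :
    ∫ x in Set.Ioc (a - h) (a + h), Real.cos (d * x) =
      2 * h * Real.sinc (d * h) * Real.cos (d * a) := by
  rw [← intervalIntegral.integral_of_le (by linarith)]
  rcases eq_or_ne d 0 with rfl | hd
  · simp
    ring
  have hd' : (d : ℝ) ≠ 0 := by exact_mod_cast hd
  rw [intervalIntegral.integral_comp_mul_left Real.cos hd', integral_cos]
  rcases eq_or_ne h 0 with rfl | hh0
  · simp
  rw [Real.sinc_of_ne_zero (mul_ne_zero hd' hh0), mul_add, mul_sub, Real.sin_add, Real.sin_sub,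
    smul_eq_mul]
  field_simp
  ring

theorem cell_eq (m j : ℕ) :
    cell m j = Set.Ioc (midPt m j - Real.pi / m) (midPt m j + Real.pi / m) := by
  unfold cell gridPt midPt
  congr 1
  · ring
  · push_cast; ring

theorem re_fourierCoef {f : ℝ → ℝ} (hf : IntegrableOn f (Set.Ioc (-Real.pi) Real.pi)) (h : ℤ) :
    autocov f h = ∫ x in Set.Ioc (-Real.pi) Real.pi, Real.cos (h * x) * f x := by
  have hpi := Real.pi_pos
  have h1 : -Real.pi ≤ Real.pi := by linarith
  have hi : IntervalIntegrable f volume (-Real.pi) Real.pi :=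
    (intervalIntegrable_iff_integrableOn_Ioc_of_le h1).2 hf
  have hc : IntervalIntegrable
      (fun ω : ℝ => Complex.exp (Complex.I * h * ω) * (f ω : ℂ)) volume
      (-Real.pi) Real.pi := by
    refine IntervalIntegrable.continuousOn_mul (g := fun ω : ℝ => Complex.exp (Complex.I * h * ω))
      (f := fun ω => (f ω : ℂ)) ?_ (by fun_prop)
    exact ⟨hi.1.ofReal, hi.2.ofReal⟩
  have := intervalIntegral.intervalIntegral_re (𝕜 := ℂ) hc
  simp only [RCLike.re_eq_complex_re] at this
  unfold autocov fourierCoef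
  rw [← this, ← intervalIntegral.integral_of_le h1]
  refine intervalIntegral.integral_congr fun ω _ => ?_
  have e : Complex.I * (h : ℂ) * (ω : ℂ) = ((h * ω : ℝ) : ℂ) * Complex.I := by
    push_cast; ring
  simp only [e, Complex.re_mul_ofReal, Complex.exp_ofReal_mul_I_re]

theorem autocov_stepFun {m : ℕ} (hm : m ≠ 0) (f : ℝ → ℝ) (d : ℤ) :
    autocov (stepFun m f) d = Real.sinc (d * (Real.pi / m)) * circCov m f d := by
  have hpi := Real.pi_pos
  have hi : IntegrableOn (stepFun m f) (Set.Ioc (-Real.pi) Real.pi) :=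
    (memLp_stepFun m f (by simp)).integrable (by norm_num)
  have hi2 : IntegrableOn (fun x => Real.cos (d * x) * stepFun m f x)
      (Set.Ioc (-Real.pi) Real.pi) := by
    refine Integrable.bdd_mul hi (by fun_prop) (c := 1) (ae_of_all _ fun x => ?_)
    exact Real.abs_cos_le_one _
  rw [re_fourierCoef hi, ← iUnion_cell hm, integral_biUnion_finset _
    (fun j _ => measurableSet_cell m j) (fun i _ j _ hij => pairwise_disjoint_cell m hij)
    (fun j hj => hi2.mono_set (cell_subset (Finset.mem_range.1 hj))), circCov, ← mul_assoc,
    Finset.mul_sum]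
  refine Finset.sum_congr rfl fun j hj => ?_
  have hj := Finset.mem_range.1 hj
  have e : ∫ x in cell m j, Real.cos (d * x) * stepFun m f x =
      ∫ x in cell m j, Real.cos (d * x) * localAverage m (j + 1) f :=
    setIntegral_congr_fun (measurableSet_cell m j) fun x hx => by
      simp only [stepFun_of_mem hj f hx]
  rw [e, integral_mul_const, cell_eq, integral_cos_Ioc _ _ _ (by positivity)]
  ring

theorem sinc_lower {x : ℝ} (hx : |x| ≤ Real.pi / 2) : 2 / Real.pi ≤ Real.sinc x := by
  have hpi := Real.two_le_pi
  wlog h : 0 ≤ x generalizing x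
  · have := this (x := -x) (by rwa [abs_neg]) (by linarith)
    rwa [Real.sinc_neg] at this
  rcases h.eq_or_lt with rfl | h
  · simp only [Real.sinc_zero]
    rw [div_le_one (by linarith)]; exact hpi
  rw [abs_of_pos h] at hx
  rw [Real.sinc_of_ne_zero h.ne', le_div_iff₀ h]
  exact Real.mul_le_sin h.le hx

theorem one_sub_sinc_sq_le {a : ℝ} (h0 : 0 ≤ a) (h1 : a ≤ 1) {x : ℝ} (hx : |x| ≤ Real.pi / 2) :
    (1 - Real.sinc x) ^ 2 ≤ |x| ^ (2 * a) := by
  wlog h : 0 ≤ x generalizing x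
  · have := this (x := -x) (by rwa [abs_neg]) (by linarith)
    rwa [Real.sinc_neg, abs_neg] at this
  rcases h.eq_or_lt with rfl | h
  · simp only [Real.sinc_zero]; norm_num; positivity
  have hs := sinc_lower hx
  have hs1 := Real.sinc_le_one x
  have hs0 : 0 ≤ Real.sinc x := le_trans (by positivity) hs
  rw [abs_of_pos h] at hx ⊢
  rcases le_total x 1 with hx1 | hx1
  · have h2 : 1 - Real.sinc x ≤ x := by
      have h3 := Real.sin_gt_sub_cube h
      rw [Real.sinc_of_ne_zero h.ne', sub_le_comm, le_div_iff₀ h]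
      nlinarith [mul_pos h h]
    calc (1 - Real.sinc x) ^ 2 ≤ x ^ 2 := by
          have : 0 ≤ 1 - Real.sinc x := by linarith
          gcongr
      _ = x ^ (2 : ℝ) := by norm_cast
      _ ≤ x ^ (2 * a) := Real.rpow_le_rpow_of_exponent_ge h hx1 (by linarith)
  · calc (1 - Real.sinc x) ^ 2 ≤ 1 := by nlinarith
      _ ≤ _ := Real.one_le_rpow hx1 (by linarith)

theorem sum_rpow_mul_sq_autocov_le {α M : ℝ} {f : ℝ → ℝ} (hf : f ∈ sobolevBall α M)
    (S : Finset ℕ) : ∑ d ∈ S, (d : ℝ) ^ (2 * α) * autocov f d ^ 2 ≤ M := by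
  have h := (hf.2.1.sum_le_tsum (S.map Nat.castEmbedding) fun _ _ => by positivity).trans
    (tsum_le_of_mem_sobolevBall hf)
  refine le_trans ?_ h
  rw [Finset.sum_map]
  refine Finset.sum_le_sum fun d _ => ?_
  simp only [Nat.castEmbedding_apply, Int.cast_natCast, Nat.abs_cast]
  gcongr ?_ * ?_
  rw [← sq_abs]
  gcongr
  exact Complex.abs_re_le_norm _

theorem sum_natCast_mul_sq_autocov_le {α M : ℝ} (hα : 1 / 2 < α) {f : ℝ → ℝ}
    (hf : f ∈ sobolevBall α M) {r : ℕ} (hr : r ≠ 0) (N : ℕ) :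
    ∑ d ∈ Finset.Ico r N, (d : ℝ) * autocov f d ^ 2 ≤ M * (r : ℝ) ^ (1 - 2 * α) := by
  rw [mul_comm]
  have hr' : (0 : ℝ) < r := by exact_mod_cast Nat.pos_of_ne_zero hr
  refine le_trans ?_ (mul_le_mul_of_nonneg_left (sum_rpow_mul_sq_autocov_le hf (Finset.Ico r N))
    (by positivity))
  rw [Finset.mul_sum]
  refine Finset.sum_le_sum fun d hd => ?_
  have hd' : (r : ℝ) ≤ d := by exact_mod_cast (Finset.mem_Ico.1 hd).1
  have hd0 : (0 : ℝ) < d := by linarith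
  have : (d : ℝ) ≤ (r : ℝ) ^ (1 - 2 * α) * (d : ℝ) ^ (2 * α) := by
    calc (d : ℝ) = (d : ℝ) ^ (1 - 2 * α) * (d : ℝ) ^ (2 * α) := by
          rw [← Real.rpow_add hd0]; simp
      _ ≤ _ := by
          gcongr ?_ * _
          exact Real.rpow_le_rpow_of_nonpos hr' hd' (by linarith)
  rw [← mul_assoc]
  gcongr

/-- The constant in the comparison of `circCov` with the autocovariances. -/
def circConst (α M : ℝ) : ℝ :=
  5 * (2 * Real.pi * (2 * M * ((2 * Real.pi) ^ (2 * α) * (2 * Real.pi))) + Real.pi ^ (2 * α) * M)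

theorem sum_sq_circCov_sub_autocov_le {α M : ℝ} (h0 : 0 ≤ α) (h1 : α ≤ 1) {f : ℝ → ℝ}
    (hf : f ∈ sobolevBall α M) {m : ℕ} (hm : m ≠ 0) :
    m * ∑ d ∈ Finset.range (m / 2 + 1), (circCov m f d - autocov f d) ^ 2 ≤
      circConst α M * (m : ℝ) ^ (1 - 2 * α) := by
  have hpi := Real.pi_pos
  have hM := nonneg_of_mem_sobolevBall hf
  have hm' : (0 : ℝ) < m := by exact_mod_cast Nat.pos_of_ne_zero hm
  have hL := memLp_Ioc_of_mem_sobolevBall hf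
  have hL2 : MemLp (stepFun m f) 2 (volume.restrict (Set.Ioc (-Real.pi) Real.pi)) :=
    memLp_stepFun m f (by simp)
  set u : ℝ → ℝ := fun x => f x - stepFun m f x with hu
  have huL : MemLp u 2 (volume.restrict (Set.Ioc (-Real.pi) Real.pi)) := hL.sub hL2
  have hlin : ∀ d : ℤ, autocov u d = autocov f d - autocov (stepFun m f) d := by
    intro d
    have hb : ∀ g : ℝ → ℝ, MemLp g 2 (volume.restrict (Set.Ioc (-Real.pi) Real.pi)) →
        Integrable (fun x => Real.cos (d * x) * g x)
          (volume.restrict (Set.Ioc (-Real.pi) Real.pi)) := fun g hg =>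
      Integrable.bdd_mul (hg.integrable (by norm_num)) (by fun_prop) (c := 1)
        (ae_of_all _ fun x => Real.abs_cos_le_one _)
    rw [re_fourierCoef (huL.integrable (by norm_num)), re_fourierCoef (hL.integrable (by norm_num)),
      re_fourierCoef (hL2.integrable (by norm_num)), ← integral_sub (hb _ hL) (hb _ hL2)]
    simp only [hu, mul_sub]
  have hBessel : ∑ d ∈ Finset.range (m / 2 + 1), autocov u d ^ 2 ≤
      2 * Real.pi * ∫ x in Set.Ioc (-Real.pi) Real.pi, u x ^ 2 := by
    have h := sum_le_hasSum ((Finset.range (m / 2 + 1)).map Nat.castEmbedding)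
      (fun _ _ => by positivity) (hasSum_sq_fourierCoef huL)
    refine le_trans ?_ h
    rw [Finset.sum_map]
    refine Finset.sum_le_sum fun d _ => ?_
    rw [← sq_abs]
    gcongr
    exact Complex.abs_re_le_norm _
  have hpt : ∀ d ∈ Finset.range (m / 2 + 1), (circCov m f d - autocov f d) ^ 2 ≤
      5 * (autocov u d ^ 2 + (Real.pi / m) ^ (2 * α) * ((d : ℝ) ^ (2 * α) * autocov f d ^ 2)) := by
    intro d hd
    have hd2 : (d : ℝ) ≤ m / 2 := by
      have : 2 * d ≤ m := by have := Finset.mem_range.1 hd; omega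
      have : (2 : ℝ) * d ≤ m := by exact_mod_cast this
      linarith
    have hx : |(d : ℝ) * (Real.pi / m)| ≤ Real.pi / 2 := by
      rw [abs_of_nonneg (by positivity)]
      calc (d : ℝ) * (Real.pi / m) ≤ m / 2 * (Real.pi / m) := by gcongr
        _ = Real.pi / 2 := by field_simp
    have hs := sinc_lower hx
    have hs2 := one_sub_sinc_sq_le h0 h1 hx
    have e := autocov_stepFun hm f d
    have hl := hlin d
    rw [e] at hl
    rw [abs_of_nonneg (by positivity), Real.mul_rpow (by positivity) (by positivity)] at hs2
    simp only [Int.cast_natCast] at hl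
    set s := Real.sinc ((d : ℝ) * (Real.pi / m))
    set c := circCov m f d
    set γ := autocov f d
    have hs0 : 0 < s := lt_of_lt_of_le (by positivity) hs
    have h3 : s * (c - γ) = -autocov u d + γ * (1 - s) := by rw [hl]; ring
    have h4 : (2 / Real.pi) ^ 2 * (c - γ) ^ 2 ≤ (s * (c - γ)) ^ 2 := by
      rw [mul_pow]; gcongr
    have h5 : (s * (c - γ)) ^ 2 ≤ 2 * (autocov u d ^ 2 + γ ^ 2 * (1 - s) ^ 2) := by
      rw [h3]; nlinarith [sq_nonneg (autocov u d + γ * (1 - s))]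
    have h6 : (c - γ) ^ 2 ≤ 5 / 2 * ((2 / Real.pi) ^ 2 * (c - γ) ^ 2) := by
      have h7 : Real.pi ^ 2 ≤ 10 := by nlinarith [Real.pi_lt_d2]
      have h8 : 1 ≤ 5 / 2 * (2 / Real.pi) ^ 2 := by
        rw [div_pow, mul_div_assoc', le_div_iff₀ (by positivity)]
        linarith
      nlinarith [sq_nonneg (c - γ)]
    have h9 : γ ^ 2 * (1 - s) ^ 2 ≤ (Real.pi / m) ^ (2 * α) * ((d : ℝ) ^ (2 * α) * γ ^ 2) := by
      nlinarith [sq_nonneg γ]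
    linarith
  have hstep := integral_sq_sub_stepFun_le h0 h1 hf hm
  have hsob := sum_rpow_mul_sq_autocov_le hf (Finset.range (m / 2 + 1))
  have hrate : m * (Real.pi / m) ^ (2 * α) = Real.pi ^ (2 * α) * (m : ℝ) ^ (1 - 2 * α) := by
    rw [Real.div_rpow hpi.le hm'.le, Real.rpow_sub hm', Real.rpow_one]
    ring
  change m * ∫ x in Set.Ioc (-Real.pi) Real.pi, u x ^ 2 ≤ _ at hstep
  set I := ∫ x in Set.Ioc (-Real.pi) Real.pi, u x ^ 2
  calc m * ∑ d ∈ Finset.range (m / 2 + 1), (circCov m f d - autocov f d) ^ 2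
      ≤ m * (5 * (∑ d ∈ Finset.range (m / 2 + 1), autocov u d ^ 2 + (Real.pi / m) ^ (2 * α) *
        ∑ d ∈ Finset.range (m / 2 + 1), (d : ℝ) ^ (2 * α) * autocov f d ^ 2)) := by
        gcongr
        rw [Finset.mul_sum, ← Finset.sum_add_distrib, Finset.mul_sum]
        exact Finset.sum_le_sum hpt
    _ ≤ m * (5 * (2 * Real.pi * I + (Real.pi / m) ^ (2 * α) * M)) := by gcongr
    _ = 5 * (2 * Real.pi * (m * I) + m * (Real.pi / m) ^ (2 * α) * M) := by ring
    _ ≤ 5 * (2 * Real.pi * (2 * M * ((2 * Real.pi) ^ (2 * α) * (2 * Real.pi)) *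
        (m : ℝ) ^ (1 - 2 * α)) + Real.pi ^ (2 * α) * (m : ℝ) ^ (1 - 2 * α) * M) := by
        rw [hrate]; gcongr
    _ = _ := by unfold circConst; ring

end Circulant

section Hartley

open Matrix

/-- The first `n` rows of the (scaled) Hartley transform of order `m`. -/
def hartley (n m : ℕ) : Matrix (Fin n) (Fin m) ℝ :=
  Matrix.of fun k j => √(2 * Real.pi / m) *
    (Real.cos ((k : ℕ) * midPt m j) + Real.sin ((k : ℕ) * midPt m j))

/-- The `n × n` Toeplitz matrix with entries `circCov m f (l - k)`. -/
def circMatrix (n m : ℕ) (f : ℝ → ℝ) : Matrix (Fin n) (Fin n) ℝ :=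
  Matrix.of fun k l => circCov m f ((l : ℤ) - (k : ℤ))

/-- The local averages as a vector. -/
def averages (m : ℕ) (f : ℝ → ℝ) (j : Fin m) : ℝ := localAverage m ((j : ℕ) + 1) f

theorem midPt_rev {m : ℕ} (j : Fin m) : midPt m (Fin.rev j : Fin m) = -midPt m j := by
  have hm : (m : ℝ) ≠ 0 := by exact_mod_cast (Fin.pos j).ne'
  have h : ((Fin.rev j : Fin m) : ℕ) + (j + 1) = m := by
    rw [Fin.val_rev]; omega
  have h' : (((Fin.rev j : Fin m) : ℕ) : ℝ) = m - j - 1 := by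
    have : (((Fin.rev j : Fin m) : ℕ) : ℝ) + (j + 1) = m := by exact_mod_cast h
    linarith
  unfold midPt
  rw [h']
  field_simp
  ring

/-- Symmetry of the local averages of an even function. -/
theorem averages_rev {m : ℕ} {f : ℝ → ℝ} (hf : ∀ x ∈ Set.Icc (-Real.pi) Real.pi, f x = f (-x))
    (j : Fin m) : averages m f (Fin.rev j) = averages m f j := by
  have hpi := Real.pi_pos
  have hm : m ≠ 0 := (Fin.pos j).ne'
  unfold averages
  rw [localAverage_eq hm, localAverage_eq hm]
  congr 1
  have hm0 : (0 : ℝ) < m := by exact_mod_cast (Fin.pos j)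
  have hle : ∀ i, midPt m i - Real.pi / m ≤ midPt m i + Real.pi / m := fun i => by
    have : 0 < Real.pi / m := by positivity
    linarith
  rw [cell_eq, cell_eq, midPt_rev, ← intervalIntegral.integral_of_le,
    ← intervalIntegral.integral_of_le (hle j)]
  · have h2 := intervalIntegral.integral_comp_neg (a := midPt m j - Real.pi / m)
      (b := midPt m j + Real.pi / m) f
    rw [neg_add', neg_sub', sub_neg_eq_add] at h2
    rw [← h2]
    refine intervalIntegral.integral_congr_ae (ae_of_all _ fun x hx => ?_)
    rw [Set.uIoc_of_le (hle j), ← cell_eq] at hx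
    exact (hf x (Set.Ioc_subset_Icc_self (cell_subset j.2 hx))).symm
  · have : 0 < Real.pi / m := by positivity
    linarith

theorem hartley_mul_diagonal {n m : ℕ} {f : ℝ → ℝ}
    (hf : ∀ x ∈ Set.Icc (-Real.pi) Real.pi, f x = f (-x)) :
    hartley n m * diagonal (averages m f) * (hartley n m)ᵀ = circMatrix n m f := by
  ext k l
  have hpi := Real.pi_pos
  rw [mul_apply]
  simp only [mul_diagonal, transpose_apply, hartley, circMatrix, of_apply]
  set p : ℝ := ((k : ℕ) : ℝ)
  set q : ℝ := ((l : ℕ) : ℝ)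
  have hs : √(2 * Real.pi / m) * √(2 * Real.pi / m) = 2 * Real.pi / m :=
    Real.mul_self_sqrt (by positivity)
  have h0 : ∑ j : Fin m, averages m f j * Real.sin ((p + q) * midPt m j) = 0 := by
    have h1 : ∑ j : Fin m, averages m f j * Real.sin ((p + q) * midPt m j) =
        ∑ j : Fin m, -(averages m f j * Real.sin ((p + q) * midPt m j)) := by
      rw [← Equiv.sum_comp Fin.revPerm]
      refine Finset.sum_congr rfl fun j _ => ?_
      rw [Fin.revPerm_apply, averages_rev hf, midPt_rev, mul_neg, Real.sin_neg, mul_neg]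
    rw [Finset.sum_neg_distrib] at h1
    linarith
  have h2 : circCov m f ((l : ℤ) - (k : ℤ)) =
      ∑ j : Fin m, 2 * Real.pi / m * (averages m f j * Real.cos ((q - p) * midPt m j)) := by
    unfold circCov
    rw [Finset.sum_range, Finset.mul_sum]
    refine Finset.sum_congr rfl fun j _ => ?_
    push_cast
    rfl
  have h3 : ∑ j : Fin m, 2 * Real.pi / m * (averages m f j * Real.sin ((p + q) * midPt m j)) = 0 := by
    rw [← Finset.mul_sum, h0, mul_zero]
  rw [h2, ← add_zero (∑ j : Fin m, 2 * Real.pi / m * (averages m f j *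
    Real.cos ((q - p) * midPt m j))), ← h3, ← Finset.sum_add_distrib]
  refine Finset.sum_congr rfl fun j _ => ?_
  rw [sub_mul, add_mul, Real.cos_sub, Real.sin_add]
  linear_combination (averages m f j * (Real.cos (p * midPt m j) + Real.sin (p * midPt m j)) *
    (Real.cos (q * midPt m j) + Real.sin (q * midPt m j))) * hs

theorem localAverage_const {m j : ℕ} (hm : m ≠ 0) (a : ℝ) :
    localAverage m (j + 1) (fun _ => a) = a := by
  have hpi := Real.pi_pos
  have hm0 : (0 : ℝ) < m := by exact_mod_cast Nat.pos_of_ne_zero hm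
  rw [localAverage_eq hm, integral_const, volume_cell, smul_eq_mul]
  field_simp

theorem circCov_one {m : ℕ} (hm : m ≠ 0) {d : ℤ} (hd : d ≠ 0) (hdm : |d| < m) :
    circCov m (fun _ => 1) d = 0 := by
  have hpi := Real.pi_pos
  have hm0 : (0 : ℝ) < m := by exact_mod_cast Nat.pos_of_ne_zero hm
  have hd0 : (d : ℝ) ≠ 0 := by exact_mod_cast hd
  have h1 := autocov_stepFun hm (fun _ => 1) d
  have hi : IntegrableOn (stepFun m fun _ => 1) (Set.Ioc (-Real.pi) Real.pi) :=
    (memLp_stepFun m _ (by simp)).integrable (by norm_num)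
  have h2 : autocov (stepFun m fun _ => 1) d = 0 := by
    rw [re_fourierCoef hi]
    have e : ∫ x in Set.Ioc (-Real.pi) Real.pi, Real.cos (d * x) * stepFun m (fun _ => 1) x =
        ∫ x in Set.Ioc (-Real.pi) Real.pi, Real.cos (d * x) := by
      refine setIntegral_congr_fun measurableSet_Ioc fun x hx => ?_
      rw [← iUnion_cell hm] at hx
      simp only [Set.mem_iUnion, Finset.mem_range] at hx
      obtain ⟨j, hj, hx⟩ := hx
      simp only [stepFun_of_mem hj _ hx, localAverage_const hm, mul_one]
    have h3 := integral_cos_Ioc d 0 Real.pi hpi.le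
    rw [zero_sub, zero_add] at h3
    rw [e, h3, Real.sinc_of_ne_zero (by positivity), Real.sin_int_mul_pi]
    simp
  rw [h2, eq_comm, mul_eq_zero] at h1
  refine h1.resolve_left ?_
  rw [Real.sinc_of_ne_zero (by positivity)]
  refine div_ne_zero ?_ (by positivity)
  intro h
  rw [Real.sin_eq_zero_iff] at h
  obtain ⟨k, hk⟩ := h
  have h4 : (d : ℝ) = (k * m : ℤ) := by
    push_cast
    field_simp at hk
    linarith
  have h5 : d = k * m := by exact_mod_cast h4
  rw [h5, abs_mul, Nat.abs_cast] at hdm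
  have h6 : |k| < 1 := by
    by_contra h7
    rw [not_lt] at h7
    have : (m : ℤ) ≤ |k| * m := le_mul_of_one_le_left (by positivity) h7
    omega
  rw [Int.abs_lt_one_iff] at h6
  exact hd (by rw [h5, h6, zero_mul])

theorem hartley_mul_transpose {n m : ℕ} (hnm : n ≤ m) :
    hartley n m * (hartley n m)ᵀ = (2 * Real.pi) • (1 : Matrix (Fin n) (Fin n) ℝ) := by
  rcases eq_or_ne m 0 with hm | hm
  · obtain rfl : n = 0 := by omega
    exact Subsingleton.elim _ _
  have hm0 : (0 : ℝ) < m := by exact_mod_cast Nat.pos_of_ne_zero hm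
  have h1 : averages m (fun _ => 1) = fun _ => 1 := by
    ext j; exact localAverage_const hm 1
  have h2 := hartley_mul_diagonal (n := n) (m := m) (f := fun _ => 1) fun _ _ => rfl
  rw [h1, diagonal_one, Matrix.mul_one] at h2
  rw [h2]
  ext k l
  rw [circMatrix, of_apply, Matrix.smul_apply, smul_eq_mul]
  rcases eq_or_ne k l with rfl | hkl
  · rw [sub_self, one_apply_eq, circCov]
    simp only [localAverage_const hm]
    simp
    field_simp
  · rw [one_apply_ne hkl, mul_zero]
    refine circCov_one hm ?_ ?_
    · intro h
      apply hkl
      ext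
      omega
    · have := k.2
      have := l.2
      rw [abs_lt]
      constructor <;> omega

theorem transpose_hartley_mul (m : ℕ) :
    (hartley m m)ᵀ * hartley m m = (2 * Real.pi) • (1 : Matrix (Fin m) (Fin m) ℝ) := by
  have hpi := Real.pi_pos
  have h := hartley_mul_transpose (le_refl m)
  have h1 : hartley m m * ((2 * Real.pi)⁻¹ • (hartley m m)ᵀ) = 1 := by
    rw [Matrix.mul_smul, h, smul_smul, inv_mul_cancel₀ (by positivity), one_smul]
  have h2 := mul_eq_one_comm.1 h1
  rw [Matrix.smul_mul] at h2
  rw [← h2, smul_smul, mul_inv_cancel₀ (by positivity), one_smul]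

theorem le_averages {M : ℝ} {f : ℝ → ℝ} (hfi : IntegrableOn f (Set.Ioc (-Real.pi) Real.pi))
    (hf : ∀ x ∈ Set.Icc (-Real.pi) Real.pi, M⁻¹ ≤ f x) {m : ℕ} (j : Fin m) :
    M⁻¹ ≤ averages m f j := by
  have hpi := Real.pi_pos
  have hm : m ≠ 0 := (Fin.pos j).ne'
  have hm0 : (0 : ℝ) < m := by exact_mod_cast Nat.pos_of_ne_zero hm
  rw [averages, ← localAverage_const hm M⁻¹ (j := j), localAverage_eq hm, localAverage_eq hm]
  refine mul_le_mul_of_nonneg_left ?_ (by positivity)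
  refine setIntegral_mono_on (integrable_const_iff.2 (Or.inr ⟨by simp [cell]⟩))
    (hfi.mono_set (cell_subset j.2)) (measurableSet_cell _ _) fun x hx => ?_
  exact hf x (Set.Ioc_subset_Icc_self (cell_subset j.2 hx))

theorem circMatrix_sub_posSemidef {n m : ℕ} (hnm : n ≤ m) {α M : ℝ} {f : ℝ → ℝ}
    (hf : f ∈ spectralClass α M) :
    (circMatrix n m f - (2 * Real.pi * M⁻¹) • (1 : Matrix (Fin n) (Fin n) ℝ)).PosSemidef := by
  have hfi : IntegrableOn f (Set.Ioc (-Real.pi) Real.pi) :=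
    (memLp_Ioc_of_mem_sobolevBall hf.1).integrable (by norm_num)
  have e : circMatrix n m f - (2 * Real.pi * M⁻¹) • (1 : Matrix (Fin n) (Fin n) ℝ) =
      hartley n m * diagonal (fun j => averages m f j - M⁻¹) * (hartley n m)ᴴ := by
    have h1 : diagonal (fun j => averages m f j - M⁻¹) =
        diagonal (averages m f) - M⁻¹ • (1 : Matrix (Fin m) (Fin m) ℝ) := by
      rw [smul_one_eq_diagonal, diagonal_sub]
    rw [conjTranspose_eq_transpose_of_trivial, h1, Matrix.mul_sub, Matrix.sub_mul,
      hartley_mul_diagonal fun x hx => (hf.2 x hx).2, Matrix.mul_smul, Matrix.mul_one,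
      Matrix.smul_mul, hartley_mul_transpose hnm, smul_smul, mul_comm M⁻¹]
  rw [e]
  refine PosSemidef.mul_mul_conjTranspose_same (PosSemidef.diagonal fun j => ?_) _
  exact sub_nonneg.2 (le_averages hfi (fun x hx => (hf.2 x hx).1) j)

theorem averages_pos {α M : ℝ} (hM : 0 < M) {f : ℝ → ℝ} (hf : f ∈ spectralClass α M) {m : ℕ}
    (j : Fin m) : 0 < averages m f j :=
  (inv_pos.2 hM).trans_le (le_averages ((memLp_Ioc_of_mem_sobolevBall hf.1).integrable
    (by norm_num)) (fun x hx => (hf.2 x hx).1) j)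

theorem scaleLaw_map_hartley {α M : ℝ} (hM : 0 < M) {f : ℝ → ℝ} (hf : f ∈ spectralClass α M)
    (n m : ℕ) :
    (scaleLaw m f).map (fun x => mulVecLp (hartley n m) (WithLp.toLp 2 x)) =
      multivariateGaussian 0 (circMatrix n m f) := by
  rw [← hartley_mul_diagonal fun x hx => (hf.2 x hx).2,
    ← map_pi_gaussianReal fun j => (averages_pos hM hf j).le]
  rfl

theorem autocov_neg {α M : ℝ} {f : ℝ → ℝ} (hf : f ∈ sobolevBall α M) (h : ℤ) :
    autocov f (-h) = autocov f h := by
  have hi : IntegrableOn f (Set.Ioc (-Real.pi) Real.pi) :=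
    (memLp_Ioc_of_mem_sobolevBall hf).integrable (by norm_num)
  rw [re_fourierCoef hi, re_fourierCoef hi]
  simp

theorem transpose_toeplitz {α M : ℝ} {f : ℝ → ℝ} (hf : f ∈ sobolevBall α M) (n : ℕ) :
    (toeplitz n f)ᵀ = toeplitz n f := by
  ext k l
  simp only [toeplitz, transpose_apply, of_apply]
  rw [← autocov_neg hf, neg_sub]

end Hartley

section Counting

theorem sum_range_symm_le (n : ℕ) {ψ : ℕ → ℕ → ℝ} (h0 : ∀ j k, 0 ≤ ψ j k)
    (hsymm : ∀ j k, ψ j k = ψ k j) :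
    ∑ j ∈ Finset.range n, ∑ k ∈ Finset.range n, ψ j k ≤
      2 * ∑ d ∈ Finset.range n, ∑ j ∈ Finset.range (n - d), ψ j (j + d) := by
  have h1 : ∑ d ∈ Finset.range n, ∑ j ∈ Finset.range (n - d), ψ j (j + d) =
      ∑ j ∈ Finset.range n, ∑ k ∈ Finset.range n, if j ≤ k then ψ j k else 0 := by
    rw [Finset.sum_comm' (t' := Finset.range n) (s' := fun j => Finset.range (n - j))
      (by intro x y; simp only [Finset.mem_range]; omega)]
    refine Finset.sum_congr rfl fun j hj => ?_
    have hj := Finset.mem_range.1 hj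
    rw [← Finset.sum_filter]
    have : (Finset.range n).filter (fun k => j ≤ k) = Finset.Ico j n := by
      ext k; simp only [Finset.mem_filter, Finset.mem_range, Finset.mem_Ico]; omega
    rw [this, Finset.sum_Ico_eq_sum_range]
  have h2 : ∑ j ∈ Finset.range n, ∑ k ∈ Finset.range n, (if j ≤ k then ψ j k else 0) =
      ∑ j ∈ Finset.range n, ∑ k ∈ Finset.range n, if k ≤ j then ψ j k else 0 := by
    rw [Finset.sum_comm]
    refine Finset.sum_congr rfl fun j _ => Finset.sum_congr rfl fun k _ => ?_
    rw [hsymm]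
  rw [h1, two_mul]
  nth_rw 2 [h2]
  rw [← Finset.sum_add_distrib]
  refine Finset.sum_le_sum fun j _ => ?_
  rw [← Finset.sum_add_distrib]
  refine Finset.sum_le_sum fun k _ => ?_
  have := h0 j k
  rcases le_total j k with h | h
  · rw [if_pos h]; split_ifs <;> linarith
  · rw [if_pos h]; split_ifs <;> linarith

end Counting

section Truncation

theorem sum_reflect_le {m : ℕ} {S T : Finset ℕ} (h : ∀ d ∈ S, d ≤ m ∧ m - d ∈ T) {φ : ℕ → ℝ}
    (h0 : ∀ e, 0 ≤ φ e) : ∑ d ∈ S, φ (m - d) ≤ ∑ e ∈ T, φ e := by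
  have hinj : Set.InjOn (fun d => m - d) (S : Set ℕ) := by
    intro a ha b hb hab
    have := (h a ha).1
    have := (h b hb).1
    simp only at hab
    omega
  rw [← Finset.sum_image (f := φ) hinj]
  refine Finset.sum_le_sum_of_subset_of_nonneg ?_ fun _ _ _ => h0 _
  intro e he
  obtain ⟨d, hd, rfl⟩ := Finset.mem_image.1 he
  exact (h d hd).2

theorem circCov_sq_reflect {m d : ℕ} (hd : d ≤ m) (f : ℝ → ℝ) :
    circCov m f (m - d : ℕ) = (-1) ^ (m + 1) * circCov m f d := by
  rw [← circCov_sub, ← circCov_neg]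
  congr 1
  push_cast [hd]
  ring

theorem sum_sq_toeplitz_sub_circMatrix_le {α M : ℝ} (hα : 1 / 2 < α) (h1 : α ≤ 1) {f : ℝ → ℝ}
    (hf : f ∈ sobolevBall α M) {n r : ℕ} (hr : r ≠ 0) (hn : n ≠ 0) :
    ∑ i, ∑ j, (toeplitz n f i j - circMatrix n (n + r) f i j) ^ 2 ≤
      10 * (circConst α M * ((n + r : ℕ) : ℝ) ^ (1 - 2 * α)) +
      8 * (M * (r : ℝ) ^ (1 - 2 * α)) + 4 * (M * (((n + r) / 2 : ℕ) : ℝ) ^ (1 - 2 * α)) := by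
  set m := n + r with hm
  have h := sum_sq_circCov_sub_autocov_le (by linarith) h1 hf (m := m) (by omega)
  have hW1 := sum_natCast_mul_sq_autocov_le hα hf hr (m / 2 + 1)
  have hW2 := sum_natCast_mul_sq_autocov_le hα hf (r := m / 2) (by omega) n
  set ε := circConst α M * (m : ℝ) ^ (1 - 2 * α)
  set c : ℕ → ℝ := fun d => circCov m f d with hc
  set γ : ℕ → ℝ := fun d => autocov f d with hγ
  have hψ : ∑ i, ∑ j, (toeplitz n f i j - circMatrix n m f i j) ^ 2 =
      ∑ j ∈ Finset.range n, ∑ k ∈ Finset.range n,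
        (autocov f ((k : ℤ) - j) - circCov m f ((k : ℤ) - j)) ^ 2 := by
    rw [Finset.sum_range]
    refine Finset.sum_congr rfl fun j _ => ?_
    rw [Finset.sum_range]
    rfl
  have hsym := sum_range_symm_le n
    (ψ := fun j k => (autocov f ((k : ℤ) - j) - circCov m f ((k : ℤ) - j)) ^ 2)
    (fun _ _ => sq_nonneg _) (fun j k => by
      rw [← autocov_neg hf, ← circCov_neg, neg_sub])
  rw [hψ]
  refine hsym.trans ?_
  have hterm : ∀ d ∈ Finset.range n, ∑ j ∈ Finset.range (n - d),
      (autocov f (((j + d : ℕ) : ℤ) - j) - circCov m f (((j + d : ℕ) : ℤ) - j)) ^ 2 =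
      ((n - d : ℕ) : ℝ) * (c d - γ d) ^ 2 := by
    intro d _
    have : ∀ j : ℕ, ((j + d : ℕ) : ℤ) - j = d := fun j => by push_cast; ring
    simp only [this, Finset.sum_const, Finset.card_range, nsmul_eq_mul, hc, hγ]
    ring
  rw [Finset.sum_congr rfl hterm]
  have hsplit : ∑ d ∈ Finset.range n, ((n - d : ℕ) : ℝ) * (c d - γ d) ^ 2 ≤
      ∑ d ∈ Finset.range (m / 2 + 1), m * (c d - γ d) ^ 2 +
      ∑ d ∈ Finset.Ico (m / 2 + 1) n, ((n - d : ℕ) : ℝ) * (c d - γ d) ^ 2 := by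
    have hsub : Finset.range n ⊆ Finset.range (m / 2 + 1) ∪ Finset.Ico (m / 2 + 1) n := by
      intro d hd
      simp only [Finset.mem_union, Finset.mem_range, Finset.mem_Ico] at hd ⊢
      omega
    refine (Finset.sum_le_sum_of_subset_of_nonneg hsub fun _ _ _ => by positivity).trans ?_
    rw [Finset.sum_union (by
      rw [Finset.disjoint_left]; intro d hd
      simp only [Finset.mem_range, Finset.mem_Ico] at hd ⊢
      omega)]
    gcongr with d hd
    omega
  have htail : ∑ d ∈ Finset.Ico (m / 2 + 1) n, ((n - d : ℕ) : ℝ) * (c d - γ d) ^ 2 ≤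
      2 * ∑ d ∈ Finset.Ico (m / 2 + 1) n, (d : ℝ) * γ d ^ 2 +
      ∑ d ∈ Finset.Ico (m / 2 + 1) n, (4 * (m * (c (m - d) - γ (m - d)) ^ 2)) +
      ∑ d ∈ Finset.Ico (m / 2 + 1) n, 4 * (((m - d : ℕ) : ℝ) * γ (m - d) ^ 2) := by
    rw [Finset.mul_sum, ← Finset.sum_add_distrib, ← Finset.sum_add_distrib]
    refine Finset.sum_le_sum fun d hd => ?_
    rw [Finset.mem_Ico] at hd
    have hdm : d ≤ m := by omega
    have e1 : c d ^ 2 = c (m - d) ^ 2 := by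
      simp only [hc]
      rw [circCov_sq_reflect hdm, mul_pow, ← pow_mul, mul_comm (m + 1), pow_mul]
      simp
    have a1 : ((n - d : ℕ) : ℝ) ≤ d := by exact_mod_cast (by omega : n - d ≤ d)
    have a2 : ((n - d : ℕ) : ℝ) ≤ (m - d : ℕ) := by exact_mod_cast (by omega : n - d ≤ m - d)
    have a3 : ((m - d : ℕ) : ℝ) ≤ m := by exact_mod_cast Nat.sub_le m d
    have a4 : (0 : ℝ) ≤ (m - d : ℕ) := by positivity
    calc ((n - d : ℕ) : ℝ) * (c d - γ d) ^ 2
        ≤ ((n - d : ℕ) : ℝ) * (2 * γ d ^ 2 + 2 * c (m - d) ^ 2) := by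
          rw [← e1]
          gcongr
          nlinarith [sq_nonneg (c d + γ d)]
      _ = 2 * (((n - d : ℕ) : ℝ) * γ d ^ 2) + 2 * (((n - d : ℕ) : ℝ) * c (m - d) ^ 2) := by ring
      _ ≤ 2 * ((d : ℝ) * γ d ^ 2) + 2 * (((m - d : ℕ) : ℝ) *
          (2 * (c (m - d) - γ (m - d)) ^ 2 + 2 * γ (m - d) ^ 2)) := by
          gcongr
          nlinarith [sq_nonneg (c (m - d) - 2 * γ (m - d))]
      _ = 2 * ((d : ℝ) * γ d ^ 2) + 4 * (((m - d : ℕ) : ℝ) * (c (m - d) - γ (m - d)) ^ 2) +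
          4 * (((m - d : ℕ) : ℝ) * γ (m - d) ^ 2) := by ring
      _ ≤ _ := by gcongr
  have hr1 : ∑ d ∈ Finset.Ico (m / 2 + 1) n, (4 * (m * (c (m - d) - γ (m - d)) ^ 2)) ≤
      ∑ e ∈ Finset.range (m / 2 + 1), 4 * (m * (c e - γ e) ^ 2) :=
    sum_reflect_le (φ := fun e => 4 * (m * (c e - γ e) ^ 2)) (fun d hd => by
      rw [Finset.mem_Ico] at hd; rw [Finset.mem_range]; omega) fun _ => by positivity
  have hr2 : ∑ d ∈ Finset.Ico (m / 2 + 1) n, 4 * (((m - d : ℕ) : ℝ) * γ (m - d) ^ 2) ≤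
      ∑ e ∈ Finset.Ico r (m / 2 + 1), 4 * ((e : ℝ) * γ e ^ 2) :=
    sum_reflect_le (φ := fun e => 4 * ((e : ℝ) * γ e ^ 2)) (fun d hd => by
      rw [Finset.mem_Ico] at hd; rw [Finset.mem_Ico]; omega) fun _ => by positivity
  have hr3 : ∑ d ∈ Finset.Ico (m / 2 + 1) n, (d : ℝ) * γ d ^ 2 ≤
      ∑ d ∈ Finset.Ico (m / 2) n, (d : ℝ) * γ d ^ 2 :=
    Finset.sum_le_sum_of_subset_of_nonneg (Finset.Ico_subset_Ico_left (Nat.le_succ _))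
      fun _ _ _ => by positivity
  simp only [← Finset.mul_sum] at hsplit htail hr1 hr2
  linarith

end Truncation

/-! ### Folding a stationary sequence into an almost periodic one -/

section Folding

open Matrix

/-- Angle of the rotation that joins the two ends of the sequence over a stretch of length `r`. -/
def foldAngle (r j : ℕ) : ℝ := Real.pi / 2 * min 1 ((j : ℝ) / r)

theorem foldAngle_of_le {r j : ℕ} (hr : r ≠ 0) (hj : r ≤ j) : foldAngle r j = Real.pi / 2 := by
  have hr' : (0 : ℝ) < r := by exact_mod_cast Nat.pos_of_ne_zero hr
  have : (1 : ℝ) ≤ (j : ℝ) / r := by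
    rw [one_le_div hr']; exact_mod_cast hj
  rw [foldAngle, min_eq_left this, mul_one]

theorem abs_foldAngle_sub_le (r j d : ℕ) :
    |foldAngle r (j + d) - foldAngle r j| ≤ Real.pi / 2 * (d / r) := by
  have hpi := Real.pi_pos
  unfold foldAngle
  rw [← mul_sub, abs_mul, abs_of_pos (by positivity)]
  gcongr
  refine (abs_min_sub_min_le_max 1 _ 1 _).trans ?_
  rw [sub_self, abs_zero]
  push_cast
  rw [add_div, add_sub_cancel_left, abs_of_nonneg (by positivity)]
  exact max_le (by positivity) le_rfl

theorem foldAngle_zero (r : ℕ) : foldAngle r 0 = 0 := by simp [foldAngle]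

theorem foldAngle_mem (r j : ℕ) : foldAngle r j ∈ Set.Icc 0 (Real.pi / 2) := by
  have hpi := Real.pi_pos
  unfold foldAngle
  refine ⟨by positivity, ?_⟩
  exact mul_le_of_le_one_right (by positivity) (min_le_left _ _)

theorem one_sub_cos_sq_le {a : ℝ} (h0 : 0 ≤ a) (h1 : a ≤ 1) (x : ℝ) :
    (1 - Real.cos x) ^ 2 ≤ 4 * |x| ^ (2 * a) := by
  refine le_trans ?_ (norm_exp_I_sub_one_sq_le h0 h1 x)
  rw [Complex.norm_exp_I_mul_ofReal_sub_one, Real.norm_eq_abs, sq_abs]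
  have h2 : Real.cos x = 2 * Real.cos (x / 2) ^ 2 - 1 := by
    rw [← Real.cos_two_mul]; congr 1; ring
  have h3 := Real.sin_sq_add_cos_sq (x / 2)
  have h4 := Real.cos_le_one x
  have h5 := Real.neg_one_le_cos x
  nlinarith

/-- The constant in the bounds for the folded sequence. -/
def foldConst (α : ℝ) : ℝ := 4 * (Real.pi / 2) ^ (2 * α)

theorem foldConst_pos (α : ℝ) : 0 < foldConst α := by
  have := Real.pi_pos
  unfold foldConst; positivity

theorem one_sub_cos_sq_le_of_abs_le {α : ℝ} (h0 : 0 ≤ α) (h1 : α ≤ 1) {r d : ℕ} {x : ℝ}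
    (hx : |x| ≤ Real.pi / 2 * (d / r)) :
    (1 - Real.cos x) ^ 2 ≤ foldConst α * ((d : ℝ) ^ (2 * α) / (r : ℝ) ^ (2 * α)) := by
  have hpi := Real.pi_pos
  calc (1 - Real.cos x) ^ 2 ≤ 4 * |x| ^ (2 * α) := one_sub_cos_sq_le h0 h1 x
    _ ≤ 4 * (Real.pi / 2 * (d / r)) ^ (2 * α) := by gcongr
    _ = _ := by
        rw [Real.mul_rpow (by positivity) (by positivity),
          Real.div_rpow (x := (d : ℝ)) (by positivity) (by positivity), foldConst]
        ring

theorem sum_ite_lt_le (N r : ℕ) {X : ℝ} (hX : 0 ≤ X) :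
    ∑ j ∈ Finset.range N, (if j < r then X else 0) ≤ r * X := by
  rw [← Finset.sum_filter, Finset.sum_const, nsmul_eq_mul]
  gcongr
  calc _ ≤ (Finset.range r).card := Finset.card_le_card fun j hj => by
        simp only [Finset.mem_filter, Finset.mem_range] at hj ⊢; exact hj.2
    _ = r := Finset.card_range r

theorem mul_rpow_div {α : ℝ} {r : ℕ} (hr : r ≠ 0) (x : ℝ) :
    (r : ℝ) * (x / (r : ℝ) ^ (2 * α)) = (r : ℝ) ^ (1 - 2 * α) * x := by
  have hr' : (0 : ℝ) < r := by exact_mod_cast Nat.pos_of_ne_zero hr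
  rw [Real.rpow_sub hr', Real.rpow_one]
  ring

theorem sum_one_sub_cos_foldAngle_sub_le {α : ℝ} (h0 : 0 ≤ α) (h1 : α ≤ 1) {r : ℕ} (hr : r ≠ 0)
    (N d : ℕ) :
    ∑ j ∈ Finset.range N, (1 - Real.cos (foldAngle r (j + d) - foldAngle r j)) ^ 2 ≤
      foldConst α * (r : ℝ) ^ (1 - 2 * α) * (d : ℝ) ^ (2 * α) := by
  have hK := foldConst_pos α
  calc _ ≤ ∑ j ∈ Finset.range N, (if j < r then
        foldConst α * ((d : ℝ) ^ (2 * α) / (r : ℝ) ^ (2 * α)) else 0) := by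
        refine Finset.sum_le_sum fun j _ => ?_
        split_ifs with hj
        · exact one_sub_cos_sq_le_of_abs_le h0 h1 (abs_foldAngle_sub_le r j d)
        · rw [foldAngle_of_le hr (by omega), foldAngle_of_le hr (by omega)]
          simp
    _ ≤ r * (foldConst α * ((d : ℝ) ^ (2 * α) / (r : ℝ) ^ (2 * α))) :=
        sum_ite_lt_le _ _ (by positivity)
    _ = foldConst α * (r * ((d : ℝ) ^ (2 * α) / (r : ℝ) ^ (2 * α))) := by ring
    _ = _ := by rw [mul_rpow_div hr]; ring

theorem sum_one_sub_cos_foldAngle_le {α : ℝ} (hα : 1 / 2 < α) (h1 : α ≤ 1) {r : ℕ} (hr : r ≠ 0)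
    (e : ℕ) :
    ∑ j ∈ Finset.range e, (1 - Real.cos (foldAngle r j)) ^ 2 ≤
      foldConst α * (r : ℝ) ^ (1 - 2 * α) * (e : ℝ) ^ (2 * α) := by
  have hpi := Real.two_le_pi
  have hr' : (0 : ℝ) < r := by exact_mod_cast Nat.pos_of_ne_zero hr
  have hK := foldConst_pos α
  have hK1 : 1 ≤ foldConst α := by
    have : 1 ≤ (Real.pi / 2) ^ (2 * α) := Real.one_le_rpow (by linarith) (by linarith)
    unfold foldConst
    linarith
  rcases le_total e r with her | her
  · calc _ ≤ ∑ j ∈ Finset.range e,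
          foldConst α * ((e : ℝ) ^ (2 * α) / (r : ℝ) ^ (2 * α)) := by
          refine Finset.sum_le_sum fun j hj => ?_
          refine one_sub_cos_sq_le_of_abs_le (by linarith) h1 ?_
          have h := abs_foldAngle_sub_le r 0 j
          rw [foldAngle_zero, sub_zero, zero_add] at h
          refine h.trans ?_
          have : j ≤ e := (Finset.mem_range.1 hj).le
          gcongr
      _ = e * (foldConst α * ((e : ℝ) ^ (2 * α) / (r : ℝ) ^ (2 * α))) := by
          rw [Finset.sum_const, Finset.card_range, nsmul_eq_mul]
      _ ≤ r * (foldConst α * ((e : ℝ) ^ (2 * α) / (r : ℝ) ^ (2 * α))) := by gcongr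
      _ = foldConst α * (r * ((e : ℝ) ^ (2 * α) / (r : ℝ) ^ (2 * α))) := by ring
      _ = _ := by rw [mul_rpow_div hr]; ring
  · have he' : (r : ℝ) ≤ e := by exact_mod_cast her
    have he0 : (0 : ℝ) < e := by linarith
    calc _ ≤ ∑ j ∈ Finset.range e, (1 : ℝ) := by
          refine Finset.sum_le_sum fun j _ => ?_
          have h2 := foldAngle_mem r j
          have h3 := Real.cos_nonneg_of_mem_Icc (x := foldAngle r j) ⟨by linarith [h2.1], h2.2⟩
          have h4 := Real.cos_le_one (foldAngle r j)
          nlinarith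
      _ = (e : ℝ) := by simp
      _ = (e : ℝ) ^ (1 - 2 * α) * (e : ℝ) ^ (2 * α) := by rw [← Real.rpow_add he0]; simp
      _ ≤ (r : ℝ) ^ (1 - 2 * α) * (e : ℝ) ^ (2 * α) := by
          gcongr ?_ * _
          exact Real.rpow_le_rpow_of_nonpos hr' he' (by linarith)
      _ ≤ _ := by
          rw [mul_assoc]
          exact le_mul_of_one_le_left (by positivity) hK1

/-- The matrix folding a sequence of length `m + r` into one of length `m`. -/
def foldMatrix (m r : ℕ) : Matrix (Fin m) (Fin (m + r)) ℝ :=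
  Matrix.of fun j k => (if (k : ℕ) = j then Real.sin (foldAngle r j) else 0) +
    (if (k : ℕ) = j + m then (-1) ^ (m + 1) * Real.cos (foldAngle r j) else 0)

theorem sum_foldMatrix_mul {m r : ℕ} (hr : r ≠ 0) (j : Fin m) (φ : ℕ → ℝ) :
    ∑ k : Fin (m + r), foldMatrix m r j k * φ k =
      Real.sin (foldAngle r j) * φ j +
        (-1) ^ (m + 1) * Real.cos (foldAngle r j) * φ (j + m) := by
  have hj := j.2
  simp only [foldMatrix, of_apply]
  rw [← Finset.sum_range (fun k : ℕ => ((if k = j then Real.sin (foldAngle r j) else 0) +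
    (if k = j + m then (-1) ^ (m + 1) * Real.cos (foldAngle r j) else 0)) * φ k)]
  simp only [add_mul, ite_mul, zero_mul, Finset.sum_add_distrib, Finset.sum_ite_eq',
    Finset.mem_range]
  rw [if_pos (by omega)]
  congr 1
  split_ifs with h
  · rfl
  · rw [foldAngle_of_le hr (by omega), Real.cos_pi_div_two]
    ring

/-- Covariances of the folded sequence. -/
def foldCov (m r : ℕ) (f : ℝ → ℝ) (j k : ℕ) : ℝ :=
  Real.cos (foldAngle r k - foldAngle r j) * autocov f ((k : ℤ) - j) +
    (-1) ^ (m + 1) * (Real.cos (foldAngle r j) * Real.sin (foldAngle r k)) *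
      autocov f ((k : ℤ) - j - m) +
    (-1) ^ (m + 1) * (Real.sin (foldAngle r j) * Real.cos (foldAngle r k)) *
      autocov f ((k : ℤ) - j + m)

theorem neg_one_pow_mul_self (m : ℕ) : (-1 : ℝ) ^ (m + 1) * (-1) ^ (m + 1) = 1 := by
  rw [← mul_pow]; simp

theorem foldMatrix_conj_apply {m r : ℕ} (hr : r ≠ 0) (f : ℝ → ℝ) (j k : Fin m) :
    (foldMatrix m r * toeplitz (m + r) f * (foldMatrix m r)ᵀ) j k = foldCov m r f j k := by
  rw [mul_apply]
  have h1 : ∀ q : Fin (m + r), (foldMatrix m r * toeplitz (m + r) f) j q =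
      Real.sin (foldAngle r j) * autocov f ((q : ℤ) - (j : ℕ)) +
        (-1) ^ (m + 1) * Real.cos (foldAngle r j) * autocov f ((q : ℤ) - ((j + m : ℕ) : ℤ)) := by
    intro q
    rw [mul_apply]
    exact sum_foldMatrix_mul hr j fun p => autocov f ((q : ℤ) - p)
  simp only [h1, transpose_apply]
  rw [Finset.sum_congr rfl fun q _ => mul_comm _ (foldMatrix m r k q),
    sum_foldMatrix_mul hr k fun q => Real.sin (foldAngle r j) * autocov f ((q : ℤ) - (j : ℕ)) +
        (-1) ^ (m + 1) * Real.cos (foldAngle r j) * autocov f ((q : ℤ) - ((j + m : ℕ) : ℤ))]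
  have e1 : ((k : ℕ) : ℤ) - (((j : ℕ) + m : ℕ) : ℤ) = (k : ℤ) - j - m := by push_cast; ring
  have e2 : (((k : ℕ) + m : ℕ) : ℤ) - ((j : ℕ) : ℤ) = (k : ℤ) - j + m := by push_cast; ring
  have e3 : (((k : ℕ) + m : ℕ) : ℤ) - (((j : ℕ) + m : ℕ) : ℤ) = (k : ℤ) - j := by push_cast; ring
  rw [e1, e2, e3, foldCov, Real.cos_sub]
  linear_combination (Real.cos (foldAngle r k) * Real.cos (foldAngle r j) *
    autocov f ((k : ℤ) - j)) * neg_one_pow_mul_self m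

theorem foldCov_symm {α M : ℝ} {f : ℝ → ℝ} (hf : f ∈ sobolevBall α M) (m r j k : ℕ) :
    foldCov m r f j k = foldCov m r f k j := by
  unfold foldCov
  rw [← autocov_neg hf ((k : ℤ) - j), ← autocov_neg hf ((k : ℤ) - j - m),
    ← autocov_neg hf ((k : ℤ) - j + m), ← Real.cos_neg (foldAngle r k - foldAngle r j), neg_sub,
    neg_sub, show -((k : ℤ) - j - m) = j - k + m by ring,
    show -((k : ℤ) - j + m) = j - k - m by ring]
  ring

theorem sum_sq_foldCov_sub_near_le {α M : ℝ} (hα : 1 / 2 < α) (h1 : α ≤ 1) {f : ℝ → ℝ}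
    (hf : f ∈ sobolevBall α M) {m r d : ℕ} (hr : r ≠ 0) (hrm : 2 * r ≤ m) (hd : 2 * d ≤ m) :
    ∑ j ∈ Finset.range (m - d), (foldCov m r f j (j + d) - circCov m f d) ^ 2 ≤
      4 * (m * (circCov m f d - autocov f d) ^ 2 +
        foldConst α * (r : ℝ) ^ (1 - 2 * α) * ((d : ℝ) ^ (2 * α) * autocov f d ^ 2) +
        ((m - d : ℕ) : ℝ) * autocov f (m - d : ℕ) ^ 2 +
        ((m + d : ℕ) : ℝ) * autocov f (m + d : ℕ) ^ 2) := by
  have hpt : ∀ j ∈ Finset.range (m - d), (foldCov m r f j (j + d) - circCov m f d) ^ 2 ≤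
      4 * ((circCov m f d - autocov f d) ^ 2 +
        (1 - Real.cos (foldAngle r (j + d) - foldAngle r j)) ^ 2 * autocov f d ^ 2 +
        (if j < r then autocov f (m - d : ℕ) ^ 2 else 0) +
        (if j < r then autocov f (m + d : ℕ) ^ 2 else 0)) := by
    intro j _
    have e0 : ((j + d : ℕ) : ℤ) - j = d := by push_cast; ring
    have e1 : autocov f ((d : ℤ) - m) = autocov f (m - d : ℕ) := by
      rw [← autocov_neg hf]; congr 1; push_cast [(by omega : d ≤ m)]; ring
    have e2 : autocov f ((d : ℤ) + m) = autocov f (m + d : ℕ) := by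
      congr 1; push_cast; ring
    rw [foldCov, e0, e1, e2]
    have hs := neg_one_pow_mul_self m
    set s : ℝ := (-1) ^ (m + 1)
    set x := Real.cos (foldAngle r (j + d) - foldAngle r j)
    set c := circCov m f d
    set γ := autocov f d
    set p := autocov f (m - d : ℕ)
    set q := autocov f (m + d : ℕ)
    set u := s * (Real.cos (foldAngle r j) * Real.sin (foldAngle r (j + d))) * p with hu
    set v := s * (Real.sin (foldAngle r j) * Real.cos (foldAngle r (j + d))) * q with hv
    have hu2 : u ^ 2 ≤ if j < r then p ^ 2 else 0 := by
      split_ifs with hj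
      · have h2 := Real.cos_sq_le_one (foldAngle r j)
        have h3 := Real.sin_sq_le_one (foldAngle r (j + d))
        have h4 : (Real.cos (foldAngle r j) * Real.sin (foldAngle r (j + d))) ^ 2 ≤ 1 := by
          rw [mul_pow]; exact mul_le_one₀ h2 (sq_nonneg _) h3
        have h5 : u ^ 2 = (s * s) * (Real.cos (foldAngle r j) *
          Real.sin (foldAngle r (j + d))) ^ 2 * p ^ 2 := by rw [hu]; ring
        rw [h5, hs, one_mul]
        exact mul_le_of_le_one_left (sq_nonneg _) h4
      · rw [hu, foldAngle_of_le hr (by omega), Real.cos_pi_div_two]; simp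
    have hv2 : v ^ 2 ≤ if j < r then q ^ 2 else 0 := by
      split_ifs with hj
      · have h2 := Real.sin_sq_le_one (foldAngle r j)
        have h3 := Real.cos_sq_le_one (foldAngle r (j + d))
        have h4 : (Real.sin (foldAngle r j) * Real.cos (foldAngle r (j + d))) ^ 2 ≤ 1 := by
          rw [mul_pow]; exact mul_le_one₀ h2 (sq_nonneg _) h3
        have h5 : v ^ 2 = (s * s) * (Real.sin (foldAngle r j) *
          Real.cos (foldAngle r (j + d))) ^ 2 * q ^ 2 := by rw [hv]; ring
        rw [h5, hs, one_mul]
        exact mul_le_of_le_one_left (sq_nonneg _) h4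
      · rw [hv, foldAngle_of_le hr (by omega : r ≤ j + d), Real.cos_pi_div_two]; simp
    have h6 : (x * γ + u + v - c) ^ 2 ≤
        4 * ((c - γ) ^ 2 + (1 - x) ^ 2 * γ ^ 2 + u ^ 2 + v ^ 2) := by
      have : x * γ + u + v - c = -(c - γ) - (1 - x) * γ + u + v := by ring
      rw [this]
      nlinarith [sq_nonneg ((c - γ) - (1 - x) * γ), sq_nonneg ((c - γ) + u),
        sq_nonneg ((c - γ) + v), sq_nonneg ((1 - x) * γ + u), sq_nonneg ((1 - x) * γ + v),
        sq_nonneg (u - v)]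
    linarith
  refine (Finset.sum_le_sum hpt).trans ?_
  rw [← Finset.mul_sum, Finset.sum_add_distrib, Finset.sum_add_distrib, Finset.sum_add_distrib,
    ← Finset.sum_mul, Finset.sum_const, Finset.card_range, nsmul_eq_mul]
  have b1 := sum_one_sub_cos_foldAngle_sub_le (by linarith) h1 hr (m - d) d
  have b2 := sum_ite_lt_le (m - d) r (sq_nonneg (autocov f (m - d : ℕ)))
  have b3 := sum_ite_lt_le (m - d) r (sq_nonneg (autocov f (m + d : ℕ)))
  have b4 : (r : ℝ) ≤ (m - d : ℕ) := by exact_mod_cast (by omega : r ≤ m - d)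
  have b5 : (r : ℝ) ≤ (m + d : ℕ) := by exact_mod_cast (by omega : r ≤ m + d)
  have b6 : ((m - d : ℕ) : ℝ) ≤ m := by exact_mod_cast Nat.sub_le m d
  rw [← mul_assoc (foldConst α * (r : ℝ) ^ (1 - 2 * α))]
  gcongr ?_ * (?_ * ?_ + ?_ * ?_ + ?_ + ?_)
  · exact b2.trans (by gcongr)
  · exact b3.trans (by gcongr)

theorem sum_sq_foldCov_sub_far_le {α M : ℝ} (hα : 1 / 2 < α) (h1 : α ≤ 1) {f : ℝ → ℝ}
    (hf : f ∈ sobolevBall α M) {m r d : ℕ} (hr : r ≠ 0) (hrm : 2 * r ≤ m) (hd : m < 2 * d)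
    (hdm : d < m) :
    ∑ j ∈ Finset.range (m - d), (foldCov m r f j (j + d) - circCov m f d) ^ 2 ≤
      3 * ((d : ℝ) * autocov f d ^ 2 +
        foldConst α * (r : ℝ) ^ (1 - 2 * α) *
          (((m - d : ℕ) : ℝ) ^ (2 * α) * autocov f (m - d : ℕ) ^ 2) +
        m * (circCov m f (m - d : ℕ) - autocov f (m - d : ℕ)) ^ 2) := by
  have hpt : ∀ j ∈ Finset.range (m - d), (foldCov m r f j (j + d) - circCov m f d) ^ 2 ≤
      3 * (autocov f d ^ 2 +
        (1 - Real.cos (foldAngle r j)) ^ 2 * autocov f (m - d : ℕ) ^ 2 +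
        (circCov m f (m - d : ℕ) - autocov f (m - d : ℕ)) ^ 2) := by
    intro j _
    have e0 : ((j + d : ℕ) : ℤ) - j = d := by push_cast; ring
    have e1 : autocov f ((d : ℤ) - m) = autocov f (m - d : ℕ) := by
      rw [← autocov_neg hf]; congr 1; push_cast [hdm.le]; ring
    have hs := neg_one_pow_mul_self m
    have ec : circCov m f d = (-1) ^ (m + 1) * circCov m f (m - d : ℕ) := by
      rw [circCov_sq_reflect hdm.le, ← mul_assoc, hs, one_mul]
    rw [foldCov, e0, e1, ec, foldAngle_of_le hr (by omega : r ≤ j + d), Real.cos_pi_div_two,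
      Real.sin_pi_div_two, Real.cos_pi_div_two_sub]
    set s : ℝ := (-1) ^ (m + 1)
    set c := circCov m f (m - d : ℕ)
    set γ := autocov f d
    set p := autocov f (m - d : ℕ)
    set x := Real.cos (foldAngle r j)
    set y := Real.sin (foldAngle r j)
    have hy : (y * γ) ^ 2 ≤ γ ^ 2 := by
      rw [mul_pow]
      exact mul_le_of_le_one_left (sq_nonneg _) (Real.sin_sq_le_one _)
    have h6 : (y * γ + s * (x * 1) * p + s * (y * 0) * autocov f ((d : ℤ) + m) - s * c) ^ 2 ≤
        3 * ((y * γ) ^ 2 + (s * s) * ((1 - x) ^ 2 * p ^ 2) + (s * s) * (c - p) ^ 2) := by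
      have : y * γ + s * (x * 1) * p + s * (y * 0) * autocov f ((d : ℤ) + m) - s * c =
        y * γ - s * ((1 - x) * p) - s * (c - p) := by ring
      rw [this]
      nlinarith [sq_nonneg (y * γ + s * ((1 - x) * p)), sq_nonneg (y * γ + s * (c - p)),
        sq_nonneg (s * ((1 - x) * p) - s * (c - p))]
    rw [hs, one_mul, one_mul] at h6
    linarith
  refine (Finset.sum_le_sum hpt).trans ?_
  rw [← Finset.mul_sum, Finset.sum_add_distrib, Finset.sum_add_distrib,
    ← Finset.sum_mul, Finset.sum_const, Finset.sum_const, Finset.card_range, nsmul_eq_mul,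
    nsmul_eq_mul]
  have b1 := sum_one_sub_cos_foldAngle_le hα h1 hr (m - d)
  have b4 : ((m - d : ℕ) : ℝ) ≤ d := by exact_mod_cast (by omega : m - d ≤ d)
  have b6 : ((m - d : ℕ) : ℝ) ≤ m := by exact_mod_cast Nat.sub_le m d
  rw [← mul_assoc (foldConst α * (r : ℝ) ^ (1 - 2 * α))]
  gcongr

theorem sum_sq_fold_sub_circMatrix_le {α M : ℝ} (hα : 1 / 2 < α) (h1 : α ≤ 1) {f : ℝ → ℝ}
    (hf : f ∈ sobolevBall α M) {m r : ℕ} (hr : r ≠ 0) (hrm : 2 * r ≤ m) :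
    ∑ i, ∑ j, ((foldMatrix m r * toeplitz (m + r) f * (foldMatrix m r)ᵀ) i j -
        circMatrix m m f i j) ^ 2 ≤
      14 * (circConst α M * (m : ℝ) ^ (1 - 2 * α)) +
      14 * (foldConst α * (r : ℝ) ^ (1 - 2 * α) * M) +
      22 * (M * ((m / 2 : ℕ) : ℝ) ^ (1 - 2 * α)) := by
  have h := sum_sq_circCov_sub_autocov_le (by linarith) h1 hf (m := m) (by omega)
  have hW := sum_natCast_mul_sq_autocov_le hα hf (r := m / 2) (by omega)
  have hS := sum_rpow_mul_sq_autocov_le hf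
  have hK := foldConst_pos α
  have hψ : ∑ i, ∑ j, ((foldMatrix m r * toeplitz (m + r) f * (foldMatrix m r)ᵀ) i j -
        circMatrix m m f i j) ^ 2 =
      ∑ j ∈ Finset.range m, ∑ k ∈ Finset.range m,
        (foldCov m r f j k - circCov m f ((k : ℤ) - j)) ^ 2 := by
    rw [Finset.sum_range]
    refine Finset.sum_congr rfl fun j _ => ?_
    rw [Finset.sum_range]
    refine Finset.sum_congr rfl fun k _ => ?_
    rw [foldMatrix_conj_apply hr]
    rfl
  have hsym := sum_range_symm_le m
    (ψ := fun j k => (foldCov m r f j k - circCov m f ((k : ℤ) - j)) ^ 2)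
    (fun _ _ => sq_nonneg _) (fun j k => by
      rw [foldCov_symm hf, ← circCov_neg, neg_sub])
  have e0 : ∀ j d : ℕ, ((j + d : ℕ) : ℤ) - j = d := fun j d => by push_cast; ring
  simp only [e0] at hsym
  rw [hψ]
  refine hsym.trans ?_
  set ε := circConst α M * (m : ℝ) ^ (1 - 2 * α)
  set W := M * ((m / 2 : ℕ) : ℝ) ^ (1 - 2 * α)
  set c : ℕ → ℝ := fun d => circCov m f d with hc
  set γ : ℕ → ℝ := fun d => autocov f d with hγ
  set κ := foldConst α * (r : ℝ) ^ (1 - 2 * α) with hκ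
  have hκ0 : 0 ≤ κ := by positivity
  have hunion : Finset.range m = Finset.range (m / 2 + 1) ∪ Finset.Ico (m / 2 + 1) m := by
    ext d
    simp only [Finset.mem_union, Finset.mem_range, Finset.mem_Ico]
    omega
  have hdisj : Disjoint (Finset.range (m / 2 + 1)) (Finset.Ico (m / 2 + 1) m) := by
    rw [Finset.disjoint_left]; intro d hd
    simp only [Finset.mem_range, Finset.mem_Ico] at hd ⊢
    omega
  rw [hunion, Finset.sum_union hdisj]
  have hnear : ∑ d ∈ Finset.range (m / 2 + 1), ∑ j ∈ Finset.range (m - d),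
      (foldCov m r f j (j + d) - circCov m f d) ^ 2 ≤ 4 * (ε + κ * M + W + W) := by
    calc _ ≤ ∑ d ∈ Finset.range (m / 2 + 1), 4 * (m * (c d - γ d) ^ 2 +
          κ * ((d : ℝ) ^ (2 * α) * γ d ^ 2) + ((m - d : ℕ) : ℝ) * γ (m - d) ^ 2 +
          ((m + d : ℕ) : ℝ) * γ (m + d) ^ 2) :=
          Finset.sum_le_sum fun d hd => sum_sq_foldCov_sub_near_le hα h1 hf hr hrm
            (by have := Finset.mem_range.1 hd; omega)
      _ = 4 * (m * ∑ d ∈ Finset.range (m / 2 + 1), (c d - γ d) ^ 2 +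
          κ * ∑ d ∈ Finset.range (m / 2 + 1), (d : ℝ) ^ (2 * α) * γ d ^ 2 +
          ∑ d ∈ Finset.range (m / 2 + 1), ((m - d : ℕ) : ℝ) * γ (m - d) ^ 2 +
          ∑ d ∈ Finset.range (m / 2 + 1), ((m + d : ℕ) : ℝ) * γ (m + d) ^ 2) := by
          rw [← Finset.mul_sum, Finset.sum_add_distrib, Finset.sum_add_distrib,
            Finset.sum_add_distrib, Finset.mul_sum, Finset.mul_sum]
      _ ≤ _ := by
          have a1 : ∑ d ∈ Finset.range (m / 2 + 1), ((m - d : ℕ) : ℝ) * γ (m - d) ^ 2 ≤ W := by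
            refine le_trans ?_ (hW (m + 1))
            exact sum_reflect_le (φ := fun e => (e : ℝ) * γ e ^ 2) (fun d hd => by
              rw [Finset.mem_range] at hd; rw [Finset.mem_Ico]; omega) fun _ => by positivity
          have a2 : ∑ d ∈ Finset.range (m / 2 + 1), ((m + d : ℕ) : ℝ) * γ (m + d) ^ 2 ≤ W := by
            have e := Finset.sum_Ico_eq_sum_range (fun e => (e : ℝ) * γ e ^ 2) m
              (m + (m / 2 + 1))
            rw [Nat.add_sub_cancel_left] at e
            rw [← e]
            refine le_trans ?_ (hW (m + (m / 2 + 1)))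
            exact Finset.sum_le_sum_of_subset_of_nonneg
              (Finset.Ico_subset_Ico_left (Nat.div_le_self _ _)) fun _ _ _ => by positivity
          gcongr
          exact hS _
  have hfar : ∑ d ∈ Finset.Ico (m / 2 + 1) m, ∑ j ∈ Finset.range (m - d),
      (foldCov m r f j (j + d) - circCov m f d) ^ 2 ≤ 3 * (W + κ * M + ε) := by
    calc _ ≤ ∑ d ∈ Finset.Ico (m / 2 + 1) m, 3 * ((d : ℝ) * γ d ^ 2 +
          κ * (((m - d : ℕ) : ℝ) ^ (2 * α) * γ (m - d) ^ 2) +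
          m * (c (m - d) - γ (m - d)) ^ 2) :=
          Finset.sum_le_sum fun d hd => sum_sq_foldCov_sub_far_le hα h1 hf hr hrm
            (by have := Finset.mem_Ico.1 hd; omega) (Finset.mem_Ico.1 hd).2
      _ = 3 * (∑ d ∈ Finset.Ico (m / 2 + 1) m, (d : ℝ) * γ d ^ 2 +
          κ * ∑ d ∈ Finset.Ico (m / 2 + 1) m, ((m - d : ℕ) : ℝ) ^ (2 * α) * γ (m - d) ^ 2 +
          m * ∑ d ∈ Finset.Ico (m / 2 + 1) m, (c (m - d) - γ (m - d)) ^ 2) := by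
          rw [← Finset.mul_sum, Finset.sum_add_distrib, Finset.sum_add_distrib,
            Finset.mul_sum, Finset.mul_sum]
      _ ≤ _ := by
          have a1 : ∑ d ∈ Finset.Ico (m / 2 + 1) m, (d : ℝ) * γ d ^ 2 ≤ W :=
            (Finset.sum_le_sum_of_subset_of_nonneg
              (Finset.Ico_subset_Ico_left (Nat.le_succ _)) fun _ _ _ => by positivity).trans (hW m)
          have a2 : ∑ d ∈ Finset.Ico (m / 2 + 1) m,
              ((m - d : ℕ) : ℝ) ^ (2 * α) * γ (m - d) ^ 2 ≤ M := by
            refine le_trans ?_ (hS (Finset.range (m / 2 + 1)))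
            exact sum_reflect_le (φ := fun e => (e : ℝ) ^ (2 * α) * γ e ^ 2) (fun d hd => by
              rw [Finset.mem_Ico] at hd; rw [Finset.mem_range]; omega) fun _ => by positivity
          have a3 : ∑ d ∈ Finset.Ico (m / 2 + 1) m, (c (m - d) - γ (m - d)) ^ 2 ≤
              ∑ e ∈ Finset.range (m / 2 + 1), (c e - γ e) ^ 2 :=
            sum_reflect_le (φ := fun e => (c e - γ e) ^ 2) (fun d hd => by
              rw [Finset.mem_Ico] at hd; rw [Finset.mem_range]; omega) fun _ => by positivity
          have a4 : m * ∑ d ∈ Finset.Ico (m / 2 + 1) m, (c (m - d) - γ (m - d)) ^ 2 ≤ ε :=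
            (mul_le_mul_of_nonneg_left a3 (by positivity)).trans h
          gcongr
  linarith

end Folding

/-! ### Deficiencies between the two experiments with different sample sizes -/

section Comparison

open Matrix

instance isProbabilityMeasure_scaleLaw (n : ℕ) (f : ℝ → ℝ) :
    IsProbabilityMeasure (scaleLaw n f) := by
  unfold scaleLaw; infer_instance

instance isProbabilityMeasure_timeSeriesLaw (n : ℕ) (f : ℝ → ℝ) :
    IsProbabilityMeasure (timeSeriesLaw n f) := by
  unfold timeSeriesLaw; infer_instance

theorem mulVecLp_mulVecLp {ι κ ν : Type*} [Fintype ι] [Fintype κ] (A : Matrix ν κ ℝ)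
    (B : Matrix κ ι ℝ) (x : EuclideanSpace ℝ ι) :
    mulVecLp A (mulVecLp B x) = mulVecLp (A * B) x := by
  simp [mulVecLp, mulVec_mulVec]

theorem mulVecLp_one {ι : Type*} [Fintype ι] [DecidableEq ι] (x : EuclideanSpace ℝ ι) :
    mulVecLp (1 : Matrix ι ι ℝ) x = x := by
  simp [mulVecLp]

/-- Squared Frobenius error when a periodic sequence is cut to a shorter one. -/
def cutError (α M : ℝ) (n r : ℕ) : ℝ :=
  10 * (circConst α M * ((n + r : ℕ) : ℝ) ^ (1 - 2 * α)) +
    8 * (M * (r : ℝ) ^ (1 - 2 * α)) + 4 * (M * (((n + r) / 2 : ℕ) : ℝ) ^ (1 - 2 * α))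

/-- Squared Frobenius error when a stationary sequence is folded into a periodic one. -/
def foldError (α M : ℝ) (m r : ℕ) : ℝ :=
  14 * (circConst α M * (m : ℝ) ^ (1 - 2 * α)) +
    14 * (foldConst α * (r : ℝ) ^ (1 - 2 * α) * M) +
    22 * (M * ((m / 2 : ℕ) : ℝ) ^ (1 - 2 * α))

theorem deficiency_scaleLaw_timeSeriesLaw_le {α M : ℝ} (hα : 1 / 2 < α) (h1 : α ≤ 1) (hM : 0 < M)
    {S : Set (ℝ → ℝ)} (hS : S ⊆ spectralClass α M) {n r : ℕ} (hr : r ≠ 0) (hn : n ≠ 0) :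
    deficiency (fun f : S => scaleLaw (n + r) f) (fun f : S => timeSeriesLaw n f) ≤
      ENNReal.ofReal ((2 * Real.pi * M⁻¹)⁻¹ * √(2 * cutError α M n r)) := by
  have hpi := Real.pi_pos
  refine deficiency_le_of_map (g := fun x => mulVecLp (hartley n (n + r)) (WithLp.toLp 2 x))
    ((measurable_mulVecLp _).comp (by fun_prop)) fun f => ?_
  have hf := hS f.2
  rw [scaleLaw_map_hartley hM hf, tvDist_comm]
  refine (tvDist_multivariateGaussian_le (by positivity)
    (circMatrix_sub_posSemidef (Nat.le_add_right n r) hf) (transpose_toeplitz hf.1 n)).trans ?_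
  refine ENNReal.ofReal_le_ofReal ?_
  gcongr
  exact sum_sq_toeplitz_sub_circMatrix_le hα h1 hf.1 hr hn

theorem scaleLaw_eq_map {α M : ℝ} (hM : 0 < M) {f : ℝ → ℝ} (hf : f ∈ spectralClass α M)
    (m : ℕ) :
    scaleLaw m f = (multivariateGaussian 0 (circMatrix m m f)).map
      (fun x => WithLp.ofLp (mulVecLp ((2 * Real.pi)⁻¹ • (hartley m m)ᵀ) x)) := by
  have hpi := Real.pi_pos
  rw [← scaleLaw_map_hartley hM hf m m, Measure.map_map]
  · have : ((fun x => WithLp.ofLp (mulVecLp ((2 * Real.pi)⁻¹ • (hartley m m)ᵀ) x)) ∘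
        fun x => mulVecLp (hartley m m) (WithLp.toLp 2 x)) = id := by
      ext1 x
      simp only [Function.comp_apply, mulVecLp_mulVecLp, Matrix.smul_mul, transpose_hartley_mul,
        smul_smul]
      rw [inv_mul_cancel₀ (by positivity), one_smul, mulVecLp_one]
      rfl
    rw [this, Measure.map_id]
  · exact (WithLp.measurable_ofLp 2 _).comp (measurable_mulVecLp _)
  · exact (measurable_mulVecLp _).comp (WithLp.measurable_toLp 2 _)

theorem deficiency_timeSeriesLaw_scaleLaw_le {α M : ℝ} (hα : 1 / 2 < α) (h1 : α ≤ 1) (hM : 0 < M)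
    {S : Set (ℝ → ℝ)} (hS : S ⊆ spectralClass α M) {m r : ℕ} (hr : r ≠ 0) (hrm : 2 * r ≤ m) :
    deficiency (fun f : S => timeSeriesLaw (m + r) f) (fun f : S => scaleLaw m f) ≤
      ENNReal.ofReal ((2 * Real.pi * M⁻¹)⁻¹ * √(2 * foldError α M m r)) := by
  have hpi := Real.pi_pos
  set T : EuclideanSpace ℝ (Fin m) → (Fin m → ℝ) :=
    fun x => WithLp.ofLp (mulVecLp ((2 * Real.pi)⁻¹ • (hartley m m)ᵀ) x) with hT
  have hTm : Measurable T := (WithLp.measurable_ofLp 2 _).comp (measurable_mulVecLp _)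
  refine deficiency_le_of_map (g := T ∘ mulVecLp (foldMatrix m r))
    (hTm.comp (measurable_mulVecLp _)) fun f => ?_
  have hf := hS f.2
  rw [← Measure.map_map hTm (measurable_mulVecLp _), scaleLaw_eq_map hM hf, timeSeriesLaw,
    map_multivariateGaussian (toeplitz_posSemidef hM hf _)]
  refine (tvDist_map_le _ _ hTm).trans ?_
  refine (tvDist_multivariateGaussian_le (by positivity)
    (circMatrix_sub_posSemidef le_rfl hf) ?_).trans (ENNReal.ofReal_le_ofReal ?_)
  · rw [transpose_mul, transpose_mul, transpose_transpose, transpose_toeplitz hf.1,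
      Matrix.mul_assoc]
  · gcongr
    exact sum_sq_fold_sub_circMatrix_le hα h1 hf.1 hr hrm

end Comparison

/-! ### Adding one observation to the scale experiment -/

section Extension

theorem tvDist_gaussianReal_le {a : ℝ} (ha : 0 < a) (b : ℝ) :
    tvDist (gaussianReal 0 a.toNNReal) (gaussianReal 0 b.toNNReal) ≤
      ENNReal.ofReal √(2 * (b / a - 1) ^ 2) := by
  have h := tvDist_pi_gaussianReal_le (ι := Unit) (a := fun _ => a) (fun _ => ha) fun _ => b
  simp only [Finset.univ_unique, Finset.sum_const, Finset.card_singleton, one_smul] at h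
  have e : ∀ c : ℝ, gaussianReal 0 c.toNNReal =
      (Measure.pi fun _ : Unit => gaussianReal 0 c.toNNReal).map (Function.eval ()) :=
    fun c => (measurePreserving_eval (fun _ : Unit => gaussianReal 0 c.toNNReal) ()).map_eq.symm
  rw [e a, e b]
  exact (tvDist_map_le _ _ (measurable_pi_apply _)).trans h

/-- Replacing the variance of an independent Gaussian variable by an estimate. -/
theorem tvDist_prod_gaussianReal_le {X : Type*} [MeasurableSpace X] (P : Measure X)
    [IsProbabilityMeasure P] {ρ : X → ℝ} (hρ : Measurable ρ) {s : ℝ} (hs : 0 < s)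
    (hint : Integrable (fun x => |ρ x ^ 2 / s - 1|) P) :
    tvDist (P.prod (gaussianReal 0 s.toNNReal))
      ((P.prod (gaussianReal 0 1)).map fun p => (p.1, ρ p.1 * p.2)) ≤
      ENNReal.ofReal (√2 * ∫ x, |ρ x ^ 2 / s - 1| ∂P) := by
  have hg : Measurable fun p : X × ℝ => (p.1, ρ p.1 * p.2) := by fun_prop
  refine tvDist_le fun A hA => ?_
  have key : ∀ (ν : Measure ℝ), IsProbabilityMeasure ν → ∀ B : Set (X × ℝ), MeasurableSet B →
      (P.prod ν).real B = ∫ x, ν.real (Prod.mk x ⁻¹' B) ∂P := by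
    intro ν _ B hB
    rw [measureReal_def, Measure.prod_apply hB,
      integral_eq_lintegral_of_nonneg_ae (Eventually.of_forall fun _ => measureReal_nonneg)
        ((measurable_measure_prodMk_left hB).ennreal_toReal.aestronglyMeasurable)]
    congr 1
    refine lintegral_congr fun x => ?_
    rw [measureReal_def, ENNReal.ofReal_toReal (measure_ne_top _ _)]
  have hbd : ∀ (ν : Measure ℝ), IsProbabilityMeasure ν → ∀ B : Set (X × ℝ), MeasurableSet B →
      Integrable (fun x => ν.real (Prod.mk x ⁻¹' B)) P := by
    intro ν _ B hB
    refine Integrable.of_bound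
      ((measurable_measure_prodMk_left hB).ennreal_toReal.aestronglyMeasurable) 1
      (ae_of_all _ fun x => ?_)
    rw [Real.norm_of_nonneg measureReal_nonneg]
    exact measureReal_le_one
  rw [map_measureReal_apply hg hA, key _ inferInstance _ hA, key _ inferInstance _ (hg hA),
    ← integral_sub (hbd _ inferInstance _ hA) (hbd _ inferInstance _ (hg hA)),
    ← integral_const_mul]
  refine abs_integral_le_integral_abs.trans
    (integral_mono ((hbd _ inferInstance _ hA).sub (hbd _ inferInstance _ (hg hA))).abs
      (hint.const_mul _) fun x => ?_)
  have hAx : MeasurableSet (Prod.mk x ⁻¹' A) := measurable_prodMk_left hA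
  have e : (gaussianReal 0 1).real (Prod.mk x ⁻¹' ((fun p : X × ℝ => (p.1, ρ p.1 * p.2)) ⁻¹' A)) =
      (gaussianReal 0 (ρ x ^ 2).toNNReal).real (Prod.mk x ⁻¹' A) := by
    have h1 : gaussianReal 0 (ρ x ^ 2).toNNReal = (gaussianReal 0 1).map (ρ x * ·) := by
      rw [gaussianReal_map_const_mul, mul_zero, mul_one]
      congr 1
      ext
      simp [Real.coe_toNNReal _ (sq_nonneg (ρ x))]
    rw [h1, map_measureReal_apply (by fun_prop) hAx]
    rfl
  simp only [e]
  have h2 := (ofReal_abs_sub_le_tvDist _ _ hAx).trans (tvDist_gaussianReal_le hs (ρ x ^ 2))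
  rw [ENNReal.ofReal_le_ofReal_iff (Real.sqrt_nonneg _), Real.sqrt_mul zero_le_two,
    Real.sqrt_sq_eq_abs] at h2
  exact h2

/-- The variance of the square of a standard Gaussian variable. -/
def sqVariance : ℝ := Var[fun x => x ^ 2; gaussianReal 0 1]

theorem memLp_sq_gaussianReal (v : NNReal) : MemLp (fun x : ℝ => x ^ 2) 2 (gaussianReal 0 v) := by
  have h := memLp_id_gaussianReal' (μ := 0) (v := v) 4 (by norm_num)
  refine (memLp_two_iff_integrable_sq (by fun_prop)).2 ?_
  have h2 := h.integrable_norm_pow (p := 4) (by norm_num)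
  refine h2.congr (ae_of_all _ fun x => ?_)
  simp only [id_eq, Real.norm_eq_abs]
  rw [← pow_mul, (by decide : Even 4).pow_abs]

theorem integral_sq_gaussianReal (v : NNReal) : ∫ x, x ^ 2 ∂(gaussianReal 0 v) = v := by
  have h := variance_id_gaussianReal (μ := 0) (v := v)
  rw [variance_of_integral_eq_zero (by fun_prop) (by simp)] at h
  simpa using h

theorem variance_sq_gaussianReal {s : ℝ} (hs : 0 < s) :
    Var[fun x => x ^ 2; gaussianReal 0 s.toNNReal] = s ^ 2 * sqVariance := by
  have h1 : gaussianReal 0 s.toNNReal = (gaussianReal 0 1).map (√s * ·) := by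
    rw [gaussianReal_map_const_mul, mul_zero, mul_one]
    congr 1
    ext
    simp [Real.coe_toNNReal _ hs.le, Real.sq_sqrt hs.le]
  rw [h1, variance_map (by fun_prop) (by fun_prop), sqVariance, ← variance_const_mul]
  congr 1
  ext x
  simp only [Function.comp_apply, mul_pow, Real.sq_sqrt hs.le]

theorem integral_abs_mean_sq_sub_one_le {ι : Type*} [Fintype ι] {v : ι → ℝ} {T : Finset ι}
    {s : ℝ} (hs : 0 < s) (hT : ∀ j ∈ T, v j = s) (hne : T.Nonempty) :
    Integrable (fun z : ι → ℝ => |(T.card : ℝ)⁻¹ * (∑ j ∈ T, z j ^ 2) / s - 1|)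
      (Measure.pi fun j => gaussianReal 0 (v j).toNNReal) ∧
    ∫ z, |(T.card : ℝ)⁻¹ * (∑ j ∈ T, z j ^ 2) / s - 1|
      ∂(Measure.pi fun j => gaussianReal 0 (v j).toNNReal) ≤ √(sqVariance / T.card) := by
  classical
  have hc : (0 : ℝ) < T.card := by exact_mod_cast hne.card_pos
  set P := Measure.pi fun j => gaussianReal 0 (v j).toNNReal with hP
  set X : ι → ℝ → ℝ := fun j x => if j ∈ T then ((T.card : ℝ) * s)⁻¹ * x ^ 2 else 0 with hX
  have hXL : ∀ j, MemLp (X j) 2 (gaussianReal 0 (v j).toNNReal) := by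
    intro j
    by_cases hj : j ∈ T
    · simp only [hX, if_pos hj]
      exact (memLp_sq_gaussianReal _).const_mul _
    · simp only [hX, if_neg hj]
      exact memLp_const 0
  have hXL' : ∀ j, MemLp (fun z : ι → ℝ => X j (z j)) 2 P := fun j =>
    (hXL j).comp_measurePreserving (measurePreserving_eval _ j)
  have eS : ∀ z : ι → ℝ, (T.card : ℝ)⁻¹ * (∑ j ∈ T, z j ^ 2) / s = ∑ j, X j (z j) := by
    intro z
    simp only [hX]
    rw [Finset.sum_ite_mem, Finset.univ_inter, ← Finset.mul_sum, mul_inv]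
    ring
  have hSL : MemLp (fun z : ι → ℝ => ∑ j, X j (z j)) 2 P := memLp_finsetSum _ fun j _ => hXL' j
  have hmean : ∫ z, ∑ j, X j (z j) ∂P = 1 := by
    rw [integral_finsetSum _ fun j _ => (hXL' j).integrable (by norm_num)]
    have h1 : ∀ j, ∫ z : ι → ℝ, X j (z j) ∂P = if j ∈ T then (T.card : ℝ)⁻¹ else 0 := by
      intro j
      rw [hP, integral_comp_eval (hXL j).aestronglyMeasurable]
      by_cases hj : j ∈ T
      · simp only [hX, if_pos hj]
        rw [integral_const_mul, integral_sq_gaussianReal, hT j hj, Real.coe_toNNReal _ hs.le]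
        field_simp
      · simp only [hX, if_neg hj, integral_zero]
    simp only [h1]
    rw [Finset.sum_ite_mem, Finset.univ_inter, Finset.sum_const, nsmul_eq_mul,
      mul_inv_cancel₀ hc.ne']
  have hvar : Var[fun z : ι → ℝ => ∑ j, X j (z j); P] = sqVariance / T.card := by
    have h1 := variance_sum_pi hXL
    have e : (∑ j, fun z : ι → ℝ => X j (z j)) = fun z => ∑ j, X j (z j) := by
      ext z; simp
    rw [e] at h1
    rw [hP, h1]
    have h2 : ∀ j, Var[X j; gaussianReal 0 (v j).toNNReal] =
        if j ∈ T then sqVariance / (T.card : ℝ) ^ 2 else 0 := by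
      intro j
      by_cases hj : j ∈ T
      · simp only [hX, if_pos hj]
        rw [variance_const_mul, hT j hj, variance_sq_gaussianReal hs]
        field_simp
      · simp only [hX, if_neg hj]
        exact variance_zero _
    simp only [h2]
    rw [Finset.sum_ite_mem, Finset.univ_inter, Finset.sum_const, nsmul_eq_mul]
    field_simp
  have hD : MemLp (fun z : ι → ℝ => ∑ j, X j (z j) - 1) 2 P := hSL.sub (memLp_const 1)
  simp only [eS]
  refine ⟨(hD.integrable (by norm_num)).abs, (integral_abs_le_sqrt_integral_sq hD).trans ?_⟩
  rw [← hvar, variance_eq_integral hSL.aemeasurable, hmean]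

/-- Appending a coordinate at the end of a vector. -/
def appendLast (n : ℕ) (p : (Fin n → ℝ) × ℝ) : Fin (n + 1) → ℝ :=
  (MeasurableEquiv.piFinSuccAbove (fun _ : Fin (n + 1) => ℝ) (Fin.last n)).symm (p.2, p.1)

theorem measurable_appendLast (n : ℕ) : Measurable (appendLast n) :=
  (MeasurableEquiv.measurable _).comp measurable_swap

theorem pi_eq_map_appendLast {n : ℕ} (μ : Fin (n + 1) → Measure ℝ)
    [∀ i, IsProbabilityMeasure (μ i)] :
    Measure.pi μ = ((Measure.pi fun j : Fin n => μ j.castSucc).prod (μ (Fin.last n))).map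
      (appendLast n) := by
  have h := (measurePreserving_piFinSuccAbove μ (Fin.last n)).symm
  simp only [Fin.succAbove_last] at h
  rw [← h.map_eq]
  have e : appendLast n = (MeasurableEquiv.piFinSuccAbove (fun _ : Fin (n + 1) => ℝ)
    (Fin.last n)).symm ∘ Prod.swap := rfl
  rw [e, ← Measure.map_map (MeasurableEquiv.measurable _) measurable_swap, Measure.prod_swap]

/-- Root mean square of the last `l` coordinates. -/
def tailScale (n l : ℕ) (z : Fin n → ℝ) : ℝ :=
  √((l : ℝ)⁻¹ * ∑ j ∈ Finset.univ.filter (fun j : Fin n => n ≤ j + l), z j ^ 2)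

theorem measurable_tailScale (n l : ℕ) : Measurable (tailScale n l) := by
  unfold tailScale
  fun_prop

theorem card_tail {n l : ℕ} (h : l ≤ n) :
    (Finset.univ.filter (fun j : Fin n => n ≤ j + l)).card = l := by
  rw [← Finset.card_map Fin.valEmbedding]
  have e : (Finset.univ.filter (fun j : Fin n => n ≤ j + l)).map Fin.valEmbedding =
      Finset.Ico (n - l) n := by
    ext k
    simp only [Finset.mem_map, Finset.mem_filter, Finset.mem_univ, true_and,
      Fin.valEmbedding_apply, Finset.mem_Ico]
    constructor
    · rintro ⟨j, hj, rfl⟩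
      exact ⟨by omega, j.2⟩
    · rintro ⟨h1, h2⟩
      exact ⟨⟨k, h2⟩, by simp only; omega, rfl⟩
  rw [e, Nat.card_Ico]
  omega

end Extension

section Refinement

theorem sq_div_sub_one_le {M a : ℝ} (hM : 0 < M) (ha : M⁻¹ ≤ a) (b : ℝ) :
    (b / a - 1) ^ 2 ≤ M ^ 2 * (b - a) ^ 2 := by
  have ha0 : 0 < a := (inv_pos.2 hM).trans_le ha
  have h1 : a⁻¹ ≤ M := inv_le_of_inv_le₀ hM ha
  have e : b / a - 1 = a⁻¹ * (b - a) := by field_simp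
  rw [e, mul_pow]
  gcongr

/-- The averages on the grid of size `n + 1`, the last `l` of the first `n` of them replaced by the
very last one. -/
def flatAverages (n l : ℕ) (f : ℝ → ℝ) (j : Fin n) : ℝ :=
  if (j : ℕ) + l < n then averages (n + 1) f j.castSucc else averages (n + 1) f (Fin.last n)

/-- Bound for the squared increments of local averages at `l` steps from each other, up to the
rate. -/
def tailConst (α M : ℝ) (l : ℕ) : ℝ :=
  2 * M * ((2 * Real.pi * (l + 1)) ^ (2 * α) * (2 * Real.pi * (l + 1)))

/-- Squared relative error in the comparison of the scale experiments of sizes `n` and `n + 1`. -/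
def refineError (α M : ℝ) (l n : ℕ) : ℝ :=
  M ^ 2 * (2 * (2 * M * ((4 * Real.pi) ^ (2 * α) * (4 * Real.pi)) * (n : ℝ) ^ (1 - 2 * α)) +
    2 * (l * tailConst α M l * ((n + 1 : ℕ) : ℝ) ^ (1 - 2 * α)))

theorem tendsto_refineError {α : ℝ} (hα : 1 / 2 < α) (M : ℝ) (l : ℕ) :
    Tendsto (refineError α M l) atTop (𝓝 0) := by
  have h1 := tendsto_natCast_rpow_rate hα (2 * M * ((4 * Real.pi) ^ (2 * α) * (4 * Real.pi)))
  have h2 := (tendsto_natCast_rpow_rate hα (l * tailConst α M l)).comp (tendsto_add_atTop_nat 1)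
  have h := ((h1.const_mul 2).add (h2.const_mul 2)).const_mul (M ^ 2)
  simp only [mul_zero, add_zero] at h
  exact h

theorem sum_sq_castSucc_sub_flatAverages_le {α M : ℝ} (h0 : 0 ≤ α) (h1 : α ≤ 1) {f : ℝ → ℝ}
    (hf : f ∈ sobolevBall α M) {n l : ℕ} (hl : l ≤ n) :
    ∑ j : Fin n, (averages (n + 1) f j.castSucc - flatAverages n l f j) ^ 2 ≤
      l * tailConst α M l * ((n + 1 : ℕ) : ℝ) ^ (1 - 2 * α) := by
  have hb : ∀ j : Fin n, (averages (n + 1) f j.castSucc - flatAverages n l f j) ^ 2 ≤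
      if n ≤ j + l then tailConst α M l * ((n + 1 : ℕ) : ℝ) ^ (1 - 2 * α) else 0 := by
    intro j
    by_cases hj : (j : ℕ) + l < n
    · rw [flatAverages, if_pos hj, if_neg (by omega)]
      simp
    · rw [flatAverages, if_neg hj, if_pos (by omega)]
      exact sq_localAverage_sub_localAverage_le h0 h1 hf (n := n + 1) (i := j) (j := n) (l := l)
        (by omega) j.2.le (by omega)
  refine (Finset.sum_le_sum fun j _ => hb j).trans_eq ?_
  rw [← Finset.sum_filter, Finset.sum_const, card_tail hl, nsmul_eq_mul, mul_assoc]

theorem sum_sq_averages_sub_flatAverages_le {α M : ℝ} (h0 : 0 ≤ α) (h1 : α ≤ 1) {f : ℝ → ℝ}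
    (hf : f ∈ sobolevBall α M) {n l : ℕ} (hn : n ≠ 0) (hl : l ≤ n) :
    ∑ j : Fin n, (averages n f j - flatAverages n l f j) ^ 2 ≤
      2 * (2 * M * ((4 * Real.pi) ^ (2 * α) * (4 * Real.pi)) * (n : ℝ) ^ (1 - 2 * α)) +
        2 * (l * tailConst α M l * ((n + 1 : ℕ) : ℝ) ^ (1 - 2 * α)) := by
  have e := sum_sq_localAverage_succ_le h0 h1 hf hn
  rw [← Fin.sum_univ_eq_sum_range
    (fun j => (localAverage n (j + 1) f - localAverage (n + 1) (j + 1) f) ^ 2) n] at e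
  have e2 := sum_sq_castSucc_sub_flatAverages_le h0 h1 hf hl
  calc ∑ j : Fin n, (averages n f j - flatAverages n l f j) ^ 2
      ≤ ∑ j : Fin n, (2 * (localAverage n (j + 1) f - localAverage (n + 1) (j + 1) f) ^ 2 +
          2 * (averages (n + 1) f j.castSucc - flatAverages n l f j) ^ 2) := by
        refine Finset.sum_le_sum fun j _ => ?_
        have : averages (n + 1) f j.castSucc = localAverage (n + 1) (j + 1) f := rfl
        rw [this, averages]
        nlinarith [sq_nonneg (localAverage n (j + 1) f - localAverage (n + 1) (j + 1) f -
          (localAverage (n + 1) (j + 1) f - flatAverages n l f j))]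
    _ = 2 * ∑ j : Fin n, (localAverage n (j + 1) f - localAverage (n + 1) (j + 1) f) ^ 2 +
          2 * ∑ j : Fin n, (averages (n + 1) f j.castSucc - flatAverages n l f j) ^ 2 := by
        rw [Finset.sum_add_distrib, Finset.mul_sum, Finset.mul_sum]
    _ ≤ _ := by gcongr

/-- The scale of an additional observation is estimated from the last `l` observations. -/
theorem deficiency_scaleLaw_succ_le {α M : ℝ} (h0 : 0 ≤ α) (h1 : α ≤ 1) (hM : 0 < M)
    {S : Set (ℝ → ℝ)} (hS : S ⊆ spectralClass α M) {n l : ℕ} (hl0 : l ≠ 0) (hl : l ≤ n) :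
    deficiency (fun f : S => scaleLaw n f) (fun f : S => scaleLaw (n + 1) f) ≤
      ENNReal.ofReal √(2 * refineError α M l n) + ENNReal.ofReal (√2 * √(sqVariance / l)) +
        ENNReal.ofReal √(2 * refineError α M l n) := by
  have hpi := Real.pi_pos
  have hn : n ≠ 0 := by omega
  have hest : Measurable fun p : (Fin n → ℝ) × ℝ => (p.1, tailScale n l p.1 * p.2) :=
    measurable_fst.prodMk (((measurable_tailScale n l).comp measurable_fst).mul measurable_snd)
  refine deficiency_le_of_prod_map (gaussianReal 0 1)
    (P := fun f : S => scaleLaw n f) ((measurable_appendLast n).comp hest) fun ⟨f, hfS⟩ => ?_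
  have hf := hS hfS
  have hfi : IntegrableOn f (Set.Ioc (-Real.pi) Real.pi) :=
    (intervalIntegrable_iff_integrableOn_Ioc_of_le (by linarith)).1 (intervalIntegrable_of_mem hf)
  have hlow : ∀ (m : ℕ) (j : Fin m), M⁻¹ ≤ averages m f j := fun m j =>
    le_averages hfi (fun x hx => (hf.2 x hx).1) j
  have hflat : ∀ j : Fin n, M⁻¹ ≤ flatAverages n l f j := by
    intro j
    unfold flatAverages
    split_ifs <;> exact hlow _ _
  set σ := averages (n + 1) f (Fin.last n) with hσ
  have hσ0 : 0 < σ := (inv_pos.2 hM).trans_le (hlow _ _)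
  set v : Fin n → ℝ := flatAverages n l f with hv
  set v' : Fin (n + 1) → ℝ := Fin.snoc v σ with hv'
  have hv'low : ∀ j, M⁻¹ ≤ v' j := by
    intro j
    refine Fin.lastCases ?_ (fun j => ?_) j
    · simpa [hv'] using hlow (n + 1) (Fin.last n)
    · simpa [hv'] using hflat j
  set F : Measure (Fin n → ℝ) := Measure.pi fun j => gaussianReal 0 (v j).toNNReal with hF
  set F' : Measure (Fin (n + 1) → ℝ) := Measure.pi fun j => gaussianReal 0 (v' j).toNNReal with hF'
  have hC : 0 ≤ 2 * (2 * M * ((4 * Real.pi) ^ (2 * α) * (4 * Real.pi)) *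
      (n : ℝ) ^ (1 - 2 * α)) := by positivity
  have hT : 0 ≤ l * tailConst α M l * ((n + 1 : ℕ) : ℝ) ^ (1 - 2 * α) := by
    unfold tailConst; positivity
  have b1 : tvDist (scaleLaw (n + 1) f) F' ≤ ENNReal.ofReal √(2 * refineError α M l n) := by
    rw [tvDist_comm]
    refine (tvDist_pi_gaussianReal_le (fun j => (inv_pos.2 hM).trans_le (hv'low j))
      (averages (n + 1) f)).trans (ENNReal.ofReal_le_ofReal (Real.sqrt_le_sqrt ?_))
    refine mul_le_mul_of_nonneg_left ?_ zero_le_two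
    refine (Finset.sum_le_sum fun j _ => sq_div_sub_one_le hM (hv'low j) _).trans ?_
    rw [← Finset.mul_sum, refineError]
    refine mul_le_mul_of_nonneg_left ?_ (sq_nonneg M)
    rw [Fin.sum_univ_castSucc]
    simp only [hv', Fin.snoc_castSucc, Fin.snoc_last]
    have := sum_sq_castSucc_sub_flatAverages_le h0 h1 hf.1 hl
    rw [← hσ, sub_self]
    linarith
  have b3 : tvDist F (scaleLaw n f) ≤ ENNReal.ofReal √(2 * refineError α M l n) := by
    refine (tvDist_pi_gaussianReal_le (fun j => (inv_pos.2 hM).trans_le (hflat j))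
      (averages n f)).trans (ENNReal.ofReal_le_ofReal (Real.sqrt_le_sqrt ?_))
    refine mul_le_mul_of_nonneg_left ?_ zero_le_two
    refine (Finset.sum_le_sum fun j _ => sq_div_sub_one_le hM (hflat j) _).trans ?_
    rw [← Finset.mul_sum, refineError]
    exact mul_le_mul_of_nonneg_left (sum_sq_averages_sub_flatAverages_le h0 h1 hf.1 hn hl)
      (sq_nonneg M)
  have b2 : tvDist F' ((F.prod (gaussianReal 0 1)).map
      (appendLast n ∘ fun p => (p.1, tailScale n l p.1 * p.2))) ≤
      ENNReal.ofReal (√2 * √(sqVariance / l)) := by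
    rw [← Measure.map_map (measurable_appendLast n) hest, hF', pi_eq_map_appendLast]
    simp only [hv', Fin.snoc_castSucc, Fin.snoc_last]
    refine (tvDist_map_le _ _ (measurable_appendLast n)).trans ?_
    have hcard := card_tail hl
    obtain ⟨i1, i2⟩ := integral_abs_mean_sq_sub_one_le (v := v) hσ0
      (T := Finset.univ.filter (fun j : Fin n => n ≤ j + l)) (fun j hj => by
        rw [Finset.mem_filter] at hj
        rw [hv, flatAverages, if_neg (by omega)]) (Finset.card_pos.1 (by omega))
    rw [hcard] at i1 i2
    have e : ∀ z, tailScale n l z ^ 2 = (l : ℝ)⁻¹ *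
        ∑ j ∈ Finset.univ.filter (fun j : Fin n => n ≤ j + l), z j ^ 2 := fun z =>
      Real.sq_sqrt (by positivity)
    refine (tvDist_prod_gaussianReal_le F (measurable_tailScale n l) hσ0
      (by simpa only [e] using i1)).trans (ENNReal.ofReal_le_ofReal ?_)
    simp only [e]
    gcongr
  calc _ ≤ tvDist (scaleLaw (n + 1) f) F' + tvDist F' (((scaleLaw n f).prod (gaussianReal 0 1)).map
        (appendLast n ∘ fun p => (p.1, tailScale n l p.1 * p.2))) := tvDist_triangle _ _ _
    _ ≤ tvDist (scaleLaw (n + 1) f) F' + (tvDist F' ((F.prod (gaussianReal 0 1)).map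
        (appendLast n ∘ fun p => (p.1, tailScale n l p.1 * p.2))) + tvDist F (scaleLaw n f)) := by
      gcongr
      refine (tvDist_triangle _ _ _).trans (add_le_add_right ?_ _)
      exact (tvDist_map_le _ _ ((measurable_appendLast n).comp hest)).trans
        (tvDist_prod_left_le _ _ _)
    _ ≤ _ := by
      rw [← add_assoc]
      gcongr

theorem tendsto_deficiency_scaleLaw_succ {α M : ℝ} (hα : 1 / 2 < α) (h1 : α ≤ 1) (hM : 0 < M)
    {S : Set (ℝ → ℝ)} (hS : S ⊆ spectralClass α M) :
    Tendsto (fun n => deficiency (fun f : S => scaleLaw n f) (fun f : S => scaleLaw (n + 1) f))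
      atTop (𝓝 0) := by
  have hvar : Tendsto (fun l : ℕ => ENNReal.ofReal (√2 * √(sqVariance / l))) atTop (𝓝 0) := by
    have h := (tendsto_const_div_atTop_nhds_zero_nat sqVariance).sqrt.const_mul √2
    simpa using ENNReal.tendsto_ofReal h
  have herr : ∀ l, Tendsto (fun n => ENNReal.ofReal √(2 * refineError α M l n)) atTop (𝓝 0) := by
    intro l
    simpa using ENNReal.tendsto_ofReal ((tendsto_refineError hα M l).const_mul 2).sqrt
  refine ENNReal.tendsto_nhds_zero.2 fun ε hε => ?_
  have hε3 : 0 < ε / 3 := ENNReal.div_pos hε.ne' (by norm_num)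
  obtain ⟨l, hl, hl0⟩ := ((ENNReal.tendsto_nhds_zero.1 hvar _ hε3).and
    (eventually_ne_atTop 0)).exists
  filter_upwards [ENNReal.tendsto_nhds_zero.1 (herr l) _ hε3, eventually_ge_atTop l] with n hn hln
  refine (deficiency_scaleLaw_succ_le (by linarith) h1 hM hS hl0 hln).trans ?_
  calc _ ≤ ε / 3 + ε / 3 + ε / 3 := by gcongr
    _ = ε := ENNReal.add_thirds ε

theorem tendsto_deficiency_scaleLaw_add {α M : ℝ} (hα : 1 / 2 < α) (h1 : α ≤ 1) (hM : 0 < M)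
    {S : Set (ℝ → ℝ)} (hS : S ⊆ spectralClass α M) {r : ℕ} (hr : r ≠ 0) :
    Tendsto (fun n => deficiency (fun f : S => scaleLaw n f) (fun f : S => scaleLaw (n + r) f))
      atTop (𝓝 0) := by
  induction r with
  | zero => exact absurd rfl hr
  | succ r ih =>
    have hstep := tendsto_deficiency_scaleLaw_succ hα h1 hM hS
    rcases Nat.eq_zero_or_pos r with rfl | hr0
    · simpa using hstep
    · have h := (ih hr0.ne').add (hstep.comp (tendsto_add_atTop_nat r))
      rw [add_zero] at h
      exact tendsto_of_tendsto_of_tendsto_of_le_of_le tendsto_const_nhds h (fun _ => zero_le)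
        fun n => deficiency_triangle (fun f : S => scaleLaw n f)
          (fun f : S => scaleLaw (n + r) f) (fun f : S => scaleLaw (n + (r + 1)) f)

end Refinement

/-! ### Asymptotic equivalence -/

section Equivalence

theorem spectralClass_anti {α β : ℝ} (hβ : 0 < β) (h : β ≤ α) (M : ℝ) :
    spectralClass α M ⊆ spectralClass β M := by
  rintro f ⟨⟨hL, hs, hle⟩, hb⟩
  have hk : ∀ k : ℤ, |(k : ℝ)| ^ (2 * β) * ‖fourierCoef f k‖ ^ 2 ≤
      |(k : ℝ)| ^ (2 * α) * ‖fourierCoef f k‖ ^ 2 := by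
    intro k
    refine mul_le_mul_of_nonneg_right ?_ (sq_nonneg _)
    rcases eq_or_ne k 0 with rfl | hk
    · rw [Int.cast_zero, abs_zero, Real.zero_rpow (by linarith), Real.zero_rpow (by linarith)]
    · refine Real.rpow_le_rpow_of_exponent_le ?_ (by linarith)
      exact_mod_cast Int.one_le_abs hk
  have hs' := hs.of_nonneg_of_le (fun k => by positivity) hk
  exact ⟨⟨hL, hs', by linarith [hs'.tsum_le_tsum hk hs]⟩, hb⟩

theorem tendsto_half_rpow_rate {α : ℝ} (hα : 1 / 2 < α) (C : ℝ) :
    Tendsto (fun n : ℕ => C * ((n / 2 : ℕ) : ℝ) ^ (1 - 2 * α)) atTop (𝓝 0) :=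
  (tendsto_natCast_rpow_rate hα C).comp (Nat.tendsto_div_const_atTop two_ne_zero)

theorem tendsto_cutError {α : ℝ} (hα : 1 / 2 < α) (M : ℝ) (r : ℕ) :
    Tendsto (fun n => cutError α M n r) atTop (𝓝 (8 * (M * (r : ℝ) ^ (1 - 2 * α)))) := by
  have h1 := (tendsto_natCast_rpow_rate hα (circConst α M)).comp (tendsto_add_atTop_nat r)
  have h2 := (tendsto_half_rpow_rate hα M).comp (tendsto_add_atTop_nat r)
  simpa [cutError] using ((h1.const_mul 10).add_const (8 * (M * (r : ℝ) ^ (1 - 2 * α)))).add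
    (h2.const_mul 4)

theorem tendsto_foldError {α : ℝ} (hα : 1 / 2 < α) (M : ℝ) (r : ℕ) :
    Tendsto (fun m => foldError α M m r) atTop
      (𝓝 (14 * (foldConst α * (r : ℝ) ^ (1 - 2 * α) * M))) := by
  have h1 := tendsto_natCast_rpow_rate hα (circConst α M)
  have h2 := tendsto_half_rpow_rate hα M
  simpa [foldError] using ((h1.const_mul 14).add_const (14 * (foldConst α * (r : ℝ) ^ (1 - 2 * α) * M))).add
    (h2.const_mul 22)

/-- If the limits `e r` of error terms tend to zero, so do the bounds derived from them: some `r`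
makes the bound eventually small. -/
theorem exists_eventually_ofReal_sqrt_le {E : ℕ → ℕ → ℝ} {e : ℕ → ℝ}
    (hE : ∀ r, Tendsto (E r) atTop (𝓝 (e r))) (he : Tendsto e atTop (𝓝 0)) (c : ℝ) {ε : ℝ≥0∞}
    (hε : 0 < ε) :
    ∃ r ≠ 0, ∀ᶠ n in atTop, ENNReal.ofReal (c * √(2 * E r n)) ≤ ε := by
  have h : Tendsto (fun r => ENNReal.ofReal (c * √(2 * e r))) atTop (𝓝 0) := by
    simpa using ENNReal.tendsto_ofReal ((he.const_mul 2).sqrt.const_mul c)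
  obtain ⟨r, hr, hr0⟩ := ((h.eventually (gt_mem_nhds hε)).and (eventually_ne_atTop 0)).exists
  refine ⟨r, hr0, ?_⟩
  have h2 := ENNReal.tendsto_ofReal (((hE r).const_mul 2).sqrt.const_mul c)
  exact (h2.eventually (gt_mem_nhds hr)).mono fun _ => le_of_lt

theorem tendsto_deficiency_scaleLaw_timeSeriesLaw {α M : ℝ} (hα : 1 / 2 < α) (h1 : α ≤ 1)
    (hM : 0 < M) {S : Set (ℝ → ℝ)} (hS : S ⊆ spectralClass α M) :
    Tendsto (fun n => deficiency (fun f : S => scaleLaw n f) (fun f : S => timeSeriesLaw n f))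
      atTop (𝓝 0) := by
  refine ENNReal.tendsto_nhds_zero.2 fun ε hε => ?_
  have hε2 : 0 < ε / 2 := ENNReal.half_pos hε.ne'
  have he : Tendsto (fun r : ℕ => 8 * (M * (r : ℝ) ^ (1 - 2 * α))) atTop (𝓝 0) := by
    simpa using (tendsto_natCast_rpow_rate hα M).const_mul 8
  obtain ⟨r, hr, h⟩ := exists_eventually_ofReal_sqrt_le (fun r => tendsto_cutError hα M r) he
    (2 * Real.pi * M⁻¹)⁻¹ hε2
  filter_upwards [h, eventually_ne_atTop 0, ENNReal.tendsto_nhds_zero.1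
    (tendsto_deficiency_scaleLaw_add hα h1 hM hS hr) _ hε2] with n hn hn0 hd
  calc _ ≤ _ := deficiency_triangle (fun f : S => scaleLaw n f)
        (fun f : S => scaleLaw (n + r) f) (fun f : S => timeSeriesLaw n f)
    _ ≤ ε / 2 + ε / 2 := by
      gcongr
      exact (deficiency_scaleLaw_timeSeriesLaw_le hα h1 hM hS hr hn0).trans hn
    _ = ε := ENNReal.add_halves ε

theorem tendsto_deficiency_timeSeriesLaw_scaleLaw {α M : ℝ} (hα : 1 / 2 < α) (h1 : α ≤ 1)
    (hM : 0 < M) {S : Set (ℝ → ℝ)} (hS : S ⊆ spectralClass α M) :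
    Tendsto (fun n => deficiency (fun f : S => timeSeriesLaw n f) (fun f : S => scaleLaw n f))
      atTop (𝓝 0) := by
  refine ENNReal.tendsto_nhds_zero.2 fun ε hε => ?_
  have hε2 : 0 < ε / 2 := ENNReal.half_pos hε.ne'
  have he : Tendsto (fun r : ℕ => 14 * (foldConst α * (r : ℝ) ^ (1 - 2 * α) * M)) atTop
      (𝓝 0) := by
    simpa using ((tendsto_natCast_rpow_rate hα (foldConst α)).mul_const M).const_mul 14
  obtain ⟨r, hr, h⟩ := exists_eventually_ofReal_sqrt_le (fun r => tendsto_foldError hα M r) he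
    (2 * Real.pi * M⁻¹)⁻¹ hε2
  have key : ∀ᶠ m in atTop, deficiency (fun f : S => timeSeriesLaw (m + r) f)
      (fun f : S => scaleLaw (m + r) f) ≤ ε := by
    filter_upwards [h, eventually_ge_atTop (2 * r), ENNReal.tendsto_nhds_zero.1
      (tendsto_deficiency_scaleLaw_add hα h1 hM hS hr) _ hε2] with m hm hm2 hd
    have : ∀ f : S, IsProbabilityMeasure (timeSeriesLaw (m + r) f) := inferInstance
    calc _ ≤ _ := deficiency_triangle (fun f : S => timeSeriesLaw (m + r) f)
          (fun f : S => scaleLaw m f) (fun f : S => scaleLaw (m + r) f)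
      _ ≤ ε / 2 + ε / 2 := by
        gcongr
        exact (deficiency_timeSeriesLaw_scaleLaw_le hα h1 hM hS hr hm2).trans hm
      _ = ε := ENNReal.add_halves ε
  filter_upwards [(tendsto_sub_atTop_nat r).eventually key, eventually_ge_atTop r] with n hn hrn
  rwa [Nat.sub_add_cancel hrn] at hn

end Equivalence

end SpectralEquivalence

end

theorem theorem1 (α M : ℝ) (hα : 1 / 2 < α) (hM : 0 < M)
    (S : Set (ℝ → ℝ)) (hS : S ⊆ SpectralEquivalence.spectralClass α M) :
    SpectralEquivalence.AsympEquiv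
      (fun (n : ℕ) (f : S) => SpectralEquivalence.timeSeriesLaw n f)
      (fun (n : ℕ) (f : S) => SpectralEquivalence.scaleLaw n f) := by
  have hβ : 1 / 2 < min α 1 := lt_min hα (by norm_num)
  have hS' : S ⊆ SpectralEquivalence.spectralClass (min α 1) M :=
    hS.trans (SpectralEquivalence.spectralClass_anti (by linarith) (min_le_left _ _) M)
  have h := (SpectralEquivalence.tendsto_deficiency_timeSeriesLaw_scaleLaw hβ (min_le_right _ _)
    hM hS').max (SpectralEquivalence.tendsto_deficiency_scaleLaw_timeSeriesLaw hβ
    (min_le_right _ _) hM hS')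
  rwa [max_self] at h
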